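/- Let $m,k$ be integers with $1\le k<m$, and let $\mathcal Cl_m$ be the real Clifford algebra generated by $\mathbb R^m$ with $x^2=-\|x\|^2$, with standard orthonormal basis $e_1,\dots,e_m$ of $\mathbb R^m$. For $\mathcal Cl_m$-valued functions $f(x,u)$ put $D_x=\sum e_i\partial_{x_i}$, $\langle u,D_x\rangle=\sum u_i\partial_{x_i}$, $\langle D_u,D_x\rangle=\sum\partial_{u_i}\partial_{x_i}$, and $$\mathcal D_{1,2n}=\Delta_x^n-\tfrac{4n}{m+2n-2}\langle u,D_x\rangle\langle D_u,D_x\rangle\Delta_x^{n-1},$$ $$\mathcal D_{1,2n-1}=D_x\Delta_x^{n-1}-\tfrac{2}{m+2n-2}\,u\langle D_u,D_x\rangle\Delta_x^{n-1}-\tfrac{4n-4}{m+2n-2}\langle u,D_x\rangle\langle D_u,D_x\rangle\Delta_x^{n-2}D_x$$ (for $n=1$ the last term is absent). Let $Z_1(u,v)$ be the reproducing kernel of the $\mathcal Cl_m$-valued homogeneous polynomials of degree one that are harmonic ($k$ even) or left monogenic ($k$ odd), with respect to $\int_{S^{m-1}}\overline{f}\,g\,dS$. It exists, is unique, and equals $m\langle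 u,v\rangle/|S^{m-1}|$ for $k$ even and $(m\langle u,v\rangle+uv)/|S^{m-1}|$ for $k$ odd. Let $G_k(x)=\|x\|^{k-m}$ for $k$ even, $G_k(x)=x\|x\|^{k-1-m}$ for $k$ odd, and, for a real constant $c_1\ne0$, $$E_{1,k}(x,u,v)=c_1\,G_k(x)\,Z_1\Big(\frac{xux}{\|x\|^2},v\Big).$$ Let $1\le p\le l$, $\mathbb Z^l=\mathbb Ze_1+\dots+\mathbb Ze_l$, $C_l=\mathbb R^m/\mathbb Z^l$ with projection $\pi_l$; write elements of $\mathbb Z^l$ as $\mathbf m+\mathbf n$ with $\mathbf m=m_1e_1+\dots+m_pe_p$ and $\mathbf n\in\mathbb Ze_{p+1}+\dots+\mathbb Ze_l$. Let $E^p$ be the bundle over $C_l$ obtained from $\mathbb R^m\times\mathcal Cl_m$ by identifying $(x,X)$ with $(x+\mathbf m+\mathbf n,(-1)^{m_1+\dots+m_p}X)$. A section $f'(x',u)$ of $E^p$ over an open $U'\subseteq C_l$ has a lift $f$ with $f'(\pi_l(x),u)=[(x,f(x,u))]$, and $\mathcal D_{1,k}$ induces the operator $\mathcal D'_{1,k}f'(\pi_l(x),u)=[(x,\mathcal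 D_{1,k}f(x,u))]$ on such sections. (1) If $1\le l\le m-k-1$, then for all $u,v\in\mathbb R^m$ the series $$cot_{l,1,k,p}(x,u,v)=\sum_{\mathbf m,\mathbf n}(-1)^{m_1+\dots+m_p}E_{1,k}(x+\mathbf m+\mathbf n,u,v)$$ converges normally on $\mathbb R^m\setminus\mathbb Z^l$ (that is, on every compact subset it is dominated by a convergent series of constants). (2) If $l=m-k$, let $\Lambda_l$ be the set of nonzero elements of $\mathbb Z^l$ whose last nonzero coordinate is positive. Then for all $u,v\in\mathbb R^m$ the symmetrized series $$cot_{m-k,1,k,p}(x,u,v)=E_{1,k}(x,u,v)+\sum_{\mathbf m+\mathbf n\in\Lambda_l}(-1)^{m_1+\dots+m_p}\big[E_{1,k}(x+\mathbf m+\mathbf n,u,v)+E_{1,k}(x-\mathbf m-\mathbf n,u,v)\big],$$ summed as the limit for $N\to\infty$ of the partial sums over the elements of $\Lambda_l$ with coordinates of absolute value at most $N$, converges locally uniformly on $\mathbb R^m\setminus\mathbb Z^l$. If $k$ is odd, the series converges normally there (to the same function). (3) In both cases, for $x\in\mathbb R^m\setminus\mathbb Z^l$ and $u,v\in\mathbb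 R^m$, the function $cot_{l,1,k,p}(x,u,v)$ is smooth in $(x,u)$ and is, as a function of $u$, a homogeneous polynomial of degree one, harmonic if $k$ is even and left monogenic if $k$ is odd. It satisfies $cot_{l,1,k,p}(x+\mathbf m+\mathbf n,u,v)=(-1)^{m_1+\dots+m_p}cot_{l,1,k,p}(x,u,v)$ and $\mathcal D_{1,k}\,cot_{l,1,k,p}=0$. Consequently $cot_{l,1,k,p}(x-y,u,v)$ projects to a unique well defined kernel $cot'_{l,1,k,p}(x',y',u,v):E^p_{y'}\to E^p_{x'}$ on $(C_l\times C_l)\setminus\mathrm{diagonal}$, given by $$cot'_{l,1,k,p}(\pi_l(x),\pi_l(y),u,v)\,[(y,Y)]=[(x,cot_{l,1,k,p}(x-y,u,v)\,Y)]$$ for all representatives $x,y$ and all $Y\in\mathcal Cl_m$; and for all $y'$, $v$ and $\eta\in E^p_{y'}$ the section $(x',u)\mapsto cot'_{l,1,k,p}(x',y',u,v)\eta$ of $E^p$ over $C_l\setminus\{y'\}$ is annihilated by $\mathcal D'_{1,k}$. -/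

import Mathlib

open Set Filter Topology MeasureTheory
open scoped ContDiff RealInnerProductSpace

noncomputable section

namespace SpinCylinder

/-! ### The Clifford algebra `Cl_m` -/

/-- Euclidean space `ℝ^m`. -/
abbrev Vec (m : ℕ) : Type := EuclideanSpace ℝ (Fin m)

/-- The quadratic form `x ↦ -‖x‖²`. -/
def negSq (m : ℕ) : QuadraticForm ℝ (Vec m) := -LinearMap.BilinMap.toQuadraticMap (innerₗ (Vec m))

theorem negSq_apply (m : ℕ) (x : Vec m) : negSq m x = -‖x‖ ^ 2 := by
  simp [negSq]

/-- The real Clifford algebra `Cl_m`, in which `x² = -‖x‖²` for `x ∈ ℝ^m`. -/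
abbrev Cl (m : ℕ) : Type := CliffordAlgebra (negSq m)

/-- The inclusion `ℝ^m ⊆ Cl_m`. -/
abbrev vec {m : ℕ} (x : Vec m) : Cl m := CliffordAlgebra.ι (negSq m) x

/-- The standard orthonormal basis vector `e_i` of `ℝ^m`. -/
abbrev e {m : ℕ} (i : Fin m) : Vec m := EuclideanSpace.single i 1

/-- Indices of the basis `e_A`: subsets `A` of `{1, …, m}`, sorted by their cardinality. -/
abbrev Blade (m : ℕ) : Type := Σ n : ℕ, Set.powersetCard (Fin m) n

instance (m : ℕ) : Finite (Blade m) := by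
  refine Finite.of_injective (fun A : Blade m => (A.2 : Finset (Fin m))) ?_
  rintro ⟨n, A, hA⟩ ⟨n', A', hA'⟩ h
  change A = A' at h
  subst h
  have h1 : A.card = n := hA
  have h2 : A.card = n' := hA'
  subst h1
  subst h2
  rfl

instance (m : ℕ) : Fintype (Blade m) := Fintype.ofFinite _

/-- The standard basis `e_A = e_{j_1} ⋯ e_{j_r}` of `Cl_m` (under the linear isomorphism with the
exterior algebra it is the basis of exterior products of the `e_j`). -/
def bladeBasis (m : ℕ) : Module.Basis (Blade m) ℝ (Cl m) :=
  ((DirectSum.Decomposition.isInternal (fun n : ℕ => ⋀[ℝ]^n (Vec m))).collectedBasis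
    (fun n => (EuclideanSpace.basisFun (Fin m) ℝ).toBasis.exteriorPower n)).map
    (CliffordAlgebra.equivExterior (negSq m)).symm

instance (m : ℕ) : FiniteDimensional ℝ (Cl m) := (bladeBasis m).finiteDimensional_of_finite

/-- The linear isomorphism `a = ∑ a_A e_A ↦ (a_A)_A`. -/
def bladeCoord (m : ℕ) : Cl m ≃ₗ[ℝ] EuclideanSpace ℝ (Blade m) :=
  (bladeBasis m).equivFun.trans (WithLp.linearEquiv 2 ℝ (Blade m → ℝ)).symm

/-- The norm `‖∑ a_A e_A‖ = (∑ a_A²)^{1/2}` on `Cl_m`. -/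
instance instNormedCl (m : ℕ) : NormedAddCommGroup (Cl m) :=
  NormedAddCommGroup.induced (Cl m) (EuclideanSpace ℝ (Blade m)) (bladeCoord m)
    (bladeCoord m).injective

instance instNormedSpaceCl (m : ℕ) : NormedSpace ℝ (Cl m) :=
  NormedSpace.induced ℝ (Cl m) (EuclideanSpace ℝ (Blade m)) (bladeCoord m)

/-! ### The differential operators

They act on functions `f(x, u)` on `ℝ^m × ℝ^m` with values in `Cl_m`. -/

/-- Functions `f(x, u)` with values in `Cl_m`. -/
abbrev Fun₂ (m : ℕ) : Type := Vec m → Vec m → Cl m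

/-- `∂_{x_i}`. -/
def dX {m : ℕ} (i : Fin m) (f : Fun₂ m) : Fun₂ m :=
  fun x u => lineDeriv ℝ (fun y => f y u) x (e i)

/-- `∂_{u_i}`. -/
def dU {m : ℕ} (i : Fin m) (f : Fun₂ m) : Fun₂ m :=
  fun x u => lineDeriv ℝ (fun w => f x w) u (e i)

/-- The Dirac operator `D_x = ∑ e_i ∂_{x_i}`. -/
def diracX {m : ℕ} (f : Fun₂ m) : Fun₂ m :=
  fun x u => ∑ i, vec (e i) * dX i f x u

/-- The Laplace operator `Δ_x`. -/
def lapX {m : ℕ} (f : Fun₂ m) : Fun₂ m :=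
  fun x u => Laplacian.laplacian (fun y => f y u) x

/-- `⟨u, D_x⟩ = ∑ u_i ∂_{x_i}`. -/
def innerUDx {m : ℕ} (f : Fun₂ m) : Fun₂ m :=
  fun x u => ∑ i, u i • dX i f x u

/-- `⟨D_u, D_x⟩ = ∑ ∂_{u_i} ∂_{x_i}`. -/
def innerDuDx {m : ℕ} (f : Fun₂ m) : Fun₂ m :=
  fun x u => ∑ i, dU i (dX i f) x u

/-- The bosonic operator
`D_{1,2n} = Δ_x^n - 4n/(m+2n-2) ⟨u,D_x⟩ ⟨D_u,D_x⟩ Δ_x^{n-1}` for `n ≥ 1`. -/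
def bosonic {m : ℕ} (n : ℕ) (f : Fun₂ m) : Fun₂ m := fun x u =>
  (lapX^[n] f) x u
    - (4 * (n : ℝ) / ((m : ℝ) + 2 * n - 2)) • innerUDx (innerDuDx (lapX^[n - 1] f)) x u

/-- The fermionic operator
`D_{1,2n-1} = D_x Δ_x^{n-1} - 2/(m+2n-2) u ⟨D_u,D_x⟩ Δ_x^{n-1}
  - (4n-4)/(m+2n-2) ⟨u,D_x⟩ ⟨D_u,D_x⟩ Δ_x^{n-2} D_x` for `n ≥ 1`.
For `n = 1` the coefficient of the last term is zero. -/
def fermionic {m : ℕ} (n : ℕ) (f : Fun₂ m) : Fun₂ m := fun x u =>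
  diracX (lapX^[n - 1] f) x u
    - (2 / ((m : ℝ) + 2 * n - 2)) • (vec u * innerDuDx (lapX^[n - 1] f) x u)
    - ((4 * (n : ℝ) - 4) / ((m : ℝ) + 2 * n - 2)) •
        innerUDx (innerDuDx (lapX^[n - 2] (diracX f))) x u

open Classical in
/-- The higher order higher spin operator `D_{1,k}` on `ℝ^m`. -/
def opD {m : ℕ} (k : ℕ) (f : Fun₂ m) : Fun₂ m :=
  if Even k then bosonic (k / 2) f else fermionic ((k + 1) / 2) f

/-! ### The reproducing kernel and the fundamental solution -/

/-- The Dirac operator `D_u` on functions of `u` alone. -/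
def diracU {m : ℕ} (g : Vec m → Cl m) : Vec m → Cl m :=
  fun u => ∑ i, vec (e i) * lineDeriv ℝ g u (e i)

/-- `Cl_m`-valued homogeneous polynomials of degree one on `ℝ^m` (that is, linear maps) which are
harmonic if `k` is even and (left) monogenic if `k` is odd. -/
def degreeOne (m k : ℕ) : Set (Vec m → Cl m) :=
  {g | (∃ L : Vec m →ₗ[ℝ] Cl m, ∀ u, g u = L u) ∧
    (Even k → ∀ u, Laplacian.laplacian g u = 0) ∧ (¬ Even k → ∀ u, diracU g u = 0)}

/-- `Z` is the reproducing kernel of `degreeOne m k` with respect to the inner product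
`∫_{S^{m-1}} \bar f g dS`; here `star` is the Clifford conjugation. -/
def IsReproducingKernel (m k : ℕ) (Z : Vec m → Vec m → Cl m) : Prop :=
  (∀ v, (fun u => Z u v) ∈ degreeOne m k) ∧
  ∀ g ∈ degreeOne m k, ∀ v,
    g v = ∫ u : Metric.sphere (0 : Vec m) 1, star (Z u v) * g u ∂(volume : Measure (Vec m)).toSphere

/-- The surface area of the unit sphere `S^{m-1}`. -/
def sphereArea (m : ℕ) : ℝ := (volume : Measure (Vec m)).toSphere.real univ

open Classical in
/-- The kernel `Z_1(u, v)`: `m⟨u,v⟩ / |S^{m-1}|` for even `k`, `(m⟨u,v⟩ + uv) / |S^{m-1}|` for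
odd `k`. -/
def Z₁ (m k : ℕ) (u v : Vec m) : Cl m :=
  (sphereArea m)⁻¹ • (algebraMap ℝ (Cl m) (m * ⟪u, v⟫) + if Even k then 0 else vec u * vec v)

open Classical in
/-- `G_k(x)`: `1/‖x‖^{m-k}` for even `k` and `x/‖x‖^{m-k+1}` for odd `k`. -/
def G (m k : ℕ) (x : Vec m) : Cl m :=
  if Even k then algebraMap ℝ (Cl m) (1 / ‖x‖ ^ ((m : ℤ) - k))
  else (1 / ‖x‖ ^ ((m : ℤ) - k + 1)) • vec x

/-- The vector `x u x` of `ℝ^m ⊆ Cl_m`; see `vec_sandwich`. -/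
def sandwich {m : ℕ} (x u : Vec m) : Vec m := ‖x‖ ^ 2 • u - (2 * ⟪x, u⟫) • x

theorem vec_sandwich {m : ℕ} (x u : Vec m) : vec (sandwich x u) = vec x * vec u * vec x := by
  have h1 : vec x * vec u = -(vec u * vec x) + algebraMap ℝ (Cl m) (-(2 * ⟪x, u⟫)) := by
    have h := CliffordAlgebra.ι_mul_ι_add_swap (Q := negSq m) x u
    have hp : QuadraticMap.polar (negSq m) x u = -(2 * ⟪x, u⟫) := by
      simp only [QuadraticMap.polar, negSq_apply, norm_add_sq_real]
      ring
    rw [hp] at h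
    rw [← h]
    abel
  have h2 : vec x * vec x = algebraMap ℝ (Cl m) (-‖x‖ ^ 2) := by
    rw [CliffordAlgebra.ι_sq_scalar, negSq_apply]
  rw [h1, add_mul, neg_mul, mul_assoc, h2, ← Algebra.commutes, Algebra.algebraMap_eq_smul_one,
    Algebra.algebraMap_eq_smul_one, smul_mul_assoc, smul_mul_assoc, one_mul, one_mul]
  simp only [sandwich, map_sub, map_smul, neg_smul, neg_neg]
  abel

/-- `E_{1,k}(x,u,v) = c_1 G_k(x) Z_1(xux/‖x‖², v)`. -/
def E (m k : ℕ) (c₁ : ℝ) (x u v : Vec m) : Cl m :=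
  c₁ • (G m k x * Z₁ m k ((‖x‖ ^ 2)⁻¹ • sandwich x u) v)

/-! ### The lattice, the cylinder and the spinor bundle `E^p` -/

/-- Integer vectors `(m_1, …, m_l, 0, …, 0)`. -/
def Lat (m l : ℕ) : AddSubgroup (Fin m → ℤ) where
  carrier := {a | ∀ i : Fin m, l ≤ (i : ℕ) → a i = 0}
  zero_mem' := fun _ _ => rfl
  add_mem' := fun {a b} ha hb i hi => by simp [ha i hi, hb i hi]
  neg_mem' := fun {a} ha i hi => by simp [ha i hi]

/-- `(m_1, m_2, …) ↦ m_1 e_1 + m_2 e_2 + ⋯`. -/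
def emb (m : ℕ) : (Fin m → ℤ) →+ Vec m where
  toFun a := WithLp.toLp 2 (fun i => (a i : ℝ))
  map_zero' := by ext i; simp
  map_add' a b := by ext i; simp

theorem emb_injective (m : ℕ) : Function.Injective (emb m) := by
  intro a b h
  funext i
  have h' := congrArg (fun z : Vec m => z i) h
  simpa [emb] using h'

/-- The lattice `ℤ^l = ℤ e_1 + ⋯ + ℤ e_l` in `ℝ^m`. -/
def lattice (m l : ℕ) : AddSubgroup (Vec m) := (Lat m l).map (emb m)

/-- The sign `(-1)^{m_1 + ⋯ + m_p}`. -/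
def sgn {m : ℕ} (p : ℕ) (a : Fin m → ℤ) : ℝ :=
  (-1 : ℝ) ^ (∑ i : Fin m, if (i : ℕ) < p then a i else 0)

theorem sgn_zero {m : ℕ} (p : ℕ) : sgn p (0 : Fin m → ℤ) = 1 := by simp [sgn]

theorem sgn_add {m : ℕ} (p : ℕ) (a b : Fin m → ℤ) : sgn p (a + b) = sgn p a * sgn p b := by
  unfold sgn
  rw [← zpow_add₀ (by norm_num), ← Finset.sum_add_distrib]
  congr 1
  refine Finset.sum_congr rfl fun i _ => ?_
  split_ifs <;> simp

theorem sgn_cases {m : ℕ} (p : ℕ) (a : Fin m → ℤ) : sgn p a = 1 ∨ sgn p a = -1 := by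
  unfold sgn
  rcases Int.even_or_odd (∑ i : Fin m, if (i : ℕ) < p then a i else 0) with h | h
  · exact Or.inl h.neg_one_zpow
  · exact Or.inr h.neg_one_zpow

theorem sgn_neg_mul {m : ℕ} (p : ℕ) (a : Fin m → ℤ) : sgn p (-a) * sgn p a = 1 := by
  rw [← sgn_add, neg_add_cancel, sgn_zero]

/-- The cylinder `C_l = ℝ^m / ℤ^l`. -/
abbrev Cyl (m l : ℕ) : Type := Vec m ⧸ lattice m l

/-- The projection `π_l : ℝ^m → C_l`. -/
abbrev proj (m l : ℕ) (x : Vec m) : Cyl m l := QuotientAddGroup.mk x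

theorem proj_eq_iff {m l : ℕ} {x y : Vec m} :
    proj m l x = proj m l y ↔ ∃ a ∈ Lat m l, y = x + emb m a := by
  rw [QuotientAddGroup.eq]
  constructor
  · rintro ⟨a, ha, h⟩
    exact ⟨a, ha, by rw [h]; abel⟩
  · rintro ⟨a, ha, h⟩
    exact ⟨a, ha, by rw [h]; abel⟩

/-- The identification of `(x, X)` with `(x + 𝐦 + 𝐧, (-1)^{m_1 + ⋯ + m_p} X)`. -/
def bundleSetoid (m l p : ℕ) : Setoid (Vec m × Cl m) where
  r P Q := ∃ a ∈ Lat m l, Q.1 = P.1 + emb m a ∧ Q.2 = sgn p a • P.2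
  iseqv := by
    refine ⟨fun P => ⟨0, zero_mem _, by simp, by simp [sgn_zero]⟩, ?_, ?_⟩
    · rintro P Q ⟨a, ha, h1, h2⟩
      exact ⟨-a, neg_mem ha, by simp [h1], by rw [h2, smul_smul, sgn_neg_mul, one_smul]⟩
    · rintro P Q R ⟨a, ha, h1, h2⟩ ⟨b, hb, h3, h4⟩
      refine ⟨a + b, add_mem ha hb, by rw [h3, h1, map_add, add_assoc], ?_⟩
      rw [h4, h2, smul_smul, ← sgn_add, add_comm b a]

/-- The total space of the spinor bundle `E^p` over `C_l`. -/
def Bundle (m l p : ℕ) : Type := Quotient (bundleSetoid m l p)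

/-- The class of `(x, X)` in `E^p`. -/
def Bundle.mk {m : ℕ} (l p : ℕ) (x : Vec m) (X : Cl m) : Bundle m l p :=
  Quotient.mk (bundleSetoid m l p) (x, X)

theorem Bundle.mk_eq_iff {m l p : ℕ} {x y : Vec m} {X Y : Cl m} :
    Bundle.mk l p x X = Bundle.mk l p y Y ↔
      ∃ a ∈ Lat m l, y = x + emb m a ∧ Y = sgn p a • X :=
  Quotient.eq (r := bundleSetoid m l p)

/-- The bundle projection `E^p → C_l`. -/
def Bundle.base {m l p : ℕ} : Bundle m l p → Cyl m l :=
  Quotient.lift (fun P => proj m l P.1) (by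
    rintro P Q ⟨a, ha, h, -⟩
    exact proj_eq_iff.2 ⟨a, ha, h⟩)

/-- The fibre of `E^p` over a point of `C_l`. -/
def Fiber {m l : ℕ} (p : ℕ) (x' : Cyl m l) : Type := {ξ : Bundle m l p // ξ.base = x'}

/-- The class of `(x, X)` as a point of the fibre over `π_l(x)`. -/
def Fiber.mk {m : ℕ} (l p : ℕ) (x : Vec m) (X : Cl m) : Fiber p (proj m l x) :=
  ⟨Bundle.mk l p x X, rfl⟩

theorem Fiber.exists_rep {m l p : ℕ} (x : Vec m) (ξ : Fiber p (proj m l x)) :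
    ∃ X, ξ = Fiber.mk l p x X := by
  obtain ⟨ξ, hξ⟩ := ξ
  induction ξ using Quotient.inductionOn with
  | _ P =>
    obtain ⟨y, Y⟩ := P
    obtain ⟨a, ha, h⟩ := proj_eq_iff.1 (show proj m l y = proj m l x from hξ)
    exact ⟨sgn p a • Y, Subtype.ext (Bundle.mk_eq_iff.2 ⟨a, ha, h, rfl⟩)⟩

/-- The element `X` of `Cl_m` with `ξ = [(x, X)]`. -/
def Fiber.coord {m l p : ℕ} (x : Vec m) (ξ : Fiber p (proj m l x)) : Cl m :=
  (Fiber.exists_rep x ξ).choose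

theorem Fiber.mk_coord {m l p : ℕ} (x : Vec m) (ξ : Fiber p (proj m l x)) :
    Fiber.mk l p x (Fiber.coord x ξ) = ξ :=
  (Fiber.exists_rep x ξ).choose_spec.symm

theorem Fiber.mk_injective {m l p : ℕ} (x : Vec m) : Function.Injective (Fiber.mk l p x) := by
  intro X Y h
  obtain ⟨a, -, h1, h2⟩ := Bundle.mk_eq_iff.1 (congrArg Subtype.val h)
  have h3 : emb m a = emb m 0 := by
    rw [map_zero]
    exact (left_eq_add.1 h1)
  rw [emb_injective m h3, sgn_zero, one_smul] at h2
  exact h2.symm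

theorem Fiber.coord_mk {m l p : ℕ} (x : Vec m) (X : Cl m) :
    Fiber.coord x (Fiber.mk l p x X) = X :=
  Fiber.mk_injective x (Fiber.mk_coord x _)

/-- The zero vector of the fibre over `x'`. -/
def Fiber.zero {m l : ℕ} (p : ℕ) (x' : Cyl m l) : Fiber p x' :=
  ⟨Quotient.lift (fun x : Vec m => Bundle.mk l p x 0) (by
      intro x y h
      obtain ⟨a, ha, h⟩ := proj_eq_iff.1 (Quotient.sound h : proj m l x = proj m l y)
      exact Bundle.mk_eq_iff.2 ⟨a, ha, h, by simp⟩) x', by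
    induction x' using Quotient.inductionOn with
    | _ x => rfl⟩

/-! ### The operator on sections of `E^p` -/

/-- Sections `f'(x', u)` of `E^p` over `U' ⊆ C_l`, depending on the variable `u`. -/
abbrev Sec {m l : ℕ} (p : ℕ) (U' : Set (Cyl m l)) : Type :=
  (x' : U') → Vec m → Fiber p x'.1

open Classical in
/-- The lift of a section to `ℝ^m`: `f'(π_l(x), u) = [(x, f(x, u))]` for `π_l(x) ∈ U'`
(extended by zero outside the preimage of `U'`). -/
def Sec.lift {m l p : ℕ} {U' : Set (Cyl m l)} (s : Sec p U') : Fun₂ m := fun x u =>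
  if h : proj m l x ∈ U' then Fiber.coord x (s ⟨proj m l x, h⟩ u) else 0

theorem Sec.lift_add {m l p : ℕ} {U' : Set (Cyl m l)} (s : Sec p U') {a : Fin m → ℤ}
    (ha : a ∈ Lat m l) (x u : Vec m) : s.lift (x + emb m a) u = sgn p a • s.lift x u := by
  have hx : proj m l x = proj m l (x + emb m a) := proj_eq_iff.2 ⟨a, ha, rfl⟩
  by_cases h : proj m l x ∈ U'
  · have h' : proj m l (x + emb m a) ∈ U' := hx ▸ h
    simp only [Sec.lift, dif_pos h, dif_pos h']
    have key : (s ⟨proj m l x, h⟩ u).1 = (s ⟨proj m l (x + emb m a), h'⟩ u).1 := by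
      have : (⟨proj m l x, h⟩ : U') = ⟨proj m l (x + emb m a), h'⟩ := Subtype.ext hx
      rw [this]
    apply Fiber.mk_injective (l := l) (p := p) (x + emb m a)
    rw [Fiber.mk_coord]
    apply Subtype.ext
    rw [← key]
    conv_lhs => rw [← Fiber.mk_coord x (s ⟨proj m l x, h⟩ u)]
    exact Bundle.mk_eq_iff.2 ⟨a, ha, rfl, rfl⟩
  · have h' : proj m l (x + emb m a) ∉ U' := hx ▸ h
    simp only [Sec.lift, dif_neg h, dif_neg h', smul_zero]

/-- `f(x + t, u) = ε f(x, u)`. -/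
def Equivar {m : ℕ} (t : Vec m) (ε : ℝ) (f : Fun₂ m) : Prop :=
  ∀ x u, f (x + t) u = ε • f x u

section Equivariance

variable {m : ℕ} {t : Vec m} {ε : ℝ} {f : Fun₂ m}

theorem Equivar.dX (h : Equivar t ε f) (i : Fin m) : Equivar t ε (dX i f) := by
  intro x u
  have : (fun s : ℝ => f (x + t + s • e i) u) = fun s : ℝ => ε • f (x + s • e i) u := by
    funext s
    rw [← h, add_right_comm]
  simp only [SpinCylinder.dX, lineDeriv, this]
  exact deriv_const_smul_field ε _

theorem Equivar.dU (h : Equivar t ε f) (i : Fin m) : Equivar t ε (dU i f) := by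
  intro x u
  simp only [SpinCylinder.dU, lineDeriv, h x]
  exact deriv_const_smul_field ε _

theorem Equivar.diracX (h : Equivar t ε f) : Equivar t ε (diracX f) := by
  intro x u
  simp only [SpinCylinder.diracX, h.dX _ x u, mul_smul_comm, Finset.smul_sum]

theorem Equivar.innerUDx (h : Equivar t ε f) : Equivar t ε (innerUDx f) := by
  intro x u
  simp only [SpinCylinder.innerUDx, h.dX _ x u, Finset.smul_sum]
  exact Finset.sum_congr rfl fun i _ => smul_comm _ _ _

theorem Equivar.innerDuDx (h : Equivar t ε f) : Equivar t ε (innerDuDx f) := by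
  intro x u
  simp only [SpinCylinder.innerDuDx, (h.dX _).dU _ x u, Finset.smul_sum]

theorem Equivar.lapX (hε : ε = 1 ∨ ε = -1) (h : Equivar t ε f) : Equivar t ε (lapX f) := by
  intro x u
  have h1 : Laplacian.laplacian (fun y => f y u) (x + t)
      = Laplacian.laplacian (fun y => f (y + t) u) x := by
    simp only [InnerProductSpace.laplacian_eq_iteratedFDeriv_stdOrthonormalBasis]
    refine Finset.sum_congr rfl fun i _ => ?_
    rw [iteratedFDeriv_comp_add_right (f := fun y => f y u) 2 t x]
  simp only [SpinCylinder.lapX, h1, h _ u]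
  rcases hε with rfl | rfl
  · simp
  · have h2 : (fun y => (-1 : ℝ) • f y u) = -(fun y => f y u) := by funext y; simp
    rw [h2, InnerProductSpace.laplacian_neg]
    simp

theorem Equivar.lapX_iterate (hε : ε = 1 ∨ ε = -1) (h : Equivar t ε f) (n : ℕ) :
    Equivar t ε (SpinCylinder.lapX^[n] f) := by
  induction n with
  | zero => exact h
  | succ n ih =>
    rw [Function.iterate_succ_apply']
    exact ih.lapX hε

theorem Equivar.opD (hε : ε = 1 ∨ ε = -1) (h : Equivar t ε f) (k : ℕ) :
    Equivar t ε (opD k f) := by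
  intro x u
  unfold SpinCylinder.opD
  split_ifs
  · simp only [bosonic, h.lapX_iterate hε _ x u,
      (h.lapX_iterate hε _).innerDuDx.innerUDx x u, smul_sub]
    rw [smul_comm]
  · simp only [fermionic, (h.lapX_iterate hε _).diracX x u, (h.lapX_iterate hε _).innerDuDx x u,
      (h.diracX.lapX_iterate hε _).innerDuDx.innerUDx x u, smul_sub, mul_smul_comm]
    rw [smul_comm ε, smul_comm ε]

end Equivariance

/-- The operator induced by `D_{1,k}` on sections of `E^p`: if `f'` lifts to `f`, the value at
`π_l(x)` is the class of `(x, (D_{1,k} f)(x, u))`, for any representative `x`. -/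
def Sec.opD {m l p : ℕ} {U' : Set (Cyl m l)} (k : ℕ) (s : Sec p U') : Sec p U' := fun x' u =>
  ⟨Quotient.lift (fun x : Vec m => Bundle.mk l p x (SpinCylinder.opD k s.lift x u)) (by
      intro x y h
      obtain ⟨a, ha, rfl⟩ := proj_eq_iff.1 (Quotient.sound h : proj m l x = proj m l y)
      exact Bundle.mk_eq_iff.2 ⟨a, ha, rfl,
        Equivar.opD (sgn_cases p a) (fun x u => s.lift_add ha x u) k x u⟩) x'.1, by
    obtain ⟨x', hx'⟩ := x'
    induction x' using Quotient.inductionOn with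
    | _ x => rfl⟩

/-! ### The cotangent kernels -/

/-- Normal convergence of the series `∑ f_i` on `S`: on each compact subset of `S` it is dominated
by a convergent series of constants. -/
def ConvergesNormallyOn {ι : Type} {m : ℕ} (f : ι → Vec m → Cl m) (S : Set (Vec m)) : Prop :=
  ∀ K ⊆ S, IsCompact K → ∃ b : ι → ℝ, Summable b ∧ ∀ i, ∀ x ∈ K, ‖f i x‖ ≤ b i

/-- The terms `(-1)^{m_1+⋯+m_p} E_{1,k}(x + 𝐦 + 𝐧, u, v)`. -/
def twistTerm (m l k p : ℕ) (c₁ : ℝ) (u v : Vec m) (a : Lat m l) (x : Vec m) : Cl m :=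
  sgn p a.1 • E m k c₁ (x + emb m a) u v

/-- `cot_{l,1,k,p}(x,u,v)` for `l ≤ m-k-1`. -/
def cot (m l k p : ℕ) (c₁ : ℝ) (x u v : Vec m) : Cl m :=
  ∑' a : Lat m l, twistTerm m l k p c₁ u v a x

/-- The positive part `Λ_l` of the lattice: the vectors `m_1 e_1 + ⋯ + m_j e_j` with `j ≤ l` and
`m_j > 0`. -/
def latPos (m l : ℕ) : Set (Fin m → ℤ) :=
  {a | a ∈ Lat m l ∧ ∃ j, 0 < a j ∧ ∀ i, j < i → a i = 0}

open Classical in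
/-- The elements of `Λ_l` with coordinates of absolute value at most `N`. -/
def posBox (m l N : ℕ) : Finset (Fin m → ℤ) :=
  (Fintype.piFinset fun _ => Finset.Icc (-(N : ℤ)) N).filter (· ∈ latPos m l)

/-- The terms `(-1)^{m_1+⋯+m_p} [E_{1,k}(x + 𝐦 + 𝐧, u, v) + E_{1,k}(x - 𝐦 - 𝐧, u, v)]`. -/
def symTerm (m k p : ℕ) (c₁ : ℝ) (u v : Vec m) (a : Fin m → ℤ) (x : Vec m) : Cl m :=
  sgn p a • (E m k c₁ (x + emb m a) u v + E m k c₁ (x - emb m a) u v)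

/-- The partial sums of the symmetrized series over `posBox m l N`. -/
def symPartial (m l k p : ℕ) (c₁ : ℝ) (u v : Vec m) (N : ℕ) (x : Vec m) : Cl m :=
  E m k c₁ x u v + ∑ a ∈ posBox m l N, symTerm m k p c₁ u v a x

/-- The symmetrized `cot_{l,1,k,p}(x,u,v)` for `l = m-k`, as the limit of its partial sums. -/
def cotSym (m l k p : ℕ) (c₁ : ℝ) (x u v : Vec m) : Cl m :=
  limUnder atTop (fun N => symPartial m l k p c₁ u v N x)

/-- `c(x,u,v)` is a sign-twisted kernel of `D_{1,k}` on `ℝ^m \ ℤ^l`: it is smooth there, a harmonic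
or monogenic polynomial of degree one in `u`, sign-periodic, and annihilated by `D_{1,k}`. -/
structure IsTwistedKernel (m l k p : ℕ) (c : Vec m → Vec m → Vec m → Cl m) : Prop where
  smooth : ∀ v, ContDiffOn ℝ ∞ (fun q : Vec m × Vec m => c q.1 q.2 v)
    ((lattice m l : Set (Vec m))ᶜ ×ˢ univ)
  degree_one : ∀ x ∉ lattice m l, ∀ v, (fun u => c x u v) ∈ degreeOne m k
  periodic : ∀ a ∈ Lat m l, ∀ x ∉ lattice m l, ∀ u v, c (x + emb m a) u v = sgn p a • c x u v
  annihilated : ∀ x ∉ lattice m l, ∀ u v, opD k (fun y w => c y w v) x u = 0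

/-- Kernels on `(C_l × C_l) \ diagonal`, for fixed `u, v`, between the fibres of `E^p`: the value
at `(x', y')` takes the fibre over `y'` to the fibre over `x'`. -/
abbrev BundleKernel (m l p : ℕ) : Type :=
  (x' y' : Cyl m l) → x' ≠ y' → Vec m → Vec m → Fiber p y' → Fiber p x'

/-- `K` is the projection of `c(x - y, u, v)`:
`K(π_l(x), π_l(y), u, v) [(y, Y)] = [(x, c(x - y, u, v) Y)]` for all representatives `x, y`. -/
def IsProjection {m l p : ℕ} (c : Vec m → Vec m → Vec m → Cl m) (K : BundleKernel m l p) : Prop :=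
  ∀ (x y : Vec m) (h : proj m l x ≠ proj m l y) (u v : Vec m) (Y : Cl m),
    K (proj m l x) (proj m l y) h u v (Fiber.mk l p y Y) = Fiber.mk l p x (c (x - y) u v * Y)

/-- The section `(x', u) ↦ K(x', y', u, v) η` of `E^p` over `C_l \ {y'}`. -/
def BundleKernel.sec {m l p : ℕ} (K : BundleKernel m l p) (y' : Cyl m l) (v : Vec m)
    (η : Fiber p y') : Sec p ({y'}ᶜ : Set (Cyl m l)) :=
  fun x' u => K x'.1 y' x'.2 u v η

end SpinCylinder

end

open SpinCylinder

noncomputable section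

namespace SpinCylinder

/-!
Let `δ` be a unit vector of the lattice with sign `-1`. Where it converges absolutely, the sum of
the `± f(x + a)` over the lattice equals half the sum of the `± (f(x + a) - f(x + a + δ))`. If the
derivatives of order `n` of `f` are `O(‖x‖^{-(l+n)})`, as those of `E_{1,k}` are for `l ≤ m - k`,
the terms of the latter decay one order faster, so that it converges and can be differentiated term
by term. This sum is the cotangent kernel in both cases: for `l = m - k` its partial sums over boxes
differ from those of the symmetrized series by sums over two opposite faces, which are `O(1/N)`.
For odd `k` the kernel `E_{1,k}` is odd in `x`, so that the symmetrized terms themselves decay one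
order faster.

The relation between a function and its periodization is stable under derivatives and left
multiplication by constants, hence under `𝓓_{1,k}`, and `𝓓_{1,k} E_{1,k} = 0` off the origin. For
the latter, `Δ ‖x‖^s = s (m + s - 2) ‖x‖^(s-2)` gives `Δ^n ‖x‖^(2n-m) = 0`, and `E_{1,k}`, which is
linear in `u`, is built from powers of the norm by operations whose commutators with `Δ` and `D` are
explicit: what `Δ^n` or `D Δ^(n-1)` leaves over is cancelled by the terms with `⟨D_u, D_x⟩`.

The formula for `Z₁` comes from the second moments `∫ u_i u_j dS = δ_{ij} |S^{m-1}| / m`, which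
are forced by the invariance of the sphere under isometries.
-/

open TopologicalSpace (Opens)

/-! ### Smooth functions on an open set -/

/-- The space `C^∞(U, F)`. A function on `U` is encoded by its extension by zero to the whole space,
so that operators such as the partial derivatives are endomorphisms of one vector space. -/
def SmoothFun {V : Type*} [NormedAddCommGroup V] [NormedSpace ℝ V] (U : Opens V)
    (F : Type*) [NormedAddCommGroup F] [NormedSpace ℝ F] : Submodule ℝ (V → F) where
  carrier := {f | ContDiffOn ℝ ∞ f U ∧ ∀ x ∉ U, f x = 0}
  zero_mem' := ⟨contDiffOn_const, fun _ _ => rfl⟩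
  add_mem' := fun hf hg => ⟨hf.1.add hg.1, fun x hx => by simp [hf.2 x hx, hg.2 x hx]⟩
  smul_mem' := fun c f hf => ⟨contDiffOn_const.smul hf.1, fun x hx => by simp [hf.2 x hx]⟩

namespace SmoothFun

section NormedSpace

variable {V F F' : Type*} [NormedAddCommGroup V] [NormedSpace ℝ V]
  [NormedAddCommGroup F] [NormedSpace ℝ F] [NormedAddCommGroup F'] [NormedSpace ℝ F']
  {U : Opens V}

instance : CoeFun (SmoothFun U F) (fun _ => V → F) := ⟨Subtype.val⟩

theorem contDiffOn (f : SmoothFun U F) : ContDiffOn ℝ ∞ f U := f.2.1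

theorem contDiffAt (f : SmoothFun U F) {x : V} (hx : x ∈ U) : ContDiffAt ℝ ∞ f x :=
  (contDiffOn f).contDiffAt (U.isOpen.mem_nhds hx)

theorem differentiableAt (f : SmoothFun U F) {x : V} (hx : x ∈ U) : DifferentiableAt ℝ f x :=
  (contDiffAt f hx).differentiableAt (by simp)

theorem apply_of_notMem (f : SmoothFun U F) {x : V} (hx : x ∉ U) : f x = 0 := f.2.2 x hx

theorem ext_on {f g : SmoothFun U F} (h : ∀ x ∈ U, f x = g x) : f = g := by
  refine Subtype.ext (funext fun x => ?_)
  by_cases hx : x ∈ U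
  · exact h x hx
  · rw [apply_of_notMem f hx, apply_of_notMem g hx]

@[simp] theorem add_apply (f g : SmoothFun U F) (x : V) : (f + g) x = f x + g x := rfl
@[simp] theorem sub_apply (f g : SmoothFun U F) (x : V) : (f - g) x = f x - g x := rfl
@[simp] theorem neg_apply (f : SmoothFun U F) (x : V) : (-f) x = -f x := rfl
@[simp] theorem smul_apply (c : ℝ) (f : SmoothFun U F) (x : V) : (c • f) x = c • f x := rfl

@[simp] theorem sum_apply {ι : Type*} (s : Finset ι) (f : ι → SmoothFun U F) (x : V) :
    (∑ i ∈ s, f i) x = ∑ i ∈ s, f i x := by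
  rw [AddSubmonoidClass.coe_finsetSum, Finset.sum_apply]

theorem eventuallyEq_nhds (f : SmoothFun U F) {g : V → F} (h : ∀ x ∈ U, g x = f x) {x : V}
    (hx : x ∈ U) : g =ᶠ[𝓝 x] f :=
  eventually_of_mem (U.isOpen.mem_nhds hx) h

/-- The restriction to `U` of a function which is smooth on `U`, as an element of `C^∞(U, F)`. -/
def ofContDiffOn (g : V → F) (hg : ContDiffOn ℝ ∞ g U) : SmoothFun U F :=
  ⟨(U : Set V).indicator g, hg.congr fun _ hx => indicator_of_mem hx g,
    fun _ hx => indicator_of_notMem (s := (U : Set V)) hx g⟩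

theorem ofContDiffOn_apply {g : V → F} (hg : ContDiffOn ℝ ∞ g U) {x : V} (hx : x ∈ U) :
    ofContDiffOn g hg x = g x := indicator_of_mem (s := (U : Set V)) hx g

theorem contDiffOn_fderiv_apply (f : SmoothFun U F) (w : V) :
    ContDiffOn ℝ ∞ (fun x => fderiv ℝ f x w) U :=
  ((contDiffOn f).fderiv_of_isOpen U.isOpen (m := ∞) (by simp)).clm_apply contDiffOn_const

/-- The directional derivative `w ↦ ∂_w` on `C^∞(U, F)`. -/
def dirDeriv : V →ₗ[ℝ] Module.End ℝ (SmoothFun U F) :=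
  LinearMap.mk₂ ℝ (fun w f => ofContDiffOn _ (contDiffOn_fderiv_apply f w))
    (fun w z f => ext_on fun x hx => by simp [ofContDiffOn_apply _ hx])
    (fun c w f => ext_on fun x hx => by simp [ofContDiffOn_apply _ hx])
    (fun w f g => ext_on fun x hx => by
      simp only [ofContDiffOn_apply _ hx, add_apply, Submodule.coe_add,
        fderiv_add (differentiableAt f hx) (differentiableAt g hx)]
      rfl)
    (fun c w f => ext_on fun x hx => by
      simp only [ofContDiffOn_apply _ hx, smul_apply, Submodule.coe_smul,
        fderiv_const_smul (differentiableAt f hx)]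
      rfl)

theorem dirDeriv_apply (w : V) (f : SmoothFun U F) {x : V} (hx : x ∈ U) :
    dirDeriv w f x = fderiv ℝ f x w :=
  ofContDiffOn_apply (contDiffOn_fderiv_apply f w) hx

theorem lineDeriv_eq_dirDeriv (w : V) (f : SmoothFun U F) {g : V → F} (h : ∀ x ∈ U, g x = f x)
    {x : V} (hx : x ∈ U) : lineDeriv ℝ g x w = dirDeriv w f x := by
  rw [(eventuallyEq_nhds f h hx).lineDeriv_eq, dirDeriv_apply w f hx,
    (differentiableAt f hx).lineDeriv_eq_fderiv]

theorem dirDeriv_dirDeriv_apply (w z : V) (f : SmoothFun U F) {x : V} (hx : x ∈ U) :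
    dirDeriv w (dirDeriv z f) x = fderiv ℝ (fderiv ℝ f) x w z := by
  have hf : DifferentiableAt ℝ (fderiv ℝ f) x :=
    ((contDiffAt f hx).fderiv_right (m := 1) (by norm_cast)).differentiableAt (by simp)
  rw [dirDeriv_apply w _ hx,
    ← (eventuallyEq_nhds (dirDeriv z f) (fun y hy => (dirDeriv_apply z f hy).symm) hx).fderiv_eq,
    fderiv_clm_apply hf (differentiableAt_const z)]
  simp

theorem dirDeriv_comm (w z : V) (f : SmoothFun U F) :
    dirDeriv w (dirDeriv z f) = dirDeriv z (dirDeriv w f) := ext_on fun x hx => by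
  rw [dirDeriv_dirDeriv_apply w z f hx, dirDeriv_dirDeriv_apply z w f hx]
  exact ((contDiffAt f hx).isSymmSndFDerivAt (by simp; norm_cast)).eq w z

/-- Composition with a continuous linear map of the values. -/
def postcomp : (F →L[ℝ] F') →ₗ[ℝ] SmoothFun U F →ₗ[ℝ] SmoothFun U F' :=
  LinearMap.mk₂ ℝ (fun A f => ⟨fun x => A (f x), A.contDiff.comp_contDiffOn (contDiffOn f),
      fun x hx => by simp [apply_of_notMem f hx]⟩)
    (fun A B f => ext_on fun x _ => by simp)
    (fun c A f => ext_on fun x _ => by simp)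
    (fun A f g => ext_on fun x _ => by simp)
    (fun c A f => ext_on fun x _ => by simp)

@[simp] theorem postcomp_apply (A : F →L[ℝ] F') (f : SmoothFun U F) (x : V) :
    postcomp A f x = A (f x) := rfl

theorem dirDeriv_postcomp (w : V) (A : F →L[ℝ] F') (f : SmoothFun U F) :
    dirDeriv w (postcomp A f) = postcomp A (dirDeriv w f) := ext_on fun x hx => by
  rw [dirDeriv_apply w _ hx, postcomp_apply, dirDeriv_apply w f hx]
  exact congrArg (· w) (A.hasFDerivAt.comp x (differentiableAt f hx).hasFDerivAt).fderiv

end NormedSpace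

section InnerProductSpace

variable {V F F' : Type*} [NormedAddCommGroup V] [InnerProductSpace ℝ V]
  [NormedAddCommGroup F] [NormedSpace ℝ F] [NormedAddCommGroup F'] [NormedSpace ℝ F']
  {U : Opens V}

/-- Multiplication by the linear function `x ↦ ⟪x, w⟫`. -/
def innerMul : V →ₗ[ℝ] Module.End ℝ (SmoothFun U F) :=
  LinearMap.mk₂ ℝ (fun w f => ⟨fun x => ⟪x, w⟫ • f x,
      ((contDiff_id.inner ℝ contDiff_const).contDiffOn).smul (contDiffOn f),
      fun x hx => by simp [apply_of_notMem f hx]⟩)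
    (fun w z f => ext_on fun x _ => by simp [inner_add_right, add_smul])
    (fun c w f => ext_on fun x _ => by simp [inner_smul_right, mul_smul])
    (fun w f g => ext_on fun x _ => by simp)
    (fun c w f => ext_on fun x _ => smul_comm ⟪x, w⟫ c (f x))

@[simp] theorem innerMul_apply (w : V) (f : SmoothFun U F) (x : V) :
    innerMul w f x = ⟪x, w⟫ • f x := rfl

theorem innerMul_comm (w z : V) (f : SmoothFun U F) :
    innerMul w (innerMul z f) = innerMul z (innerMul w f) :=
  ext_on fun x _ => smul_comm ⟪x, w⟫ ⟪x, z⟫ (f x)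

theorem innerMul_postcomp (w : V) (A : F →L[ℝ] F') (f : SmoothFun U F) :
    innerMul w (postcomp A f) = postcomp A (innerMul w f) :=
  ext_on fun x _ => (A.map_smul ⟪x, w⟫ (f x)).symm

theorem dirDeriv_innerMul (w z : V) (f : SmoothFun U F) :
    dirDeriv w (innerMul z f) = innerMul z (dirDeriv w f) + ⟪w, z⟫ • f := ext_on fun x hx => by
  have hinner : HasFDerivAt (fun y : V => ⟪y, z⟫) (innerSL ℝ z) x := by
    simpa [real_inner_comm] using (innerSL ℝ z).hasFDerivAt (x := x)
  have hmul : HasFDerivAt (innerMul z f) _ x := hinner.smul (differentiableAt f hx).hasFDerivAt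
  rw [dirDeriv_apply w _ hx, hmul.fderiv, add_apply, innerMul_apply, dirDeriv_apply w f hx,
    smul_apply]
  simp [real_inner_comm]

end InnerProductSpace

section Euclidean

variable {m : ℕ} {F : Type*} [NormedAddCommGroup F] [NormedSpace ℝ F] {U : Opens (Vec m)}

/-- The Laplace operator `∑ ∂_i²` on `C^∞(U, F)`. -/
def lap : Module.End ℝ (SmoothFun U F) := ∑ i, dirDeriv (e i) * dirDeriv (e i)

theorem lap_eq_sum (f : SmoothFun U F) : lap f = ∑ i, dirDeriv (e i) (dirDeriv (e i) f) := by
  simp only [lap, LinearMap.sum_apply, Module.End.mul_apply]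

theorem laplacian_eq_lap (f : SmoothFun U F) {g : Vec m → F} (h : ∀ x ∈ U, g x = f x) {x : Vec m}
    (hx : x ∈ U) : Laplacian.laplacian g x = lap f x := by
  rw [(InnerProductSpace.laplacian_congr_nhds (eventuallyEq_nhds f h hx)).eq_of_nhds,
    InnerProductSpace.laplacian_eq_iteratedFDeriv_orthonormalBasis _
      (EuclideanSpace.basisFun (Fin m) ℝ), lap_eq_sum, sum_apply]
  refine Finset.sum_congr rfl fun i _ => ?_
  rw [dirDeriv_dirDeriv_apply _ _ f hx, iteratedFDeriv_two_apply]
  simp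

end Euclidean

section Clifford

variable {m : ℕ} {V : Type*} [NormedAddCommGroup V]

section NormedSpace

variable [NormedSpace ℝ V] {U : Opens V}

/-- Left multiplication of `Cl_m`-valued functions by a constant. -/
def leftMul : Cl m →ₗ[ℝ] Module.End ℝ (SmoothFun U (Cl m)) :=
  postcomp ∘ₗ LinearMap.toContinuousLinearMap.toLinearMap ∘ₗ LinearMap.mul ℝ (Cl m)

/-- Right multiplication of `Cl_m`-valued functions by a constant. -/
def rightMul : Cl m →ₗ[ℝ] Module.End ℝ (SmoothFun U (Cl m)) :=
  postcomp ∘ₗ LinearMap.toContinuousLinearMap.toLinearMap ∘ₗ (LinearMap.mul ℝ (Cl m)).flip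

@[simp] theorem leftMul_apply (a : Cl m) (f : SmoothFun U (Cl m)) (x : V) :
    leftMul a f x = a * f x := rfl

@[simp] theorem rightMul_apply (a : Cl m) (f : SmoothFun U (Cl m)) (x : V) :
    rightMul a f x = f x * a := rfl

theorem leftMul_leftMul (a b : Cl m) (f : SmoothFun U (Cl m)) :
    leftMul a (leftMul b f) = leftMul (a * b) f :=
  ext_on fun x _ => (mul_assoc a b (f x)).symm

theorem rightMul_leftMul (a b : Cl m) (f : SmoothFun U (Cl m)) :
    rightMul a (leftMul b f) = leftMul b (rightMul a f) :=
  ext_on fun x _ => mul_assoc b (f x) a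

theorem leftMul_algebraMap (c : ℝ) (f : SmoothFun U (Cl m)) :
    leftMul (algebraMap ℝ (Cl m) c) f = c • f :=
  ext_on fun x _ => (Algebra.smul_def c (f x)).symm

theorem dirDeriv_leftMul (w : V) (a : Cl m) (f : SmoothFun U (Cl m)) :
    dirDeriv w (leftMul a f) = leftMul a (dirDeriv w f) := dirDeriv_postcomp _ _ _

theorem dirDeriv_rightMul (w : V) (a : Cl m) (f : SmoothFun U (Cl m)) :
    dirDeriv w (rightMul a f) = rightMul a (dirDeriv w f) := dirDeriv_postcomp _ _ _

end NormedSpace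

section InnerProductSpace

variable [InnerProductSpace ℝ V] {U : Opens V}

theorem innerMul_leftMul (w : V) (a : Cl m) (f : SmoothFun U (Cl m)) :
    innerMul w (leftMul a f) = leftMul a (innerMul w f) := innerMul_postcomp _ _ _

theorem innerMul_rightMul (w : V) (a : Cl m) (f : SmoothFun U (Cl m)) :
    innerMul w (rightMul a f) = rightMul a (innerMul w f) := innerMul_postcomp _ _ _

end InnerProductSpace

variable {U : Opens (Vec m)}

/-- The Dirac operator `∑ e_i ∂_i` on `C^∞(U, Cl_m)`. -/
def dirac : Module.End ℝ (SmoothFun U (Cl m)) := ∑ i, leftMul (vec (e i)) * dirDeriv (e i)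

theorem dirac_eq_sum (f : SmoothFun U (Cl m)) :
    dirac f = ∑ i, leftMul (vec (e i)) (dirDeriv (e i) f) := by
  simp only [dirac, LinearMap.sum_apply, Module.End.mul_apply]

end Clifford

end SmoothFun

/-! ### The operators on functions which are linear in `u` -/

theorem sum_coord_smul_map {m : ℕ} {M : Type*} [AddCommGroup M] [Module ℝ M]
    (A : Vec m →ₗ[ℝ] M) (u : Vec m) : ∑ i, u i • A (e i) = A u := by
  have hu : ∑ i, u i • (e i : Vec m) = u := by
    simpa using (EuclideanSpace.basisFun (Fin m) ℝ).sum_repr u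
  rw [← congrArg A hu, map_sum]
  simp only [map_smul]

theorem lineDeriv_linearMap {V W : Type*} [NormedAddCommGroup V] [NormedSpace ℝ V]
    [FiniteDimensional ℝ V] [NormedAddCommGroup W] [NormedSpace ℝ W] (L : V →ₗ[ℝ] W) (u w : V) :
    lineDeriv ℝ (fun z => L z) u w = L w :=
  ((LinearMap.toContinuousLinearMap L).hasFDerivAt.hasLineDerivAt w).lineDeriv

section Linear

open SmoothFun

variable {m : ℕ} {U V : Opens (Vec m)}

/-- `F(x, u)` agrees for `x ∈ U` with the family `f_u(x)` of smooth functions, which is linear in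
`u`. -/
def IsRep (F : Fun₂ m) (f : Vec m →ₗ[ℝ] SmoothFun U (Cl m)) : Prop := ∀ x ∈ U, ∀ u, F x u = f u x

/-- The operator `⟨D_u, D_x⟩` on families which are linear in `u`; the result does not depend on
`u`. -/
def divU (f : Vec m →ₗ[ℝ] SmoothFun U (Cl m)) : SmoothFun U (Cl m) := ∑ i, dirDeriv (e i) (f (e i))

theorem innerUDx_eq_dirDeriv {F : Fun₂ m} {g : SmoothFun U (Cl m)}
    (h : ∀ x ∈ U, ∀ u, F x u = g x) {x : Vec m} (hx : x ∈ U) (u : Vec m) :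
    innerUDx F x u = dirDeriv u g x := by
  have hsum : ∑ i, u i • dirDeriv (e i) g = dirDeriv u g :=
    sum_coord_smul_map (LinearMap.flip dirDeriv g) u
  rw [← hsum, SmoothFun.sum_apply]
  exact Finset.sum_congr rfl fun i _ =>
    congrArg (u i • ·) (lineDeriv_eq_dirDeriv (e i) g (fun y hy => h y hy u) hx)

namespace IsRep

variable {F : Fun₂ m} {f : Vec m →ₗ[ℝ] SmoothFun U (Cl m)}

theorem dX (h : IsRep F f) (i : Fin m) : IsRep (dX i F) (dirDeriv (e i) ∘ₗ f) := fun _ hx u =>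
  lineDeriv_eq_dirDeriv (e i) (f u) (fun y hy => h y hy u) hx

theorem lapX (h : IsRep F f) : IsRep (lapX F) (lap ∘ₗ f) := fun _ hx u =>
  laplacian_eq_lap (f u) (fun y hy => h y hy u) hx

theorem lapX_iterate (h : IsRep F f) (n : ℕ) :
    IsRep (SpinCylinder.lapX^[n] F) ((lap ^ n) ∘ₗ f) := by
  induction n with
  | zero => exact h
  | succ n ih =>
    rw [Function.iterate_succ_apply', pow_succ']
    exact ih.lapX

theorem diracX (h : IsRep F f) : IsRep (diracX F) (dirac ∘ₗ f) := fun x hx u => by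
  rw [LinearMap.comp_apply, dirac_eq_sum, SmoothFun.sum_apply]
  exact Finset.sum_congr rfl fun i _ => congrArg (vec (e i) * ·) (h.dX i x hx u)

theorem innerDuDx (h : IsRep F f) {x : Vec m} (hx : x ∈ U) (u : Vec m) :
    innerDuDx F x u = divU f x := by
  rw [divU, SmoothFun.sum_apply]
  refine Finset.sum_congr rfl fun i _ => ?_
  let L : Vec m →ₗ[ℝ] Cl m :=
    LinearMap.proj x ∘ₗ (SmoothFun U (Cl m)).subtype ∘ₗ dirDeriv (e i) ∘ₗ f
  have hL : (fun w => SpinCylinder.dX i F x w) = fun w => L w := funext fun w => h.dX i x hx w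
  rw [dU, hL]
  exact lineDeriv_linearMap L u (e i)

end IsRep

/-- The bosonic operator `D_{1,2n}` on families which are linear in `u`. -/
def bosonicLin (n : ℕ) (f : Vec m →ₗ[ℝ] SmoothFun U (Cl m)) (u : Vec m) : SmoothFun U (Cl m) :=
  (lap ^ n) (f u)
    - (4 * (n : ℝ) / ((m : ℝ) + 2 * n - 2)) • dirDeriv u (divU ((lap ^ (n - 1)) ∘ₗ f))

/-- The fermionic operator `D_{1,2n-1}` on families which are linear in `u`. -/
def fermionicLin (n : ℕ) (f : Vec m →ₗ[ℝ] SmoothFun U (Cl m)) (u : Vec m) : SmoothFun U (Cl m) :=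
  dirac ((lap ^ (n - 1)) (f u))
    - (2 / ((m : ℝ) + 2 * n - 2)) • leftMul (vec u) (divU ((lap ^ (n - 1)) ∘ₗ f))
    - ((4 * (n : ℝ) - 4) / ((m : ℝ) + 2 * n - 2)) •
        dirDeriv u (divU ((lap ^ (n - 2)) ∘ₗ dirac ∘ₗ f))

open Classical in
/-- The operator `D_{1,k}` on families which are linear in `u`. -/
def opLin (k : ℕ) (f : Vec m →ₗ[ℝ] SmoothFun U (Cl m)) : Vec m → SmoothFun U (Cl m) :=
  if Even k then bosonicLin (k / 2) f else fermionicLin ((k + 1) / 2) f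

theorem IsRep.opD {F : Fun₂ m} {f : Vec m →ₗ[ℝ] SmoothFun U (Cl m)} (h : IsRep F f) (k : ℕ)
    {x : Vec m} (hx : x ∈ U) (u : Vec m) : opD k F x u = opLin k f u x := by
  unfold SpinCylinder.opD opLin
  split_ifs
  · rw [bosonic, h.lapX_iterate _ x hx u,
      innerUDx_eq_dirDeriv (fun _ hy => (h.lapX_iterate _).innerDuDx hy) hx u]
    rfl
  · rw [fermionic, (h.lapX_iterate _).diracX x hx u, (h.lapX_iterate _).innerDuDx hx u,
      innerUDx_eq_dirDeriv (fun _ hy => (h.diracX.lapX_iterate _).innerDuDx hy) hx u]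
    rfl

theorem prodMk_sum_mem {ι M N : Type*} [AddCommGroup M] [Module ℝ M] [AddCommGroup N] [Module ℝ N]
    (R : Submodule ℝ (M × N)) {s : Finset ι} {a : ι → M} {b : ι → N}
    (h : ∀ i ∈ s, (a i, b i) ∈ R) : (∑ i ∈ s, a i, ∑ i ∈ s, b i) ∈ R := by
  have hsum : ∑ i ∈ s, (a i, b i) = (∑ i ∈ s, a i, ∑ i ∈ s, b i) :=
    Prod.ext Prod.fst_sum Prod.snd_sum
  exact hsum ▸ R.sum_mem h

/-- A linear relation between smooth functions on `U` and on `V` which is stable under the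
directional derivatives and the left multiplications by constants. -/
structure IsDiffStable (R : Submodule ℝ (SmoothFun U (Cl m) × SmoothFun V (Cl m))) : Prop where
  dirDeriv_mem : ∀ w, ∀ q ∈ R, (dirDeriv w q.1, dirDeriv w q.2) ∈ R
  leftMul_mem : ∀ a, ∀ q ∈ R, (leftMul a q.1, leftMul a q.2) ∈ R

namespace IsDiffStable

variable {R : Submodule ℝ (SmoothFun U (Cl m) × SmoothFun V (Cl m))}

theorem lap_mem (hR : IsDiffStable R) : ∀ q ∈ R, (lap q.1, lap q.2) ∈ R := fun q hq => by
  simpa only [lap_eq_sum] using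
    prodMk_sum_mem R fun i _ => hR.dirDeriv_mem (e i) _ (hR.dirDeriv_mem (e i) q hq)

theorem lap_pow_mem (hR : IsDiffStable R) (n : ℕ) :
    ∀ q ∈ R, ((lap ^ n) q.1, (lap ^ n) q.2) ∈ R := by
  induction n with
  | zero => exact fun q hq => hq
  | succ n ih =>
    intro q hq
    simpa only [pow_succ', Module.End.mul_apply] using hR.lap_mem _ (ih q hq)

theorem dirac_mem (hR : IsDiffStable R) : ∀ q ∈ R, (dirac q.1, dirac q.2) ∈ R := fun q hq => by
  simpa only [dirac_eq_sum] using
    prodMk_sum_mem R fun i _ => hR.leftMul_mem (vec (e i)) _ (hR.dirDeriv_mem (e i) q hq)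

variable {f : Vec m →ₗ[ℝ] SmoothFun U (Cl m)} {g : Vec m →ₗ[ℝ] SmoothFun V (Cl m)}

theorem divU_mem (hR : IsDiffStable R) (h : ∀ u, (f u, g u) ∈ R) : (divU f, divU g) ∈ R :=
  prodMk_sum_mem R fun i _ => hR.dirDeriv_mem (e i) _ (h (e i))

theorem opLin_mem (hR : IsDiffStable R) (k : ℕ) (h : ∀ u, (f u, g u) ∈ R) (u : Vec m) :
    (opLin k f u, opLin k g u) ∈ R := by
  unfold opLin
  split_ifs
  · exact R.sub_mem (hR.lap_pow_mem _ _ (h u))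
      (R.smul_mem _ (hR.dirDeriv_mem u _ (hR.divU_mem fun w => hR.lap_pow_mem _ _ (h w))))
  · exact R.sub_mem (R.sub_mem (hR.dirac_mem _ (hR.lap_pow_mem _ _ (h u)))
      (R.smul_mem _ (hR.leftMul_mem _ _ (hR.divU_mem fun w => hR.lap_pow_mem _ _ (h w)))))
      (R.smul_mem _ (hR.dirDeriv_mem u _
        (hR.divU_mem fun w => hR.lap_pow_mem _ _ (hR.dirac_mem _ (h w)))))

end IsDiffStable

end Linear

/-! ### The lattice -/

section Lattice

variable {m l : ℕ}

theorem abs_le_norm_emb (a : Fin m → ℤ) (i : Fin m) : |(a i : ℝ)| ≤ ‖emb m a‖ := by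
  simpa [emb] using PiLp.norm_apply_le (emb m a) i

theorem one_le_norm_emb {a : Fin m → ℤ} (ha : a ≠ 0) : 1 ≤ ‖emb m a‖ := by
  obtain ⟨i, hi⟩ := Function.ne_iff.1 ha
  refine le_trans ?_ (abs_le_norm_emb a i)
  exact_mod_cast Int.one_le_abs hi

theorem half_norm_emb_le {x : Vec m} {a : Fin m → ℤ} (h : 2 * ‖x‖ ≤ ‖emb m a‖) :
    ‖emb m a‖ / 2 ≤ ‖x + emb m a‖ := by
  have := norm_sub_le (x + emb m a) x
  rw [add_sub_cancel_left] at this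
  linarith

theorem finite_norm_emb_lt (R : ℝ) : {a : Fin m → ℤ | ‖emb m a‖ < R}.Finite := by
  refine (Set.finite_Icc (fun _ => -⌈R⌉ : Fin m → ℤ) (fun _ => ⌈R⌉)).subset fun a ha => ?_
  have habs : ∀ i, |a i| ≤ ⌈R⌉ := fun i => by
    have : |(a i : ℝ)| ≤ ⌈R⌉ := (abs_le_norm_emb a i).trans (ha.le.trans (Int.le_ceil R))
    exact_mod_cast this
  exact ⟨fun i => (abs_le.1 (habs i)).1, fun i => (abs_le.1 (habs i)).2⟩

theorem finite_lat_norm_emb_lt (R : ℝ) : {a : Lat m l | ‖emb m a‖ < R}.Finite :=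
  (finite_norm_emb_lt R).preimage Subtype.val_injective.injOn

theorem emb_mem_lattice {a : Fin m → ℤ} (ha : a ∈ Lat m l) : emb m a ∈ lattice m l := ⟨a, ha, rfl⟩

instance discreteTopology_lattice : DiscreteTopology (lattice m l) := by
  refine DiscreteTopology.of_forall_le_dist (r := 1) one_pos ?_
  rintro ⟨_, a, ha, rfl⟩ ⟨_, b, hb, rfl⟩ hne
  have hab : a - b ≠ 0 := fun h => hne (by simp [sub_eq_zero.1 h])
  change 1 ≤ dist (emb m a) (emb m b)
  rw [dist_eq_norm, ← map_sub]
  exact one_le_norm_emb hab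

theorem isClosed_lattice (m l : ℕ) : IsClosed (lattice m l : Set (Vec m)) :=
  AddSubgroup.isClosed_of_discrete

/-- The complement of the lattice `ℤ^l`, the domain of the cotangent kernels. -/
def offLattice (m l : ℕ) : Opens (Vec m) :=
  ⟨(lattice m l : Set (Vec m))ᶜ, (isClosed_lattice m l).isOpen_compl⟩

/-- The complement of the origin, the domain of the fundamental solution. -/
def offZero (m : ℕ) : Opens (Vec m) := ⟨{0}ᶜ, isClosed_singleton.isOpen_compl⟩

theorem mem_offZero {x : Vec m} : x ∈ offZero m ↔ x ≠ 0 := Iff.rfl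

theorem add_emb_ne_zero {x : Vec m} (hx : x ∉ lattice m l) {a : Fin m → ℤ} (ha : a ∈ Lat m l) :
    x + emb m a ≠ 0 := fun h => hx (by
  rw [eq_neg_of_add_eq_zero_left h]
  exact neg_mem (emb_mem_lattice ha))

theorem add_emb_notMem {x : Vec m} (hx : x ∉ lattice m l) {a : Fin m → ℤ} (ha : a ∈ Lat m l) :
    x + emb m a ∉ lattice m l := fun h => hx (by
  simpa using sub_mem h (emb_mem_lattice ha))

theorem finrank_lat_le : Module.finrank ℤ (Lat m l) ≤ l := by
  let φ : Lat m l →+ (Fin l → ℤ) :=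
    { toFun := fun a i => if h : (i : ℕ) < m then a.1 ⟨i, h⟩ else 0
      map_zero' := by funext i; simp
      map_add' := fun a b => by funext i; by_cases h : (i : ℕ) < m <;> simp [h] }
  have hφ : Function.Injective φ := by
    refine fun a b hab => Subtype.ext (funext fun i => ?_)
    by_cases hi : (i : ℕ) < l
    · simpa [φ] using congrFun hab ⟨i, hi⟩
    · rw [a.2 i (not_lt.1 hi), b.2 i (not_lt.1 hi)]
  simpa using LinearMap.finrank_le_finrank_of_injective (f := φ.toIntLinearMap) hφ

theorem summable_norm_emb_pow_inv {n : ℕ} (hn : l < n) :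
    Summable fun a : Lat m l => (‖emb m a‖ ^ n)⁻¹ := by
  let L : Submodule ℤ (Vec m) := AddSubgroup.toIntSubmodule (lattice m l)
  have : DiscreteTopology L := discreteTopology_lattice (m := m) (l := l)
  let equivL : Lat m l ≃+ L := (Lat m l).equivMapOfInjective (emb m) (emb_injective m)
  have hrank : Module.finrank ℤ L < n := by
    rw [← equivL.toIntLinearEquiv.finrank_eq]
    exact finrank_lat_le.trans_lt hn
  refine ((ZLattice.summable_norm_pow_inv L n hrank).comp_injective equivL.injective).congr
    fun a => ?_
  simp only [Function.comp_apply, inv_pow]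
  rfl

theorem exists_summable_bound_of_finite_compl {ι T W : Type*} [TopologicalSpace T]
    [SeminormedAddCommGroup W] {g : ι → T → W} {K : Set T} (hK : IsCompact K)
    (hg : ∀ i, ContinuousOn (g i) K) {c : ι → ℝ} (hc : Summable c) {S : Set ι} (hS : S.Finite)
    (h : ∀ i ∉ S, ∀ x ∈ K, ‖g i x‖ ≤ c i) :
    ∃ b : ι → ℝ, Summable b ∧ ∀ i, ∀ x ∈ K, ‖g i x‖ ≤ b i := by
  classical
  choose B hB using fun i => hK.exists_bound_of_continuousOn (hg i)
  refine ⟨fun i => if i ∈ S then B i else c i, hc.congr_cofinite ?_, fun i x hx => ?_⟩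
  · filter_upwards [hS.compl_mem_cofinite] with i hi
    simp only [if_neg (show i ∉ S from hi)]
  · by_cases hi : i ∈ S
    · simpa [hi] using hB i x hx
    · simpa [hi] using h i hi x hx

end Lattice

/-! ### Functions whose derivatives decay -/

section Decay

theorem inv_pow_le_of_half_le {a b : ℝ} (ha : 0 < a) (h : a / 2 ≤ b) (n : ℕ) :
    (b ^ n)⁻¹ ≤ 2 ^ n * (a ^ n)⁻¹ := by
  calc (b ^ n)⁻¹ ≤ ((a / 2) ^ n)⁻¹ := by gcongr
    _ = 2 ^ n * (a ^ n)⁻¹ := by rw [div_pow, inv_div, div_eq_mul_inv]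

theorem ne_zero_of_one_le_norm {V : Type*} [NormedAddCommGroup V] {x : V} (hx : 1 ≤ ‖x‖) :
    x ≠ 0 :=
  norm_pos_iff.1 (one_pos.trans_le hx)

variable {V W W' : Type*} [NormedAddCommGroup V] [NormedSpace ℝ V] [NormedAddCommGroup W]
  [NormedSpace ℝ W] [NormedAddCommGroup W'] [NormedSpace ℝ W']

/-- `f` is smooth off the origin and its derivatives of order `n` are `O(‖x‖^{-(l+n)})` at
infinity. -/
structure Decay (l : ℕ) (f : V → W) : Prop where
  smooth : ContDiffOn ℝ ∞ f {0}ᶜ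
  bound : ∀ n : ℕ, ∃ C, 0 ≤ C ∧ ∀ x, 1 ≤ ‖x‖ → ‖iteratedFDeriv ℝ n f x‖ ≤ C * (‖x‖ ^ (l + n))⁻¹

namespace Decay

variable {l : ℕ} {f g : V → W}

theorem contDiffAt (hf : Decay l f) {x : V} (hx : x ≠ 0) : ContDiffAt ℝ ∞ f x :=
  hf.smooth.contDiffAt (isOpen_compl_singleton.mem_nhds hx)

theorem differentiableAt (hf : Decay l f) {x : V} (hx : x ≠ 0) : DifferentiableAt ℝ f x :=
  (hf.contDiffAt hx).differentiableAt (by simp)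

theorem norm_le (hf : Decay l f) : ∃ C, 0 ≤ C ∧ ∀ x, 1 ≤ ‖x‖ → ‖f x‖ ≤ C * (‖x‖ ^ l)⁻¹ := by
  simpa using hf.bound 0

theorem norm_fderiv_le (hf : Decay l f) :
    ∃ C, 0 ≤ C ∧ ∀ x, 1 ≤ ‖x‖ → ‖fderiv ℝ f x‖ ≤ C * (‖x‖ ^ (l + 1))⁻¹ := by
  simpa only [norm_iteratedFDeriv_one] using hf.bound 1

protected theorem fderiv (hf : Decay l f) : Decay l (fderiv ℝ f) where
  smooth := hf.smooth.fderiv_of_isOpen isOpen_compl_singleton (by simp)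
  bound n := by
    obtain ⟨C, hC, h⟩ := hf.bound (n + 1)
    refine ⟨C, hC, fun x hx => ?_⟩
    rw [norm_iteratedFDeriv_fderiv]
    refine (h x hx).trans (mul_le_mul_of_nonneg_left ?_ hC)
    exact inv_anti₀ (by positivity) (pow_le_pow_right₀ hx (by lia))

theorem add (hf : Decay l f) (hg : Decay l g) : Decay l (f + g) where
  smooth := hf.smooth.add hg.smooth
  bound n := by
    obtain ⟨C, hC, h⟩ := hf.bound n
    obtain ⟨C', hC', h'⟩ := hg.bound n
    refine ⟨C + C', add_nonneg hC hC', fun x hx => ?_⟩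
    have hx0 := ne_zero_of_one_le_norm hx
    rw [iteratedFDeriv_add_apply ((hf.contDiffAt hx0).of_le (by exact_mod_cast le_top))
      ((hg.contDiffAt hx0).of_le (by exact_mod_cast le_top)), add_mul]
    exact (norm_add_le _ _).trans (add_le_add (h x hx) (h' x hx))

theorem clm_comp (hf : Decay l f) (A : W →L[ℝ] W') : Decay l (fun x => A (f x)) where
  smooth := A.contDiff.comp_contDiffOn hf.smooth
  bound n := by
    obtain ⟨C, hC, h⟩ := hf.bound n
    refine ⟨‖A‖ * C, by positivity, fun x hx => ?_⟩
    refine (A.norm_iteratedFDeriv_comp_left (hf.contDiffAt (ne_zero_of_one_le_norm hx))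
      (by exact_mod_cast le_top)).trans ?_
    rw [mul_assoc]
    exact mul_le_mul_of_nonneg_left (h x hx) (norm_nonneg _)

protected theorem zero : Decay l (0 : V → W) where
  smooth := contDiffOn_const
  bound n := ⟨0, le_rfl, fun x _ => by simp⟩

theorem congr (hf : Decay l f) (h : ∀ x ≠ 0, g x = f x) : Decay l g where
  smooth := hf.smooth.congr h
  bound n := by
    obtain ⟨C, hC, hb⟩ := hf.bound n
    refine ⟨C, hC, fun x hx => ?_⟩
    have heq : g =ᶠ[𝓝 x] f :=
      eventually_of_mem (isOpen_compl_singleton.mem_nhds (ne_zero_of_one_le_norm hx)) h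
    rw [(heq.iteratedFDeriv ℝ n).eq_of_nhds]
    exact hb x hx

theorem norm_sub_le (hf : Decay l f) : ∃ C, 0 ≤ C ∧ ∀ y z, 2 ≤ ‖y‖ → ‖z - y‖ ≤ ‖y‖ / 2 →
    ‖f z - f y‖ ≤ C * (‖y‖ ^ (l + 1))⁻¹ * ‖z - y‖ := by
  obtain ⟨C, hC, hfderiv⟩ := hf.norm_fderiv_le
  refine ⟨C * 2 ^ (l + 1), by positivity, fun y z hy hz => ?_⟩
  have hball : ∀ w ∈ Metric.closedBall y (‖y‖ / 2), ‖y‖ / 2 ≤ ‖w‖ := by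
    intro w hw
    rw [mem_closedBall_iff_norm, norm_sub_rev] at hw
    linarith [norm_sub_norm_le y w]
  refine (convex_closedBall y (‖y‖ / 2)).norm_image_sub_le_of_norm_fderiv_le (𝕜 := ℝ)
    (fun w hw => hf.differentiableAt (ne_zero_of_one_le_norm ?_)) (fun w hw => ?_)
    (Metric.mem_closedBall_self (by positivity)) (mem_closedBall_iff_norm.2 hz)
  · linarith [hball w hw]
  · calc ‖fderiv ℝ f w‖ ≤ C * (‖w‖ ^ (l + 1))⁻¹ := hfderiv w (by linarith [hball w hw])
      _ ≤ C * (2 ^ (l + 1) * (‖y‖ ^ (l + 1))⁻¹) := by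
        gcongr
        exact inv_pow_le_of_half_le (by linarith) (hball w hw) _
      _ = C * 2 ^ (l + 1) * (‖y‖ ^ (l + 1))⁻¹ := (mul_assoc _ _ _).symm

end Decay

/-- `f` is positively homogeneous of degree `s` off the origin. -/
def IsHomogeneous (s : ℤ) (f : V → W) : Prop := ∀ t : ℝ, 0 < t → ∀ x ≠ 0, f (t • x) = t ^ s • f x

namespace IsHomogeneous

universe u

variable {s : ℤ} {f : V → W}

protected theorem fderiv (hom : IsHomogeneous s f) (hf : ∀ x ≠ 0, DifferentiableAt ℝ f x) :
    IsHomogeneous (s - 1) (fderiv ℝ f) := fun t ht x hx => by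
  have heq : (fun y => f (t • y)) =ᶠ[𝓝 x] fun y => t ^ s • f y :=
    eventually_of_mem (isOpen_compl_singleton.mem_nhds hx) (hom t ht)
  have hderiv := heq.fderiv_eq (𝕜 := ℝ)
  rw [fderiv_fun_const_smul (hf x hx), fderiv_comp_smul] at hderiv
  rw [zpow_sub_one₀ ht.ne', mul_comm, mul_smul, ← hderiv, inv_smul_smul₀ ht.ne']

theorem norm_eq (hom : IsHomogeneous s f) {x : V} (hx : x ≠ 0) :
    ‖f x‖ = ‖x‖ ^ s * ‖f (‖x‖⁻¹ • x)‖ := by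
  have hn : ‖x‖ ≠ 0 := norm_ne_zero_iff.2 hx
  have h := hom ‖x‖ (norm_pos_iff.2 hx) (‖x‖⁻¹ • x) (smul_ne_zero (inv_ne_zero hn) hx)
  rw [smul_inv_smul₀ hn] at h
  rw [h, norm_smul, norm_zpow, norm_norm]

theorem exists_norm_le [FiniteDimensional ℝ V] (hom : IsHomogeneous s f)
    (hf : ContinuousOn f {0}ᶜ) : ∃ C, 0 ≤ C ∧ ∀ x ≠ 0, ‖f x‖ ≤ C * ‖x‖ ^ s := by
  have : ProperSpace V := FiniteDimensional.proper_real V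
  obtain ⟨C, hC⟩ := (isCompact_sphere (0 : V) 1).exists_bound_of_continuousOn
    (hf.mono fun x hx => ne_zero_of_one_le_norm (mem_sphere_zero_iff_norm.1 hx).ge)
  refine ⟨max C 0, le_max_right _ _, fun x hx => ?_⟩
  have hunit : ‖x‖⁻¹ • x ∈ Metric.sphere (0 : V) 1 := by
    simp [norm_smul, inv_mul_cancel₀ (norm_ne_zero_iff.2 hx)]
  rw [hom.norm_eq hx, mul_comm]
  gcongr
  exact (hC _ hunit).trans (le_max_left _ _)

theorem exists_norm_iteratedFDeriv_le {V W : Type u} [NormedAddCommGroup V] [NormedSpace ℝ V]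
    [FiniteDimensional ℝ V] [NormedAddCommGroup W] [NormedSpace ℝ W] {f : V → W}
    (hom : IsHomogeneous s f) (hf : ContDiffOn ℝ ∞ f {0}ᶜ) (n : ℕ) :
    ∃ C, 0 ≤ C ∧ ∀ x ≠ 0, ‖iteratedFDeriv ℝ n f x‖ ≤ C * ‖x‖ ^ (s - n) := by
  induction n generalizing W s with
  | zero => simpa using hom.exists_norm_le hf.continuousOn
  | succ n ih =>
    have hdiff : ∀ x ≠ 0, DifferentiableAt ℝ f x := fun x hx =>
      (hf.contDiffAt (isOpen_compl_singleton.mem_nhds hx)).differentiableAt (by simp)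
    obtain ⟨C, hC, h⟩ := ih (hom.fderiv hdiff)
      (hf.fderiv_of_isOpen isOpen_compl_singleton (m := ∞) (by simp))
    refine ⟨C, hC, fun x hx => ?_⟩
    rw [← norm_iteratedFDeriv_fderiv, Nat.cast_succ, sub_add_eq_sub_sub_swap]
    exact h x hx

theorem decay {V W : Type u} [NormedAddCommGroup V] [NormedSpace ℝ V] [FiniteDimensional ℝ V]
    [NormedAddCommGroup W] [NormedSpace ℝ W] {f : V → W} {l : ℕ}
    (hom : IsHomogeneous s f) (hs : s ≤ -l) (hf : ContDiffOn ℝ ∞ f {0}ᶜ) : Decay l f where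
  smooth := hf
  bound n := by
    obtain ⟨C, hC, h⟩ := hom.exists_norm_iteratedFDeriv_le hf n
    refine ⟨C, hC, fun x hx => (h x (ne_zero_of_one_le_norm hx)).trans ?_⟩
    gcongr
    calc ‖x‖ ^ (s - n) ≤ ‖x‖ ^ (-((l + n : ℕ) : ℤ)) := zpow_le_zpow_right₀ hx (by push_cast; lia)
      _ = (‖x‖ ^ (l + n))⁻¹ := by rw [zpow_neg, zpow_natCast]

end IsHomogeneous

end Decay

/-! ### Sign-twisted periodization -/

section Periodize

variable {m l : ℕ} {W W' : Type*} [NormedAddCommGroup W] [NormedSpace ℝ W]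
  [NormedAddCommGroup W'] [NormedSpace ℝ W']

/-- The terms `± (f(x + a) - f(x + a + δ))`, which decay one order faster than those of `f`. -/
def diffTerm (p : ℕ) (δ : Lat m l) (f : Vec m → W) (a : Lat m l) (x : Vec m) : W :=
  sgn p a.1 • (f (x + emb m a) - f (x + emb m (a + δ : Lat m l)))

/-- Half the sum of the terms `± (f(x + a) - f(x + a + δ))` over the lattice. If `sgn p δ = -1`
and `f` is summable over the lattice, this is the sum of the terms `± f(x + a)`. -/
def periodize (p : ℕ) (δ : Lat m l) (f : Vec m → W) (x : Vec m) : W :=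
  (1 / 2 : ℝ) • ∑' a : Lat m l, diffTerm p δ f a x

theorem norm_sgn_smul (p : ℕ) (a : Fin m → ℤ) (w : W) : ‖sgn p a • w‖ = ‖w‖ := by
  rcases sgn_cases p a with h | h <;> simp [h]

theorem sgn_mul_self (p : ℕ) (a : Fin m → ℤ) : sgn p a * sgn p a = 1 := by
  rcases sgn_cases p a with h | h <;> simp [h]

theorem sgn_mul_sgn_add (p : ℕ) (a b : Fin m → ℤ) : sgn p a * sgn p (b + a) = sgn p b := by
  rw [sgn_add, mul_left_comm, sgn_mul_self, mul_one]

theorem continuousOn_comp_add_emb {T : Type*} [TopologicalSpace T] {f : Vec m → T}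
    (hf : ContinuousOn f {0}ᶜ) {K : Set (Vec m)} (hK : K ⊆ (lattice m l : Set (Vec m))ᶜ)
    (a : Lat m l) : ContinuousOn (fun x => f (x + emb m a)) K :=
  hf.comp (continuousOn_id.add continuousOn_const) fun _ hx => add_emb_ne_zero (hK hx) a.2

variable {p : ℕ} {δ : Lat m l} {f g : Vec m → W}

theorem Decay.norm_diffTerm_le (hf : Decay l f) (p : ℕ) (δ : Lat m l) :
    ∃ C, 0 ≤ C ∧ ∀ (x : Vec m) (a : Lat m l), 2 * ‖x‖ + 4 * ‖emb m δ‖ + 4 ≤ ‖emb m a‖ →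
      ‖diffTerm p δ f a x‖ ≤ C * (‖emb m a‖ ^ (l + 1))⁻¹ := by
  obtain ⟨C, hC, hsub⟩ := hf.norm_sub_le
  refine ⟨C * 2 ^ (l + 1) * ‖emb m δ‖, by positivity, fun x a ha => ?_⟩
  have hx0 : 0 ≤ ‖x‖ := norm_nonneg x
  have hδ0 : 0 ≤ ‖emb m δ‖ := norm_nonneg _
  have hhalf : ‖emb m a‖ / 2 ≤ ‖x + emb m a‖ := half_norm_emb_le (by linarith)
  have hδ : x + emb m (a + δ : Lat m l) - (x + emb m a) = emb m δ := by simp [map_add]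
  rw [diffTerm, norm_sgn_smul, norm_sub_rev]
  calc ‖f (x + emb m (a + δ : Lat m l)) - f (x + emb m a)‖
      ≤ C * (‖x + emb m a‖ ^ (l + 1))⁻¹ * ‖emb m δ‖ :=
        hδ ▸ hsub (x + emb m a) _ (by linarith) (hδ.symm ▸ by linarith)
    _ ≤ C * (2 ^ (l + 1) * (‖emb m a‖ ^ (l + 1))⁻¹) * ‖emb m δ‖ := by
      gcongr
      exact inv_pow_le_of_half_le (by linarith) hhalf _
    _ = C * 2 ^ (l + 1) * ‖emb m δ‖ * (‖emb m a‖ ^ (l + 1))⁻¹ := by ring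

theorem Decay.exists_summable_bound_diffTerm (hf : Decay l f) (p : ℕ) (δ : Lat m l)
    {K : Set (Vec m)} (hK : IsCompact K) (hKl : K ⊆ (lattice m l : Set (Vec m))ᶜ) :
    ∃ b : Lat m l → ℝ, Summable b ∧ ∀ a, ∀ x ∈ K, ‖diffTerm p δ f a x‖ ≤ b a := by
  obtain ⟨C, -, hterm⟩ := hf.norm_diffTerm_le p δ
  obtain ⟨R, hR⟩ := hK.exists_bound_of_continuousOn continuousOn_id
  refine exists_summable_bound_of_finite_compl hK (fun a => ?_)
    ((summable_norm_emb_pow_inv (Nat.lt_succ_self l)).mul_left C)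
    (finite_lat_norm_emb_lt (2 * R + 4 * ‖emb m δ‖ + 4)) fun a ha x hx => hterm x a ?_
  · exact ((continuousOn_comp_add_emb hf.smooth.continuousOn hKl a).sub
      (continuousOn_comp_add_emb hf.smooth.continuousOn hKl (a + δ))).const_smul _
  · have ha' : 2 * R + 4 * ‖emb m δ‖ + 4 ≤ ‖emb m a‖ := not_lt.1 ha
    have hxR : ‖x‖ ≤ R := hR x hx
    linarith

theorem Decay.hasFDerivAt_diffTerm (hf : Decay l f) (a : Lat m l) {x : Vec m}
    (hx : x ∉ lattice m l) : HasFDerivAt (diffTerm p δ f a) (diffTerm p δ (fderiv ℝ f) a x) x := by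
  have h : ∀ b : Lat m l, HasFDerivAt (fun y => f (y + emb m b)) (fderiv ℝ f (x + emb m b)) x :=
    fun b => (hasFDerivAt_comp_add_right _).2
      (hf.differentiableAt (add_emb_ne_zero hx b.2)).hasFDerivAt
  exact ((h a).sub (h (a + δ))).const_smul (sgn p a.1)

theorem diffTerm_add_emb (a b : Lat m l) (x : Vec m) :
    diffTerm p δ f b (x + emb m a) = sgn p a.1 • diffTerm p δ f (b + a) x := by
  have hsgn : sgn p a.1 * sgn p (b + a : Lat m l).1 = sgn p b.1 := sgn_mul_sgn_add p a.1 b.1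
  have hshift : ∀ c : Lat m l, x + emb m a + emb m c = x + emb m (c + a : Lat m l) := fun c => by
    rw [AddSubgroup.coe_add, map_add]
    abel
  rw [diffTerm, diffTerm, smul_smul, hsgn, hshift, hshift, add_right_comm]

theorem periodize_add_emb (a : Lat m l) (x : Vec m) :
    periodize p δ f (x + emb m a) = sgn p a.1 • periodize p δ f x := by
  simp only [periodize, diffTerm_add_emb]
  rw [tsum_const_smul'', smul_comm,
    ← (Equiv.addRight a).tsum_eq fun b => diffTerm p δ f b x]
  rfl

variable [CompleteSpace W]

theorem Decay.summable_diffTerm (hf : Decay l f) {x : Vec m} (hx : x ∉ lattice m l) :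
    Summable fun a => diffTerm p δ f a x := by
  obtain ⟨b, hb, h⟩ := hf.exists_summable_bound_diffTerm p δ
    (isCompact_singleton (x := x)) (by simpa using hx)
  exact Summable.of_norm_bounded hb fun a => h a x rfl

theorem periodize_add (hf : Decay l f) (hg : Decay l g) {x : Vec m} (hx : x ∉ lattice m l) :
    periodize p δ (f + g) x = periodize p δ f x + periodize p δ g x := by
  rw [periodize, periodize, periodize, ← smul_add,
    ← (hf.summable_diffTerm hx).tsum_add (hg.summable_diffTerm hx)]
  simp only [diffTerm, Pi.add_apply, ← smul_add, add_sub_add_comm]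

theorem periodize_clm (hf : Decay l f) (A : W →L[ℝ] W') {x : Vec m} (hx : x ∉ lattice m l) :
    periodize p δ (fun y => A (f y)) x = A (periodize p δ f x) := by
  rw [periodize, periodize, map_smul, A.map_tsum (hf.summable_diffTerm hx)]
  simp only [diffTerm, map_smul, map_sub]

theorem Decay.hasFDerivAt_periodize (hf : Decay l f) {x : Vec m} (hx : x ∉ lattice m l) :
    HasFDerivAt (periodize p δ f) (periodize p δ (fderiv ℝ f) x) x := by
  obtain ⟨r, hr, hball⟩ := Metric.nhds_basis_closedBall.mem_iff.1
    ((isClosed_lattice m l).isOpen_compl.mem_nhds hx)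
  obtain ⟨b, hb, h⟩ := hf.fderiv.exists_summable_bound_diffTerm p δ
    (isCompact_closedBall x r) hball
  have hsub : Metric.ball x r ⊆ Metric.closedBall x r := Metric.ball_subset_closedBall
  exact (hasFDerivAt_tsum_of_isPreconnected hb Metric.isOpen_ball
    (convex_ball x r).isPreconnected
    (fun a y hy => hf.hasFDerivAt_diffTerm a (hball (hsub hy)))
    (fun a y hy => h a y (hsub hy)) (Metric.mem_ball_self hr) (hf.summable_diffTerm hx)
    (Metric.mem_ball_self hr)).const_smul (1 / 2 : ℝ)

theorem Decay.contDiffOn_periodize (hf : Decay l f) :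
    ContDiffOn ℝ ∞ (periodize p δ f) (lattice m l : Set (Vec m))ᶜ := by
  refine contDiffOn_infty.2 fun n => ?_
  induction n generalizing W with
  | zero =>
    exact contDiffOn_zero.2 fun x hx =>
      (hf.hasFDerivAt_periodize hx).continuousAt.continuousWithinAt
  | succ n ih =>
    have hsucc := (contDiffOn_succ_iff_fderiv_of_isOpen (𝕜 := ℝ) (n := n)
      (f := periodize p δ f) (isClosed_lattice m l).isOpen_compl).2
      ⟨fun x hx => (hf.hasFDerivAt_periodize hx).differentiableAt.differentiableWithinAt,
        by simp, (ih hf.fderiv).congr fun x hx => (hf.hasFDerivAt_periodize hx).fderiv⟩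
    exact_mod_cast hsucc

end Periodize

/-! ### Commutation relations -/

theorem vec_mul_self {m : ℕ} (x : Vec m) : vec x * vec x = algebraMap ℝ (Cl m) (-‖x‖ ^ 2) := by
  rw [CliffordAlgebra.ι_sq_scalar, negSq_apply]

theorem vec_mul_add_swap {m : ℕ} (x y : Vec m) :
    vec x * vec y + vec y * vec x = algebraMap ℝ (Cl m) (-(2 * ⟪x, y⟫)) := by
  rw [CliffordAlgebra.ι_mul_ι_add_swap]
  congr 1
  simp only [QuadraticMap.polar, negSq_apply, norm_add_sq_real]
  ring

theorem inner_e {m : ℕ} (i : Fin m) (u : Vec m) : ⟪e i, u⟫ = u i := by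
  simp [e, EuclideanSpace.inner_single_left]

theorem sum_inner_smul_map {m : ℕ} {M : Type*} [AddCommGroup M] [Module ℝ M]
    (A : Vec m →ₗ[ℝ] M) (u : Vec m) : ∑ i, ⟪e i, u⟫ • A (e i) = A u := by
  simpa only [inner_e] using sum_coord_smul_map A u

theorem sum_inner_smul_vec {m : ℕ} (x : Vec m) : ∑ i, ⟪e i, x⟫ • vec (e i) = vec x :=
  sum_inner_smul_map (CliffordAlgebra.ι (negSq m)) x

theorem vec_e_mul_self {m : ℕ} (i : Fin m) :
    vec (e i : Vec m) * vec (e i) = algebraMap ℝ (Cl m) (-1) := by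
  rw [vec_mul_self]; simp

namespace SmoothFun

section Vector

variable {m : ℕ} {F : Type*} [NormedAddCommGroup F] [NormedSpace ℝ F] {U : Opens (Vec m)}

theorem lap_dirDeriv (w : Vec m) (f : SmoothFun U F) :
    lap (dirDeriv w f) = dirDeriv w (lap f) := by
  simp only [lap_eq_sum, map_sum]
  exact Finset.sum_congr rfl fun i _ => by rw [dirDeriv_comm (e i) w f, dirDeriv_comm (e i) w]

theorem lap_pow_comm {A : Module.End ℝ (SmoothFun U F)} (hA : ∀ f, lap (A f) = A (lap f)) (n : ℕ)
    (f : SmoothFun U F) : (lap ^ n) (A f) = A ((lap ^ n) f) := by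
  have hcomm : Commute lap A := LinearMap.ext hA
  exact LinearMap.congr_fun (hcomm.pow_left n).eq f

theorem lap_innerMul (w : Vec m) (f : SmoothFun U F) :
    lap (innerMul w f) = innerMul w (lap f) + (2 : ℝ) • dirDeriv w f := by
  have hsum : ∑ i, ⟪e i, w⟫ • dirDeriv (e i) f = dirDeriv w f :=
    sum_inner_smul_map (LinearMap.flip dirDeriv f) w
  simp only [lap_eq_sum, dirDeriv_innerMul, map_add, map_smul, map_sum, Finset.sum_add_distrib,
    two_smul, hsum]
  abel

theorem lap_pow_innerMul (w : Vec m) (n : ℕ) (f : SmoothFun U F) :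
    (lap ^ n) (innerMul w f) =
      innerMul w ((lap ^ n) f) + (2 * n : ℝ) • dirDeriv w ((lap ^ (n - 1)) f) := by
  induction n with
  | zero => simp
  | succ n ih =>
    have hpred : (n : ℝ) • dirDeriv w (lap ((lap ^ (n - 1)) f)) =
        (n : ℝ) • dirDeriv w ((lap ^ n) f) := by
      rcases n with _ | n
      · simp
      · rw [pow_succ' _ n]; rfl
    rw [pow_succ', Module.End.mul_apply, ih, map_add, map_smul, lap_innerMul, lap_dirDeriv,
      mul_smul, hpred, Module.End.mul_apply, Nat.add_sub_cancel]
    push_cast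
    module

/-- The Euler operator `∑ x_i ∂_i`. -/
def euler : Module.End ℝ (SmoothFun U F) := ∑ i, innerMul (e i) * dirDeriv (e i)

theorem euler_eq_sum (f : SmoothFun U F) : euler f = ∑ i, innerMul (e i) (dirDeriv (e i) f) := by
  simp only [euler, LinearMap.sum_apply, Module.End.mul_apply]

theorem euler_innerMul (w : Vec m) (f : SmoothFun U F) :
    euler (innerMul w f) = innerMul w (euler f) + innerMul w f := by
  have hsum : ∑ i, ⟪e i, w⟫ • innerMul (e i) f = innerMul w f :=
    sum_inner_smul_map (LinearMap.flip innerMul f) w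
  simp only [euler_eq_sum, dirDeriv_innerMul, map_add, map_smul, map_sum, Finset.sum_add_distrib,
    hsum, innerMul_comm w]

theorem sum_dirDeriv_innerMul (f : SmoothFun U F) :
    ∑ i, dirDeriv (e i) (innerMul (e i) f) = (m : ℝ) • f + euler f := by
  have hone (i : Fin m) : ⟪(e i : Vec m), e i⟫ = (1 : ℝ) := by simp
  simp only [dirDeriv_innerMul, Finset.sum_add_distrib, ← euler_eq_sum, hone, one_smul,
    Finset.sum_const, Finset.card_univ, Fintype.card_fin, ← Nat.cast_smul_eq_nsmul ℝ]
  abel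

end Vector

section Clifford

variable {m : ℕ} {U : Opens (Vec m)}

theorem lap_leftMul (a : Cl m) (f : SmoothFun U (Cl m)) :
    lap (leftMul a f) = leftMul a (lap f) := by
  simp only [lap_eq_sum, map_sum, dirDeriv_leftMul]

theorem lap_rightMul (a : Cl m) (f : SmoothFun U (Cl m)) :
    lap (rightMul a f) = rightMul a (lap f) := by
  simp only [lap_eq_sum, map_sum, dirDeriv_rightMul]

theorem dirac_dirDeriv (w : Vec m) (f : SmoothFun U (Cl m)) :
    dirac (dirDeriv w f) = dirDeriv w (dirac f) := by
  simp only [dirac_eq_sum, map_sum, dirDeriv_leftMul, dirDeriv_comm _ w]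

theorem dirac_rightMul (a : Cl m) (f : SmoothFun U (Cl m)) :
    dirac (rightMul a f) = rightMul a (dirac f) := by
  simp only [dirac_eq_sum, map_sum, dirDeriv_rightMul, rightMul_leftMul]

theorem lap_dirac (f : SmoothFun U (Cl m)) : lap (dirac f) = dirac (lap f) := by
  simp only [dirac_eq_sum, map_sum, lap_leftMul, lap_dirDeriv]

theorem sum_inner_smul_leftMul (w : Vec m) (f : SmoothFun U (Cl m)) :
    ∑ i, ⟪e i, w⟫ • leftMul (vec (e i)) f = leftMul (vec w) f :=
  sum_inner_smul_map ((leftMul ∘ₗ CliffordAlgebra.ι (negSq m)).flip f) w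

theorem dirac_innerMul (w : Vec m) (f : SmoothFun U (Cl m)) :
    dirac (innerMul w f) = innerMul w (dirac f) + leftMul (vec w) f := by
  simp only [dirac_eq_sum, dirDeriv_innerMul, map_add, map_smul, map_sum, Finset.sum_add_distrib,
    innerMul_leftMul, sum_inner_smul_leftMul]

theorem dirac_leftMul_vec (w : Vec m) (f : SmoothFun U (Cl m)) :
    dirac (leftMul (vec w) f) = -leftMul (vec w) (dirac f) - (2 : ℝ) • dirDeriv w f := by
  have hsum : ∑ i, ⟪e i, w⟫ • dirDeriv (e i) f = dirDeriv w f :=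
    sum_inner_smul_map (LinearMap.flip dirDeriv f) w
  rw [← hsum]
  simp only [dirac_eq_sum, dirDeriv_leftMul, leftMul_leftMul, map_sum, Finset.smul_sum,
    ← Finset.sum_neg_distrib, ← Finset.sum_sub_distrib]
  refine Finset.sum_congr rfl fun i _ => ?_
  rw [eq_sub_of_add_eq (vec_mul_add_swap (e i) w), map_sub, LinearMap.sub_apply,
    leftMul_algebraMap]
  module

theorem dirac_dirac (f : SmoothFun U (Cl m)) : dirac (dirac f) = -lap f := by
  have hswap : dirac (dirac f) = -dirac (dirac f) - (2 : ℝ) • lap f := by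
    conv_lhs => rw [dirac_eq_sum f, map_sum]
    simp only [dirac_leftMul_vec, Finset.sum_sub_distrib, Finset.sum_neg_distrib,
      ← Finset.smul_sum, ← lap_eq_sum, dirac_dirDeriv, ← dirac_eq_sum]
  have htwo : (2 : ℝ) • (dirac (dirac f) + lap f) = 0 := by
    rw [smul_add, two_smul ℝ (dirac (dirac f))]
    nth_rewrite 1 [hswap]
    abel
  exact eq_neg_of_add_eq_zero_left ((smul_eq_zero.1 htwo).resolve_left two_ne_zero)

theorem sum_leftMul_leftMul_vec_e (f : SmoothFun U (Cl m)) :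
    ∑ i, leftMul (vec (e i)) (leftMul (vec (e i)) f) = -((m : ℝ) • f) := by
  simp only [leftMul_leftMul, vec_e_mul_self, leftMul_algebraMap, Finset.sum_const,
    Finset.card_univ, Fintype.card_fin, ← Nat.cast_smul_eq_nsmul ℝ]
  module

theorem euler_leftMul (a : Cl m) (f : SmoothFun U (Cl m)) :
    euler (leftMul a f) = leftMul a (euler f) := by
  simp only [euler_eq_sum, dirDeriv_leftMul, innerMul_leftMul, map_sum]

/-- Left multiplication by the vector variable `x`. -/
def vecMul : Module.End ℝ (SmoothFun U (Cl m)) := ∑ i, leftMul (vec (e i)) * innerMul (e i)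

theorem vecMul_eq_sum (f : SmoothFun U (Cl m)) :
    vecMul f = ∑ i, leftMul (vec (e i)) (innerMul (e i) f) := by
  simp only [vecMul, LinearMap.sum_apply, Module.End.mul_apply]

@[simp] theorem vecMul_apply (f : SmoothFun U (Cl m)) (x : Vec m) : vecMul f x = vec x * f x := by
  rw [vecMul_eq_sum, SmoothFun.sum_apply, ← sum_inner_smul_vec, Finset.sum_mul]
  exact Finset.sum_congr rfl fun i _ => by
    rw [leftMul_apply, innerMul_apply, mul_smul_comm, smul_mul_assoc, real_inner_comm]

theorem innerMul_vecMul (w : Vec m) (f : SmoothFun U (Cl m)) :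
    innerMul w (vecMul f) = vecMul (innerMul w f) :=
  ext_on fun x _ => by simp

theorem dirDeriv_vecMul (w : Vec m) (f : SmoothFun U (Cl m)) :
    dirDeriv w (vecMul f) = vecMul (dirDeriv w f) + leftMul (vec w) f := by
  simp only [vecMul_eq_sum, map_sum, dirDeriv_leftMul, dirDeriv_innerMul, map_add, map_smul,
    Finset.sum_add_distrib, real_inner_comm _ w, sum_inner_smul_leftMul]

theorem euler_vecMul (f : SmoothFun U (Cl m)) :
    euler (vecMul f) = vecMul (euler f) + vecMul f := by
  simp only [vecMul_eq_sum, map_sum, euler_leftMul, euler_innerMul, map_add,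
    Finset.sum_add_distrib]

theorem leftMul_vec_vecMul (w : Vec m) (f : SmoothFun U (Cl m)) :
    leftMul (vec w) (vecMul f) = -vecMul (leftMul (vec w) f) - (2 : ℝ) • innerMul w f :=
  ext_on fun x _ => by
    simp only [leftMul_apply, vecMul_apply, sub_apply, neg_apply, smul_apply, innerMul_apply,
      ← mul_assoc]
    rw [eq_sub_of_add_eq (vec_mul_add_swap w x), sub_mul, ← Algebra.smul_def, real_inner_comm]
    module

end Clifford

end SmoothFun

/-! ### Powers of the norm -/

section InnerProductSpace

variable {V : Type*} [NormedAddCommGroup V] [InnerProductSpace ℝ V]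

theorem hasFDerivAt_norm {x : V} (hx : x ≠ 0) :
    HasFDerivAt (fun y : V => ‖y‖) (‖x‖⁻¹ • innerSL ℝ x) x := by
  have hsqrt := (hasStrictFDerivAt_norm_sq x).hasFDerivAt.sqrt (by simpa using hx)
  simp only [Real.sqrt_sq (norm_nonneg _)] at hsqrt
  convert hsqrt using 1
  ext w
  simp only [smul_apply, innerSL_apply_apply, smul_eq_mul, nsmul_eq_mul, Nat.cast_ofNat]
  field_simp

theorem hasFDerivAt_norm_zpow (s : ℤ) {x : V} (hx : x ≠ 0) :
    HasFDerivAt (fun y : V => ‖y‖ ^ s) ((s * ‖x‖ ^ (s - 2)) • innerSL ℝ x) x := by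
  have hn : ‖x‖ ≠ 0 := norm_ne_zero_iff.2 hx
  have hcomp := (hasDerivAt_zpow s ‖x‖ (Or.inl hn)).comp_hasFDerivAt x (hasFDerivAt_norm hx)
  rwa [smul_smul, mul_assoc, ← zpow_sub_one₀ hn (s - 1), sub_sub, one_add_one_eq_two] at hcomp

theorem contDiffOn_norm_zpow (s : ℤ) : ContDiffOn ℝ ∞ (fun y : V => ‖y‖ ^ s) {0}ᶜ := by
  intro x hx
  have hnorm : ContDiffAt ℝ ∞ (fun y : V => ‖y‖) x := contDiffAt_norm ℝ hx
  refine ContDiffAt.contDiffWithinAt ?_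
  rcases s with n | n
  · simpa using hnorm.pow n
  · simp only [zpow_negSucc]
    exact (hnorm.pow (n + 1)).inv (pow_ne_zero _ (norm_ne_zero_iff.2 hx))

end InnerProductSpace

namespace SmoothFun

variable {m : ℕ}

theorem contDiffOn_algebraMap_norm_zpow (s : ℤ) :
    ContDiffOn ℝ ∞ (fun x : Vec m => algebraMap ℝ (Cl m) (‖x‖ ^ s)) (offZero m) :=
  (LinearMap.toContinuousLinearMap (Algebra.linearMap ℝ (Cl m))).contDiff.comp_contDiffOn
    (contDiffOn_norm_zpow s)

/-- The function `‖x‖^s` on `ℝ^m ∖ {0}`. -/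
def normZpow (m : ℕ) (s : ℤ) : SmoothFun (offZero m) (Cl m) :=
  ofContDiffOn (fun x => algebraMap ℝ (Cl m) (‖x‖ ^ s)) (contDiffOn_algebraMap_norm_zpow s)

theorem normZpow_apply (s : ℤ) {x : Vec m} (hx : x ≠ 0) :
    normZpow m s x = algebraMap ℝ (Cl m) (‖x‖ ^ s) :=
  ofContDiffOn_apply (contDiffOn_algebraMap_norm_zpow s) hx

theorem dirDeriv_normZpow (s : ℤ) (w : Vec m) :
    dirDeriv w (normZpow m s) = (s : ℝ) • innerMul w (normZpow m (s - 2)) :=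
  ext_on fun x hx => by
    let A : ℝ →L[ℝ] Cl m := LinearMap.toContinuousLinearMap (Algebra.linearMap ℝ (Cl m))
    have hA : HasFDerivAt (fun y : Vec m => A (‖y‖ ^ s)) _ x :=
      A.hasFDerivAt.comp x (hasFDerivAt_norm_zpow s hx)
    have heq := eventuallyEq_nhds (normZpow m s) (fun y hy => (normZpow_apply s hy).symm) hx
    rw [dirDeriv_apply w _ hx, ← heq.fderiv_eq, smul_apply, innerMul_apply, normZpow_apply _ hx,
      show (fun y : Vec m => algebraMap ℝ (Cl m) (‖y‖ ^ s)) = fun y => A (‖y‖ ^ s) from rfl,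
      hA.fderiv]
    simp [A, Algebra.algebraMap_eq_smul_one, smul_smul, mul_right_comm, mul_assoc]

theorem rightMul_normZpow (a : Cl m) (s : ℤ) :
    rightMul a (normZpow m s) = leftMul a (normZpow m s) := ext_on fun x hx => by
  rw [rightMul_apply, leftMul_apply, normZpow_apply s hx, Algebra.commutes]

theorem norm_sq_mul_zpow_sub_two (s : ℤ) {x : Vec m} (hx : x ≠ 0) :
    ‖x‖ ^ 2 * ‖x‖ ^ (s - 2) = ‖x‖ ^ s := by
  rw [← zpow_natCast, ← zpow_add₀ (norm_ne_zero_iff.2 hx), Nat.cast_ofNat, add_sub_cancel]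

theorem vecMul_vecMul_normZpow (s : ℤ) :
    vecMul (vecMul (normZpow m (s - 2))) = -normZpow m s := ext_on fun x hx => by
  rw [vecMul_apply, vecMul_apply, ← mul_assoc, vec_mul_self, neg_apply, normZpow_apply _ hx,
    normZpow_apply _ hx, ← map_mul, ← map_neg, neg_mul, norm_sq_mul_zpow_sub_two s hx]

theorem sum_innerMul_innerMul_normZpow (s : ℤ) :
    ∑ i, innerMul (e i) (innerMul (e i) (normZpow m (s - 2))) = normZpow m s :=
  ext_on fun x hx => by
    have hsum : ∑ i, ⟪x, e i⟫ * ⟪x, e i⟫ = ‖x‖ ^ 2 := by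
      rw [EuclideanSpace.real_norm_sq_eq]
      exact Finset.sum_congr rfl fun i _ => by rw [real_inner_comm, inner_e, sq]
    simp only [SmoothFun.sum_apply, innerMul_apply, smul_smul]
    rw [← Finset.sum_smul, hsum, normZpow_apply _ hx, normZpow_apply _ hx, Algebra.smul_def,
      ← map_mul, norm_sq_mul_zpow_sub_two s hx]

theorem euler_normZpow (s : ℤ) : euler (normZpow m s) = (s : ℝ) • normZpow m s := by
  simp only [euler_eq_sum, dirDeriv_normZpow, map_smul]
  rw [← Finset.smul_sum, sum_innerMul_innerMul_normZpow]

theorem lap_normZpow (s : ℤ) :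
    lap (normZpow m s) = ((s : ℝ) * (m + s - 2)) • normZpow m (s - 2) := by
  simp only [lap_eq_sum, dirDeriv_normZpow, map_smul]
  rw [← Finset.smul_sum, sum_dirDeriv_innerMul, euler_normZpow]
  push_cast
  module

theorem lap_pow_normZpow {n : ℕ} {t : ℤ} (ht : t = 2 * (n + 1) - m) :
    (lap ^ (n + 1)) (normZpow m t) = 0 := by
  induction n generalizing t with
  | zero => rw [zero_add, pow_one, lap_normZpow, ht]; simp
  | succ n ih =>
    rw [pow_succ, Module.End.mul_apply, lap_normZpow, map_smul,
      ih (t := t - 2) (by rw [ht]; push_cast; ring), smul_zero]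

theorem dirac_vecMul_normZpow (s : ℤ) :
    dirac (vecMul (normZpow m s)) = -((m + s : ℝ) • normZpow m s) := by
  have hvec : ∑ i, leftMul (vec (e i)) (vecMul (innerMul (e i) (normZpow m (s - 2)))) =
      -normZpow m s := by
    simp only [← innerMul_vecMul, ← vecMul_eq_sum, vecMul_vecMul_normZpow]
  simp only [dirac_eq_sum, dirDeriv_vecMul, dirDeriv_normZpow, map_smul, map_add,
    Finset.sum_add_distrib]
  rw [sum_leftMul_leftMul_vec_e, ← Finset.smul_sum, hvec]
  module

end SmoothFun

/-! ### The families annihilated by the operators -/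

namespace SmoothFun

variable {m : ℕ} {U : Opens (Vec m)}

theorem lap_pow_succ_of_dirac_eq {f g : SmoothFun U (Cl m)} {c : ℝ} (h : dirac f = c • g) (n : ℕ) :
    (lap ^ (n + 1)) f = -(c • dirac ((lap ^ n) g)) := by
  have hlap : lap f = -(c • dirac g) := by rw [← neg_eq_iff_eq_neg, ← dirac_dirac, h, map_smul]
  rw [pow_succ, Module.End.mul_apply, hlap, map_neg, map_smul, lap_pow_comm lap_dirac]

theorem dirac_dirac_lap_pow {f : SmoothFun U (Cl m)} {n : ℕ} (h : (lap ^ (n + 1)) f = 0) :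
    dirac (dirac ((lap ^ n) f)) = 0 := by
  rw [dirac_dirac, ← Module.End.mul_apply, ← pow_succ', h, neg_zero]

theorem rightMul_vecMul (a : Cl m) (f : SmoothFun U (Cl m)) :
    rightMul a (vecMul f) = vecMul (rightMul a f) :=
  ext_on fun x _ => by simp [mul_assoc]

theorem dirDeriv_vecMul_normZpow (t : ℤ) (v : Vec m) :
    dirDeriv v (vecMul (normZpow m t)) =
      leftMul (vec v) (normZpow m t) + (t : ℝ) • innerMul v (vecMul (normZpow m (t - 2))) := by
  rw [dirDeriv_vecMul, dirDeriv_normZpow, map_smul, innerMul_vecMul]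
  abel

theorem innerMul_vecMul_normZpow {t : ℤ} (ht : (t : ℝ) ≠ 0) (v : Vec m) :
    innerMul v (vecMul (normZpow m (t - 2))) =
      (t : ℝ)⁻¹ • (dirDeriv v (vecMul (normZpow m t)) - leftMul (vec v) (normZpow m t)) := by
  rw [dirDeriv_vecMul_normZpow, add_sub_cancel_left, inv_smul_smul₀ ht]

theorem rightMul_dirac_lap_pow_normZpow (t : ℤ) (n : ℕ) (v : Vec m) :
    rightMul (vec v) (dirac ((lap ^ n) (normZpow m t))) =
      -leftMul (vec v) (dirac ((lap ^ n) (normZpow m t)))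
        - (2 : ℝ) • dirDeriv v ((lap ^ n) (normZpow m t)) := by
  rw [← dirac_rightMul, ← lap_pow_comm (lap_rightMul _), rightMul_normZpow,
    lap_pow_comm (lap_leftMul _), dirac_leftMul_vec]

end SmoothFun

section Families

open SmoothFun

variable {m : ℕ}

section DivU

variable {U : Opens (Vec m)}

theorem divU_comp {A : Module.End ℝ (SmoothFun U (Cl m))}
    (hA : ∀ w f, A (dirDeriv w f) = dirDeriv w (A f)) (f : Vec m →ₗ[ℝ] SmoothFun U (Cl m)) :
    divU (A ∘ₗ f) = A (divU f) := by
  simp only [divU, map_sum, LinearMap.comp_apply, hA]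

theorem divU_lap_pow_comp (n : ℕ) (f : Vec m →ₗ[ℝ] SmoothFun U (Cl m)) :
    divU ((lap ^ n) ∘ₗ f) = (lap ^ n) (divU f) :=
  divU_comp (fun w => lap_pow_comm (lap_dirDeriv w) n) f

theorem divU_lap_pow_comp_dirac_comp (n : ℕ) (f : Vec m →ₗ[ℝ] SmoothFun U (Cl m)) :
    divU ((lap ^ n) ∘ₗ dirac ∘ₗ f) = dirac ((lap ^ n) (divU f)) := by
  rw [divU_lap_pow_comp, divU_comp fun w f => dirac_dirDeriv w f, lap_pow_comm lap_dirac]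

end DivU

/-- The family `u ↦ ⟨u,v⟩ ‖x‖^t - 2 ⟨x,u⟩ ⟨x,v⟩ ‖x‖^(t-2) = ‖x‖^t ⟨xux / ‖x‖², v⟩`. -/
def evenFamily (t : ℤ) (v : Vec m) : Vec m →ₗ[ℝ] SmoothFun (offZero m) (Cl m) :=
  ((innerₗ (Vec m)).flip v).smulRight (normZpow m t)
    - (2 : ℝ) • innerMul.flip (innerMul v (normZpow m (t - 2)))

theorem evenFamily_apply (t : ℤ) (u v : Vec m) :
    evenFamily t v u =
      ⟪u, v⟫ • normZpow m t - (2 : ℝ) • innerMul u (innerMul v (normZpow m (t - 2))) := rfl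

theorem divU_evenFamily (t : ℤ) (v : Vec m) :
    divU (evenFamily t v) = -((2 * m + t - 2 : ℝ) • innerMul v (normZpow m (t - 2))) := by
  have hsum : ∑ i, ⟪e i, v⟫ • dirDeriv (e i) (normZpow m t) = dirDeriv v (normZpow m t) :=
    sum_inner_smul_map (LinearMap.flip dirDeriv (normZpow m t)) v
  simp only [divU, evenFamily_apply, map_sub, map_smul, Finset.sum_sub_distrib]
  rw [hsum, ← Finset.smul_sum, sum_dirDeriv_innerMul, euler_innerMul, euler_normZpow,
    dirDeriv_normZpow, map_smul]
  push_cast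
  module

theorem lap_pow_innerMul_normZpow {n : ℕ} {t : ℤ} (ht : t = 2 * (n + 1) - m) (ht0 : (t : ℝ) ≠ 0)
    (v : Vec m) : (lap ^ (n + 1)) (innerMul v (normZpow m (t - 2))) = 0 := by
  have hsmul : (t : ℝ) • (lap ^ (n + 1)) (innerMul v (normZpow m (t - 2))) = 0 := by
    rw [← map_smul, ← dirDeriv_normZpow, lap_pow_comm (lap_dirDeriv v), lap_pow_normZpow ht,
      map_zero]
  exact (smul_eq_zero.1 hsmul).resolve_left ht0

theorem bosonicLin_evenFamily {n : ℕ} {t : ℤ} (ht : t = 2 * (n + 1) - m) (hnm : 2 * (n + 1) < m)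
    (u v : Vec m) : bosonicLin (n + 1) (evenFamily t v) u = 0 := by
  have htr : (t : ℝ) = 2 * (n + 1) - m := by exact_mod_cast ht
  have hlt : (2 * (n + 1) : ℝ) < m := by exact_mod_cast hnm
  have ht0 : (t : ℝ) ≠ 0 := by linarith
  have hden : (m + 2 * (n + 1) - 2 : ℝ) ≠ 0 := by linarith [n.cast_nonneg (α := ℝ)]
  rw [bosonicLin, divU_lap_pow_comp, divU_evenFamily, evenFamily_apply, Nat.add_sub_cancel]
  simp only [map_sub, map_smul, map_neg, lap_pow_innerMul, lap_pow_normZpow ht,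
    lap_pow_innerMul_normZpow ht ht0, map_zero, Nat.add_sub_cancel]
  push_cast
  rw [htr]
  match_scalars
  field_simp
  ring

/-- The family `u ↦ m ⟨u,v⟩ x‖x‖^t - 2m ⟨x,u⟩ ⟨x,v⟩ x‖x‖^(t-2) - u x v ‖x‖^t`, which equals
`x ‖x‖^t (m ⟨w,v⟩ + w v)` for `w = xux / ‖x‖²`. -/
def oddFamily (t : ℤ) (v : Vec m) : Vec m →ₗ[ℝ] SmoothFun (offZero m) (Cl m) :=
  (m : ℝ) • ((innerₗ (Vec m)).flip v).smulRight (vecMul (normZpow m t))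
    - (2 * m : ℝ) • innerMul.flip (innerMul v (vecMul (normZpow m (t - 2))))
    - (leftMul ∘ₗ CliffordAlgebra.ι (negSq m)).flip (rightMul (vec v) (vecMul (normZpow m t)))

theorem oddFamily_apply (t : ℤ) (u v : Vec m) :
    oddFamily t v u = (m : ℝ) • ⟪u, v⟫ • vecMul (normZpow m t)
      - (2 * m : ℝ) • innerMul u (innerMul v (vecMul (normZpow m (t - 2))))
      - leftMul (vec u) (rightMul (vec v) (vecMul (normZpow m t))) := rfl

theorem divU_oddFamily (t : ℤ) (v : Vec m) :
    divU (oddFamily t v) = (m : ℝ) • dirDeriv v (vecMul (normZpow m t))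
      - (2 * m * (m + t) : ℝ) • innerMul v (vecMul (normZpow m (t - 2)))
      + (m + t : ℝ) • rightMul (vec v) (normZpow m t) := by
  have hsum : ∑ i, ⟪e i, v⟫ • dirDeriv (e i) (vecMul (normZpow m t)) =
      dirDeriv v (vecMul (normZpow m t)) :=
    sum_inner_smul_map (LinearMap.flip dirDeriv (vecMul (normZpow m t))) v
  simp only [divU, oddFamily_apply, map_sub, map_smul, Finset.sum_sub_distrib, dirDeriv_leftMul]
  rw [← dirac_eq_sum, ← Finset.smul_sum, hsum, ← Finset.smul_sum, sum_dirDeriv_innerMul,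
    euler_innerMul, euler_vecMul, euler_normZpow, map_smul, map_add, map_smul, dirac_rightMul,
    dirac_vecMul_normZpow, map_neg, map_smul]
  push_cast
  module

theorem divU_oddFamily_neg (v : Vec m) :
    divU (oddFamily (-m) v) = (m : ℝ) • dirDeriv v (vecMul (normZpow m (-m))) := by
  rw [divU_oddFamily]
  push_cast
  module

theorem dirac_innerMul_vecMul_normZpow (v : Vec m) :
    dirac (innerMul v (vecMul (normZpow m (-m - 2)))) =
      -rightMul (vec v) (vecMul (normZpow m (-m - 2))) := by
  rw [dirac_innerMul, dirac_vecMul_normZpow, leftMul_vec_vecMul, map_neg, map_smul,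
    rightMul_vecMul, rightMul_normZpow]
  push_cast
  module

theorem dirac_oddFamily_neg (u v : Vec m) :
    dirac (oddFamily (-m) v u) =
      (2 : ℝ) • leftMul (vec u) (dirDeriv v (vecMul (normZpow m (-m)))) := by
  have hmonogenic : dirac (vecMul (normZpow m (-m))) = 0 := by rw [dirac_vecMul_normZpow]; simp
  rw [oddFamily_apply]
  simp only [map_sub, map_smul]
  rw [dirac_innerMul, dirac_innerMul_vecMul_normZpow, dirac_leftMul_vec, dirac_rightMul,
    hmonogenic, dirDeriv_rightMul, dirDeriv_vecMul_normZpow, dirDeriv_vecMul_normZpow]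
  simp only [map_neg, map_smul, map_add, map_zero, innerMul_rightMul, rightMul_leftMul,
    rightMul_normZpow]
  push_cast
  module

theorem fermionicLin_one_oddFamily (hm : 0 < m) (u v : Vec m) :
    fermionicLin 1 (oddFamily (-m) v) u = 0 := by
  have hm0 : (m : ℝ) ≠ 0 := by positivity
  have hden : (m + 2 * (1 : ℕ) - 2 : ℝ) = m := by push_cast; ring
  have hdivU : divU ((lap ^ (1 - 1)) ∘ₗ oddFamily (-m) v) = divU (oddFamily (-m) v) := rfl
  rw [fermionicLin, hdivU, divU_oddFamily_neg, Nat.sub_self, pow_zero, Module.End.one_apply,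
    dirac_oddFamily_neg, map_smul, hden]
  match_scalars <;> field_simp <;> norm_num

section Odd

variable {n : ℕ} {t : ℤ}

theorem dirac_vecMul_normZpow_of_eq (ht : t = 2 * (n + 1) - m) :
    dirac (vecMul (normZpow m t)) = (-(2 * (n + 1)) : ℝ) • normZpow m t := by
  rw [dirac_vecMul_normZpow, ht]
  push_cast
  module

theorem lap_pow_vecMul_normZpow (ht : t = 2 * (n + 1) - m) :
    (lap ^ (n + 1)) (vecMul (normZpow m t)) =
      (2 * (n + 1) : ℝ) • dirac ((lap ^ n) (normZpow m t)) := by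
  rw [lap_pow_succ_of_dirac_eq (dirac_vecMul_normZpow_of_eq ht)]
  module

theorem dirac_lap_pow_vecMul_normZpow (ht : t = 2 * (n + 1) - m) :
    dirac ((lap ^ n) (vecMul (normZpow m t))) =
      (-(2 * (n + 1)) : ℝ) • (lap ^ n) (normZpow m t) := by
  rw [← lap_pow_comm lap_dirac, dirac_vecMul_normZpow_of_eq ht, map_smul]

theorem lap_pow_innerMul_vecMul_normZpow (ht : t = 2 * (n + 1) - m) (ht0 : (t : ℝ) ≠ 0)
    (v : Vec m) :
    (lap ^ (n + 1)) (innerMul v (vecMul (normZpow m (t - 2)))) =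
      (2 * (n + 1) / t : ℝ) • dirDeriv v (dirac ((lap ^ n) (normZpow m t))) := by
  rw [innerMul_vecMul_normZpow ht0, map_smul, map_sub, lap_pow_comm (lap_dirDeriv v),
    lap_pow_comm (lap_leftMul _), lap_pow_normZpow ht, lap_pow_vecMul_normZpow ht, map_zero,
    sub_zero, map_smul]
  module

theorem dirac_lap_pow_innerMul_vecMul_normZpow (ht : t = 2 * (n + 1) - m) (ht0 : (t : ℝ) ≠ 0)
    (v : Vec m) :
    dirac ((lap ^ n) (innerMul v (vecMul (normZpow m (t - 2))))) =
      (t : ℝ)⁻¹ • (leftMul (vec v) (dirac ((lap ^ n) (normZpow m t)))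
        - (2 * n : ℝ) • dirDeriv v ((lap ^ n) (normZpow m t))) := by
  rw [innerMul_vecMul_normZpow ht0, map_smul, map_sub, lap_pow_comm (lap_dirDeriv v),
    lap_pow_comm (lap_leftMul _), map_smul, map_sub, dirac_dirDeriv,
    dirac_lap_pow_vecMul_normZpow ht, dirac_leftMul_vec, map_smul]
  module

theorem lap_pow_divU_oddFamily (ht : t = 2 * (n + 1) - m) (ht0 : (t : ℝ) ≠ 0) (v : Vec m) :
    (lap ^ (n + 1)) (divU (oddFamily t v)) =
      (-(2 * (n + 1) * m * (m + 2 * (n + 1)) / t) : ℝ) •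
        dirDeriv v (dirac ((lap ^ n) (normZpow m t))) := by
  rw [divU_oddFamily]
  simp only [map_sub, map_add, map_smul, lap_pow_comm (lap_dirDeriv v),
    lap_pow_comm (lap_rightMul _), lap_pow_normZpow ht, lap_pow_vecMul_normZpow ht,
    lap_pow_innerMul_vecMul_normZpow ht ht0, map_zero]
  have htr : (m : ℝ) = 2 * (n + 1) - t := by rw [ht]; push_cast; ring
  rw [htr]
  match_scalars
  field_simp
  ring

theorem dirac_lap_pow_divU_oddFamily (ht : t = 2 * (n + 1) - m) (ht0 : (t : ℝ) ≠ 0) (v : Vec m) :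
    dirac ((lap ^ n) (divU (oddFamily t v))) =
      (-(2 * (n + 1) * (m + 2 * (n + 1)) / t) : ℝ) •
        (leftMul (vec v) (dirac ((lap ^ n) (normZpow m t)))
          - (m - 2 : ℝ) • dirDeriv v ((lap ^ n) (normZpow m t))) := by
  rw [divU_oddFamily]
  simp only [map_sub, map_add, map_smul, lap_pow_comm (lap_dirDeriv v),
    lap_pow_comm (lap_rightMul _), dirac_dirDeriv, dirac_rightMul,
    dirac_lap_pow_vecMul_normZpow ht, dirac_lap_pow_innerMul_vecMul_normZpow ht ht0,
    rightMul_dirac_lap_pow_normZpow]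
  have htr : (m : ℝ) = 2 * (n + 1) - t := by rw [ht]; push_cast; ring
  rw [htr]
  match_scalars <;> field_simp <;> ring

theorem dirac_lap_pow_oddFamily (ht : t = 2 * (n + 1) - m) (ht0 : (t : ℝ) ≠ 0) (u v : Vec m) :
    dirac ((lap ^ (n + 1)) (oddFamily t v u)) =
      (-(4 * (n + 1) * m / t) : ℝ) •
          leftMul (vec u) (dirDeriv v (dirac ((lap ^ n) (normZpow m t))))
        - (8 * (n + 1) ^ 2 / t : ℝ) • dirDeriv u
            (leftMul (vec v) (dirac ((lap ^ n) (normZpow m t)))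
              - (m - 2 : ℝ) • dirDeriv v ((lap ^ n) (normZpow m t))) := by
  have hdirac := dirac_dirac_lap_pow (lap_pow_normZpow (m := m) ht)
  rw [oddFamily_apply]
  simp only [map_sub, map_smul]
  rw [lap_pow_innerMul u]
  simp only [map_sub, map_add, map_smul, map_neg, Nat.add_sub_cancel,
    lap_pow_comm (lap_leftMul _), lap_pow_comm (lap_rightMul _), lap_pow_vecMul_normZpow ht,
    lap_pow_innerMul_vecMul_normZpow ht ht0, dirac_innerMul, dirac_dirDeriv, dirac_leftMul_vec,
    dirac_lap_pow_innerMul_vecMul_normZpow ht ht0, hdirac,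
    rightMul_dirac_lap_pow_normZpow, dirDeriv_leftMul, map_zero]
  have htr : (m : ℝ) = 2 * (n + 1) - t := by rw [ht]; push_cast; ring
  rw [htr]
  push_cast
  match_scalars <;> field_simp <;> ring

theorem fermionicLin_succ_oddFamily (ht : t = 2 * (n + 1) - m) (ht0 : (t : ℝ) ≠ 0)
    (u v : Vec m) : fermionicLin (n + 2) (oddFamily t v) u = 0 := by
  have hden : (m + 2 * (n + 2) - 2 : ℝ) ≠ 0 := by
    rw [show (m + 2 * (n + 2) - 2 : ℝ) = m + 2 * (n + 1) by ring]
    positivity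
  rw [fermionicLin, show n + 2 - 1 = n + 1 from rfl, show n + 2 - 2 = n from rfl,
    divU_lap_pow_comp, divU_lap_pow_comp_dirac_comp, dirac_lap_pow_oddFamily ht ht0,
    lap_pow_divU_oddFamily ht ht0, dirac_lap_pow_divU_oddFamily ht ht0]
  simp only [map_sub, map_smul]
  push_cast
  match_scalars <;> field_simp <;> ring

end Odd

end Families

/-! ### The fundamental solutions -/

section Fundamental

open SmoothFun

variable {m k : ℕ}

theorem vec_smul (c : ℝ) (x : Vec m) : vec (c • x) = c • vec x := map_smul _ _ _

theorem inner_sandwich (x u v : Vec m) :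
    ⟪sandwich x u, v⟫ = ‖x‖ ^ 2 * ⟪u, v⟫ - 2 * ⟪x, u⟫ * ⟪x, v⟫ := by
  rw [sandwich, inner_sub_left, real_inner_smul_left, real_inner_smul_left]

theorem vec_mul_vec_inv_smul_sandwich {x : Vec m} (hx : x ≠ 0) (u : Vec m) :
    vec x * vec ((‖x‖ ^ 2)⁻¹ • sandwich x u) = -(vec u * vec x) := by
  have hn : ‖x‖ ^ 2 ≠ 0 := pow_ne_zero 2 (norm_ne_zero_iff.2 hx)
  rw [vec_smul, vec_sandwich, mul_smul_comm, ← mul_assoc, ← mul_assoc, vec_mul_self,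
    ← Algebra.smul_def, smul_mul_assoc, smul_smul, mul_neg, inv_mul_cancel₀ hn,
    neg_one_smul]

theorem inv_smul_sandwich_smul {t : ℝ} (ht : t ≠ 0) (x u : Vec m) :
    (‖t • x‖ ^ 2)⁻¹ • sandwich (t • x) u = (‖x‖ ^ 2)⁻¹ • sandwich x u := by
  have hsandwich : sandwich (t • x) u = t ^ 2 • sandwich x u := by
    simp only [sandwich, norm_smul, real_inner_smul_left, smul_sub, smul_smul, mul_pow,
      Real.norm_eq_abs, sq_abs]
    module
  rw [hsandwich, smul_smul, norm_smul, mul_pow, Real.norm_eq_abs, sq_abs]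
  congr 1
  field_simp

theorem G_zero (hkm : k < m) : G m k 0 = 0 := by
  have h : (m : ℤ) - k ≠ 0 := by lia
  unfold G
  split_ifs
  · simp [zero_zpow _ h]
  · simp

theorem G_smul {t : ℝ} (ht : 0 < t) (x : Vec m) :
    G m k (t • x) = t ^ ((k : ℤ) - m) • G m k x := by
  unfold G
  rw [norm_smul, Real.norm_of_nonneg ht.le]
  split_ifs
  · rw [Algebra.algebraMap_eq_smul_one, Algebra.algebraMap_eq_smul_one, smul_smul, mul_zpow,
      one_div, mul_inv, ← zpow_neg, one_div, neg_sub]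
  · rw [vec_smul, smul_smul, smul_smul, mul_zpow, one_div, mul_inv, ← zpow_neg, one_div,
      mul_right_comm, ← zpow_add_one₀ ht.ne']
    congr 3
    ring

theorem E_zero (hkm : k < m) (c₁ : ℝ) (u v : Vec m) : E m k c₁ 0 u v = 0 := by
  simp [E, G_zero hkm]

theorem E_smul (c₁ : ℝ) (u v : Vec m) {t : ℝ} (ht : 0 < t) (x : Vec m) :
    E m k c₁ (t • x) u v = t ^ ((k : ℤ) - m) • E m k c₁ x u v := by
  rw [E, E, inv_smul_sandwich_smul ht.ne', G_smul ht, smul_mul_assoc, smul_comm]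

theorem E_neg (hk : Odd k) (c₁ : ℝ) (x u v : Vec m) : E m k c₁ (-x) u v = -E m k c₁ x u v := by
  have hk' : ¬ Even k := Nat.not_even_iff_odd.2 hk
  simp [E, G, if_neg hk', sandwich, vec]

open Classical in
/-- The fundamental solutions `E_{1,k}(·, u, v)`, as a family of smooth functions which is linear
in `u`. -/
def kernelFamily (k : ℕ) (c₁ : ℝ) (v : Vec m) : Vec m →ₗ[ℝ] SmoothFun (offZero m) (Cl m) :=
  if Even k then (c₁ * (sphereArea m)⁻¹ * m) • evenFamily (k - m) v
  else (c₁ * (sphereArea m)⁻¹) • oddFamily (k - 1 - m) v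

theorem kernelFamily_of_even (hk : Even k) (c₁ : ℝ) (v : Vec m) :
    kernelFamily k c₁ v = (c₁ * (sphereArea m)⁻¹ * m) • evenFamily (k - m) v := if_pos hk

theorem kernelFamily_of_odd (hk : Odd k) (c₁ : ℝ) (v : Vec m) :
    kernelFamily k c₁ v = (c₁ * (sphereArea m)⁻¹) • oddFamily (k - 1 - m) v :=
  if_neg (Nat.not_even_iff_odd.2 hk)

theorem E_eq_evenFamily (hk : Even k) (c₁ : ℝ) {x : Vec m} (hx : x ≠ 0) (u v : Vec m) :
    E m k c₁ x u v = (c₁ * (sphereArea m)⁻¹ * m) • evenFamily (k - m) v u x := by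
  have hn : ‖x‖ ≠ 0 := norm_ne_zero_iff.2 hx
  rw [E, G, Z₁, if_pos hk, if_pos hk, evenFamily_apply, SmoothFun.sub_apply,
    SmoothFun.smul_apply, SmoothFun.smul_apply,
    innerMul_apply, innerMul_apply, normZpow_apply _ hx, normZpow_apply _ hx,
    real_inner_smul_left, inner_sandwich, zpow_sub₀ hn (k - m : ℤ) 2, zpow_sub₀ hn (k : ℤ) m,
    zpow_sub₀ hn (m : ℤ) k]
  simp only [Algebra.algebraMap_eq_smul_one, add_zero, smul_mul_assoc, one_mul, zpow_natCast,
    zpow_ofNat]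
  match_scalars
  field_simp

theorem E_eq_oddFamily (hk : Odd k) (c₁ : ℝ) {x : Vec m} (hx : x ≠ 0) (u v : Vec m) :
    E m k c₁ x u v = (c₁ * (sphereArea m)⁻¹) • oddFamily (k - 1 - m) v u x := by
  have hn : ‖x‖ ≠ 0 := norm_ne_zero_iff.2 hx
  have hz : ‖x‖ ^ ((k : ℤ) - 1 - m) = 1 / ‖x‖ ^ ((m : ℤ) - k + 1) := by
    rw [one_div, ← zpow_neg]
    congr 1
    ring
  have hz' : ‖x‖ ^ ((k : ℤ) - 1 - m - 2) = 1 / ‖x‖ ^ ((m : ℤ) - k + 1) * (‖x‖ ^ 2)⁻¹ := by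
    rw [zpow_sub₀ hn _ 2, hz, zpow_ofNat, div_eq_mul_inv]
  have hk' : ¬ Even k := Nat.not_even_iff_odd.2 hk
  rw [E, G, Z₁, if_neg hk', if_neg hk', real_inner_smul_left, inner_sandwich, smul_mul_assoc,
    mul_smul_comm, mul_add, ← mul_assoc (vec x), vec_mul_vec_inv_smul_sandwich hx,
    oddFamily_apply]
  simp only [SmoothFun.sub_apply, SmoothFun.smul_apply, innerMul_apply, leftMul_apply,
    rightMul_apply, vecMul_apply, normZpow_apply _ hx, hz, hz', Algebra.algebraMap_eq_smul_one,
    mul_smul_comm, smul_mul_assoc, mul_one, mul_assoc, neg_mul]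
  match_scalars <;> field_simp

theorem kernelFamily_apply (hkm : k < m) (c₁ : ℝ) (x u v : Vec m) :
    kernelFamily k c₁ v u x = E m k c₁ x u v := by
  by_cases hx : x = 0
  · subst hx
    rw [E_zero hkm, apply_of_notMem _ (by simp [mem_offZero])]
  rcases Nat.even_or_odd k with hk | hk
  · rw [kernelFamily_of_even hk, E_eq_evenFamily hk c₁ hx, LinearMap.smul_apply,
      SmoothFun.smul_apply]
  · rw [kernelFamily_of_odd hk, E_eq_oddFamily hk c₁ hx, LinearMap.smul_apply,
      SmoothFun.smul_apply]

theorem decay_kernelFamily {l : ℕ} (hl : l + k ≤ m) (hkm : k < m) (c₁ : ℝ) (u v : Vec m) :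
    Decay l (kernelFamily k c₁ v u : Vec m → Cl m) :=
  IsHomogeneous.decay (s := (k : ℤ) - m)
    (fun t ht x _ => by rw [kernelFamily_apply hkm, kernelFamily_apply hkm, E_smul c₁ u v ht])
    (by lia) (contDiffOn (kernelFamily k c₁ v u))

theorem opLin_smul {U : Opens (Vec m)} (k : ℕ) (c : ℝ) (f : Vec m →ₗ[ℝ] SmoothFun U (Cl m))
    (u : Vec m) : opLin k (c • f) u = c • opLin k f u := by
  have hgraph : IsDiffStable (LinearMap.graph (c • LinearMap.id (M := SmoothFun U (Cl m)))) :=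
    { dirDeriv_mem := fun w q hq => by
        rw [LinearMap.mem_graph_iff] at hq ⊢
        simp [hq]
      leftMul_mem := fun a q hq => by
        rw [LinearMap.mem_graph_iff] at hq ⊢
        simp [hq] }
  exact hgraph.opLin_mem k (f := f) (g := c • f) (fun w => rfl) u

theorem opLin_evenFamily (hk : Even k) (hk1 : 1 ≤ k) (hkm : k < m) (u v : Vec m) :
    opLin k (evenFamily (k - m) v) u = 0 := by
  obtain ⟨n, rfl⟩ : ∃ n, k = 2 * (n + 1) := by
    obtain ⟨n, rfl⟩ := hk
    exact ⟨n - 1, by lia⟩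
  rw [opLin, if_pos hk, Nat.mul_div_cancel_left _ two_pos]
  exact bosonicLin_evenFamily (by push_cast; ring) hkm u v

theorem opLin_oddFamily (hk : Odd k) (hkm : k < m) (u v : Vec m) :
    opLin k (oddFamily (k - 1 - m) v) u = 0 := by
  obtain ⟨n, rfl⟩ := hk
  rw [opLin, if_neg (Nat.not_even_iff_odd.2 ⟨n, rfl⟩), show (2 * n + 1 + 1) / 2 = n + 1 by lia]
  cases n with
  | zero =>
    rw [show ((2 * 0 + 1 : ℕ) : ℤ) - 1 - m = -m by simp]
    exact fermionicLin_one_oddFamily (by lia) u v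
  | succ n =>
    refine fermionicLin_succ_oddFamily (by push_cast; ring) ?_ u v
    exact_mod_cast (by push_cast; lia : ((2 * (n + 1) + 1 : ℕ) : ℤ) - 1 - m ≠ 0)

theorem opLin_kernelFamily (hk : 1 ≤ k) (hkm : k < m) (c₁ : ℝ) (u v : Vec m) :
    opLin k (kernelFamily k c₁ v) u = 0 := by
  rcases Nat.even_or_odd k with hk' | hk'
  · rw [kernelFamily_of_even hk', opLin_smul, opLin_evenFamily hk' hk hkm, smul_zero]
  · rw [kernelFamily_of_odd hk', opLin_smul, opLin_oddFamily hk' hkm, smul_zero]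

theorem sum_leftMul_oddFamily (t : ℤ) (v : Vec m) :
    ∑ i, leftMul (vec (e i)) (oddFamily t v (e i)) = 0 := by
  simp only [oddFamily_apply, map_smul, map_sub, Finset.sum_sub_distrib, ← Finset.smul_sum]
  rw [sum_inner_smul_leftMul, sum_leftMul_leftMul_vec_e, ← vecMul_eq_sum, ← innerMul_vecMul,
    vecMul_vecMul_normZpow, leftMul_vec_vecMul, rightMul_vecMul, rightMul_normZpow, map_neg]
  module

theorem sum_leftMul_kernelFamily (hk : Odd k) (c₁ : ℝ) (v : Vec m) :
    ∑ i, leftMul (vec (e i)) (kernelFamily k c₁ v (e i)) = 0 := by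
  simp only [kernelFamily_of_odd hk, LinearMap.smul_apply, map_smul]
  rw [← Finset.smul_sum, sum_leftMul_oddFamily, smul_zero]

end Fundamental

/-! ### Periodized families -/

section PeriodizeFamily

open SmoothFun

variable {m l p k : ℕ} {δ : Lat m l}

/-- The relation between a function which decays and its sign-twisted periodization. It is stable
under the operations from which the operators `𝓓_{1,k}` are built, so periodization commutes with
these operators. -/
def periodizeRel (p : ℕ) (δ : Lat m l) :
    Submodule ℝ (SmoothFun (offZero m) (Cl m) × SmoothFun (offLattice m l) (Cl m)) where
  carrier := {q | Decay l (q.1 : Vec m → Cl m) ∧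
    ∀ x ∉ lattice m l, q.2 x = periodize p δ (q.1 : Vec m → Cl m) x}
  zero_mem' := ⟨Decay.zero, fun x _ => by
    change (0 : Cl m) = periodize p δ (fun _ => 0) x
    simp [periodize, diffTerm]⟩
  add_mem' := fun {q r} hq hr => ⟨hq.1.add hr.1, fun x hx => by
    change q.2 x + r.2 x = periodize p δ (q.1.1 + r.1.1) x
    rw [hq.2 x hx, hr.2 x hx, periodize_add hq.1 hr.1 hx]⟩
  smul_mem' := fun c q hq => ⟨hq.1.clm_comp (c • ContinuousLinearMap.id ℝ (Cl m)), fun x hx => by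
    change c • q.2 x = periodize p δ (fun y => (c • ContinuousLinearMap.id ℝ (Cl m)) (q.1.1 y)) x
    rw [hq.2 x hx, periodize_clm hq.1 _ hx]
    rfl⟩

theorem leftMul_mem_periodizeRel (a : Cl m) :
    ∀ q ∈ periodizeRel p δ, (leftMul a q.1, leftMul a q.2) ∈ periodizeRel p δ := fun q hq => by
  let A : Cl m →L[ℝ] Cl m := LinearMap.toContinuousLinearMap (LinearMap.mul ℝ (Cl m) a)
  refine ⟨hq.1.clm_comp A, fun x hx => ?_⟩
  change a * q.2 x = periodize p δ (fun y => A (q.1.1 y)) x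
  rw [hq.2 x hx, periodize_clm hq.1 _ hx]
  rfl

theorem dirDeriv_mem_periodizeRel (w : Vec m) :
    ∀ q ∈ periodizeRel p δ, (dirDeriv w q.1, dirDeriv w q.2) ∈ periodizeRel p δ := fun q hq => by
  let A : (Vec m →L[ℝ] Cl m) →L[ℝ] Cl m := ContinuousLinearMap.apply ℝ (Cl m) w
  have hderiv : ∀ x ≠ 0, dirDeriv w q.1 x = A (fderiv ℝ q.1 x) :=
    fun x hx => dirDeriv_apply w q.1 hx
  refine ⟨(hq.1.fderiv.clm_comp A).congr hderiv, fun x hx => ?_⟩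
  have hperiodize : periodize p δ (dirDeriv w q.1 : Vec m → Cl m) x
      = periodize p δ (fun y => A (fderiv ℝ q.1 y)) x := by
    simp only [periodize, diffTerm]
    congr 2
    funext a
    rw [hderiv _ (add_emb_ne_zero hx a.2), hderiv _ (add_emb_ne_zero hx (a + δ).2)]
  have heq : (q.2 : Vec m → Cl m) =ᶠ[𝓝 x] periodize p δ (q.1 : Vec m → Cl m) := by
    filter_upwards [(offLattice m l).isOpen.mem_nhds hx] with y hy using hq.2 y hy
  change dirDeriv w q.2 x = periodize p δ (dirDeriv w q.1 : Vec m → Cl m) x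
  rw [hperiodize, periodize_clm hq.1.fderiv _ hx, dirDeriv_apply w q.2 hx, heq.fderiv_eq,
    (hq.1.hasFDerivAt_periodize hx).fderiv]
  rfl

theorem isDiffStable_periodizeRel : IsDiffStable (periodizeRel p δ) where
  dirDeriv_mem := dirDeriv_mem_periodizeRel
  leftMul_mem := leftMul_mem_periodizeRel

theorem eq_of_mem_periodizeRel {f : SmoothFun (offZero m) (Cl m)}
    {g g' : SmoothFun (offLattice m l) (Cl m)} (h : (f, g) ∈ periodizeRel p δ)
    (h' : (f, g') ∈ periodizeRel p δ) : g = g' :=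
  ext_on fun x hx => by rw [h.2 x hx, h'.2 x hx]

theorem mk_mem_periodizeRel {f : SmoothFun (offZero m) (Cl m)}
    (hf : Decay l (f : Vec m → Cl m)) :
    (f, ofContDiffOn (U := offLattice m l) (periodize p δ f) hf.contDiffOn_periodize) ∈
      periodizeRel p δ :=
  ⟨hf, fun _ hx => ofContDiffOn_apply (U := offLattice m l) hf.contDiffOn_periodize hx⟩

/-- The sign-twisted periodization of a family of functions which is linear in `u`. -/
def periodizeFamily (p : ℕ) (δ : Lat m l) (f : Vec m →ₗ[ℝ] SmoothFun (offZero m) (Cl m))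
    (hf : ∀ u, Decay l (f u : Vec m → Cl m)) :
    Vec m →ₗ[ℝ] SmoothFun (offLattice m l) (Cl m) where
  toFun u := ofContDiffOn (periodize p δ (f u : Vec m → Cl m)) (hf u).contDiffOn_periodize
  map_add' u w := eq_of_mem_periodizeRel (mk_mem_periodizeRel (hf (u + w))) <| by
    rw [map_add]
    exact add_mem (mk_mem_periodizeRel (hf u)) (mk_mem_periodizeRel (hf w))
  map_smul' c u := eq_of_mem_periodizeRel (mk_mem_periodizeRel (hf (c • u))) <| by
    rw [map_smul]
    exact Submodule.smul_mem _ c (mk_mem_periodizeRel (hf u))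

theorem periodizeFamily_mem (f : Vec m →ₗ[ℝ] SmoothFun (offZero m) (Cl m))
    (hf : ∀ u, Decay l (f u : Vec m → Cl m)) (u : Vec m) :
    (f u, periodizeFamily p δ f hf u) ∈ periodizeRel p δ := mk_mem_periodizeRel (hf u)

theorem laplacian_linearMap {V W : Type*} [NormedAddCommGroup V] [InnerProductSpace ℝ V]
    [FiniteDimensional ℝ V] [NormedAddCommGroup W] [NormedSpace ℝ W] (L : V →ₗ[ℝ] W) (u : V) :
    Laplacian.laplacian (fun w => L w) u = 0 := by
  have hfderiv : (fderiv ℝ fun w => L w) = fun _ => LinearMap.toContinuousLinearMap L :=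
    funext fun x => (LinearMap.toContinuousLinearMap L).hasFDerivAt.fderiv
  rw [InnerProductSpace.laplacian_eq_iteratedFDeriv_stdOrthonormalBasis]
  refine Finset.sum_eq_zero fun i _ => ?_
  rw [iteratedFDeriv_two_apply, hfderiv]
  simp

theorem mem_degreeOne_of_linearMap (L : Vec m →ₗ[ℝ] Cl m)
    (hL : ¬ Even k → ∑ i, vec (e i) * L (e i) = 0) : (fun u => L u) ∈ degreeOne m k :=
  ⟨⟨L, fun _ => rfl⟩, fun _ u => laplacian_linearMap L u, fun hk u => by
    simp only [diracU, lineDeriv_linearMap]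
    exact hL hk⟩

theorem contDiffOn_uncurry_family {U : Opens (Vec m)} (f : Vec m →ₗ[ℝ] SmoothFun U (Cl m)) :
    ContDiffOn ℝ ∞ (fun q : Vec m × Vec m => f q.2 q.1) ((U : Set (Vec m)) ×ˢ univ) := by
  have hsum : (fun q : Vec m × Vec m => f q.2 q.1) = fun q => ∑ i, q.2 i • f (e i) q.1 := by
    funext q
    rw [← sum_coord_smul_map f q.2, SmoothFun.sum_apply]
    rfl
  rw [hsum]
  refine ContDiffOn.sum fun i _ => ContDiffOn.fun_smul ?_ ?_
  · exact ((EuclideanSpace.proj (𝕜 := ℝ) i).contDiff.comp contDiff_snd).contDiffOn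
  · exact (contDiffOn (f (e i))).comp contDiff_fst.contDiffOn fun q hq => hq.1

theorem isTwistedKernel_of_isRep {c : Vec m → Vec m → Vec m → Cl m}
    (F : Vec m → Vec m →ₗ[ℝ] SmoothFun (offLattice m l) (Cl m))
    (hF : ∀ v, IsRep (fun x u => c x u v) (F v))
    (hmono : ¬ Even k → ∀ v, ∑ i, leftMul (vec (e i)) (F v (e i)) = 0)
    (hper : ∀ a ∈ Lat m l, ∀ x ∉ lattice m l, ∀ u v, c (x + emb m a) u v = sgn p a • c x u v)
    (hop : ∀ u v, opLin k (F v) u = 0) : IsTwistedKernel m l k p c where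
  smooth v := (contDiffOn_uncurry_family (F v)).congr fun q hq => hF v q.1 hq.1 q.2
  degree_one x hx v := by
    let L : Vec m →ₗ[ℝ] Cl m :=
      LinearMap.proj x ∘ₗ (SmoothFun (offLattice m l) (Cl m)).subtype ∘ₗ F v
    have hL : (fun u => c x u v) = fun u => L u := funext fun u => hF v x hx u
    rw [hL]
    refine mem_degreeOne_of_linearMap L fun hk => ?_
    have hsum := congrArg (fun f : SmoothFun (offLattice m l) (Cl m) => f x) (hmono hk v)
    rwa [SmoothFun.sum_apply] at hsum
  periodic := hper
  annihilated x hx u v := by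
    rw [(hF v).opD k hx u, hop]
    rfl

theorem isTwistedKernel_of_periodize (hk : 1 ≤ k) (hkm : k < m) (hl : l + k ≤ m) {c₁ : ℝ}
    {c : Vec m → Vec m → Vec m → Cl m}
    (hc : ∀ x ∉ lattice m l, ∀ u v, c x u v = periodize p δ (fun y => E m k c₁ y u v) x) :
    IsTwistedKernel m l k p c := by
  let F : Vec m → Vec m →ₗ[ℝ] SmoothFun (offLattice m l) (Cl m) := fun v =>
    periodizeFamily p δ (kernelFamily k c₁ v) fun u => decay_kernelFamily hl hkm c₁ u v
  have hmem : ∀ v u, (kernelFamily k c₁ v u, F v u) ∈ periodizeRel p δ :=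
    fun v u => periodizeFamily_mem _ _ u
  refine isTwistedKernel_of_isRep F (fun v x hx u => ?_) (fun hk' v => ?_)
    (fun a ha x hx u v => ?_) fun u v => ?_
  · have hE : (fun y => E m k c₁ y u v) = kernelFamily k c₁ v u :=
      funext fun y => (kernelFamily_apply hkm c₁ y u v).symm
    exact (hc x hx u v).trans (hE ▸ ((hmem v u).2 x hx).symm)
  · have hsum := prodMk_sum_mem (periodizeRel p δ) fun i (_ : i ∈ Finset.univ) =>
      leftMul_mem_periodizeRel (vec (e i)) _ (hmem v (e i))
    rw [sum_leftMul_kernelFamily (Nat.not_even_iff_odd.1 hk')] at hsum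
    exact eq_of_mem_periodizeRel hsum (zero_mem _)
  · rw [hc _ (add_emb_notMem hx ha), hc x hx]
    exact periodize_add_emb ⟨a, ha⟩ x
  · have hop := isDiffStable_periodizeRel.opLin_mem k (hmem v) u
    rw [opLin_kernelFamily hk hkm] at hop
    exact eq_of_mem_periodizeRel hop (zero_mem _)

end PeriodizeFamily

/-! ### Absolutely convergent series -/

section Absolute

variable {m l p : ℕ} {W : Type*} [NormedAddCommGroup W] [NormedSpace ℝ W] {f : Vec m → W}

theorem sgn_smul_comp_add_emb (f : Vec m → W) (a δ : Lat m l) (x : Vec m) :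
    sgn p a.1 • f (x + emb m (a + δ : Lat m l))
      = sgn p δ.1 • sgn p (a + δ : Lat m l).1 • f (x + emb m (a + δ : Lat m l)) := by
  rw [smul_smul, AddSubgroup.coe_add, sgn_mul_sgn_add]

theorem Decay.exists_summable_bound_twist (hf : Decay (l + 1) f) (p : ℕ) {K : Set (Vec m)}
    (hK : IsCompact K) (hKl : K ⊆ (lattice m l : Set (Vec m))ᶜ) :
    ∃ b : Lat m l → ℝ, Summable b ∧ ∀ a : Lat m l, ∀ x ∈ K,
      ‖sgn p a.1 • f (x + emb m a)‖ ≤ b a := by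
  obtain ⟨C, hC, hdecay⟩ := hf.norm_le
  obtain ⟨R, hR⟩ := hK.exists_bound_of_continuousOn continuousOn_id
  refine exists_summable_bound_of_finite_compl hK
    (fun a => (continuousOn_comp_add_emb hf.smooth.continuousOn hKl a).const_smul _)
    ((summable_norm_emb_pow_inv (Nat.lt_succ_self l)).mul_left (C * 2 ^ (l + 1)))
    (finite_lat_norm_emb_lt (2 * R + 2)) fun a ha x hx => ?_
  have ha' : 2 * R + 2 ≤ ‖emb m a‖ := not_lt.1 ha
  have hxR : ‖x‖ ≤ R := hR x hx
  have hx0 : 0 ≤ ‖x‖ := norm_nonneg x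
  have hhalf : ‖emb m a‖ / 2 ≤ ‖x + emb m a‖ := half_norm_emb_le (by linarith)
  calc ‖sgn p a.1 • f (x + emb m a)‖ = ‖f (x + emb m a)‖ := norm_sgn_smul _ _ _
    _ ≤ C * (‖x + emb m a‖ ^ (l + 1))⁻¹ := hdecay _ (by linarith)
    _ ≤ C * (2 ^ (l + 1) * (‖emb m a‖ ^ (l + 1))⁻¹) := by
      gcongr
      exact inv_pow_le_of_half_le (by linarith) hhalf _
    _ = C * 2 ^ (l + 1) * (‖emb m a‖ ^ (l + 1))⁻¹ := (mul_assoc _ _ _).symm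

theorem Decay.periodize_eq_tsum [CompleteSpace W] (hf : Decay (l + 1) f) {δ : Lat m l}
    (hδ : sgn p δ.1 = -1) {x : Vec m} (hx : x ∉ lattice m l) :
    periodize p δ f x = ∑' a : Lat m l, sgn p a.1 • f (x + emb m a) := by
  obtain ⟨b, hb, hbound⟩ := hf.exists_summable_bound_twist p
    (isCompact_singleton (x := x)) (by simpa using hx)
  have hs : Summable fun a : Lat m l => sgn p a.1 • f (x + emb m a) :=
    Summable.of_norm_bounded hb fun a => hbound a x rfl
  have hsδ := ((Equiv.addRight δ).summable_iff.2 hs).const_smul (sgn p δ.1)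
  have htsum := (Equiv.addRight δ).tsum_eq fun a : Lat m l => sgn p a.1 • f (x + emb m a)
  simp only [Function.comp_def, Equiv.coe_addRight] at hsδ htsum
  simp only [periodize, diffTerm, smul_sub, sgn_smul_comp_add_emb]
  rw [hs.tsum_sub hsδ, tsum_const_smul'', htsum, hδ]
  module

end Absolute

/-! ### Summation over boxes -/

section Box

variable {m l p : ℕ}

theorem tendsto_atTop_of_mem_iff_abs_le {ι n : Type*} [Finite n] {s : ℕ → Finset ι}
    {φ : ι → n → ℤ} (hs : ∀ N a, a ∈ s N ↔ ∀ i, |φ a i| ≤ N) : Tendsto s atTop atTop := by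
  have := Fintype.ofFinite n
  refine tendsto_atTop_finset_of_monotone (fun N M hNM a ha => ?_) fun a => ?_
  · rw [hs] at ha ⊢
    exact fun i => (ha i).trans (by exact_mod_cast hNM)
  · refine ⟨∑ i, (φ a i).natAbs, (hs _ _).2 fun i => ?_⟩
    rw [Int.abs_eq_natAbs]
    exact_mod_cast Finset.single_le_sum (f := fun i => (φ a i).natAbs) (fun _ _ => Nat.zero_le _)
      (Finset.mem_univ i)

open Classical in
/-- The lattice points with coordinates of absolute value at most `N`. -/
def latBox (m l N : ℕ) : Finset (Lat m l) :=
  (Fintype.piFinset fun _ : Fin m => Finset.Icc (-(N : ℤ)) N).subtype (· ∈ Lat m l)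

theorem mem_latBox {N : ℕ} {a : Lat m l} : a ∈ latBox m l N ↔ ∀ i, |a.1 i| ≤ N := by
  simp [latBox, abs_le]

theorem tendsto_latBox : Tendsto (latBox m l) atTop atTop :=
  tendsto_atTop_of_mem_iff_abs_le fun _ _ => mem_latBox

variable {o : Fin m} {N : ℕ}

theorem mem_latBox_iff_of_coord (o : Fin m) {a : Lat m l} :
    a ∈ latBox m l N ↔ |a.1 o| ≤ N ∧ ∀ i ≠ o, |a.1 i| ≤ N := by
  rw [mem_latBox]
  refine ⟨fun h => ⟨h o, fun i _ => h i⟩, fun h i => ?_⟩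
  obtain rfl | hi := eq_or_ne i o
  · exact h.1
  · exact h.2 i hi

theorem sub_mem_latBox_iff {δ : Lat m l} (hδ : δ.1 = Pi.single o 1) {a : Lat m l} :
    a - δ ∈ latBox m l N ↔ |a.1 o - 1| ≤ N ∧ ∀ i ≠ o, |a.1 i| ≤ N := by
  simp +contextual [mem_latBox_iff_of_coord o, hδ]

theorem card_filter_ne_and_lt_le (ho : (o : ℕ) < l) :
    (Finset.univ.filter fun i : Fin m => i ≠ o ∧ (i : ℕ) < l).card ≤ l - 1 := by
  calc (Finset.univ.filter fun i : Fin m => i ≠ o ∧ (i : ℕ) < l).card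
      ≤ ((Finset.range l).erase o).card := by
        refine Finset.card_le_card_of_injOn (fun i => (i : ℕ)) (fun i hi => ?_)
          Fin.val_injective.injOn
        simpa [Fin.ext_iff, and_comm] using hi
    _ = l - 1 := by rw [Finset.card_erase_of_mem (Finset.mem_range.2 ho), Finset.card_range]

theorem card_face_le (ho : (o : ℕ) < l) {c : ℤ} {s : Finset (Lat m l)}
    (hs : ∀ a ∈ s, a.1 o = c ∧ ∀ i ≠ o, |a.1 i| ≤ N) : s.card ≤ (2 * N + 1) ^ (l - 1) := by
  let face : Finset (Fin m → ℤ) := Fintype.piFinset fun i : Fin m =>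
    if i ≠ o ∧ (i : ℕ) < l then Finset.Icc (-(N : ℤ)) N else {if i = o then c else 0}
  have hsub : s.card ≤ face.card := by
    refine Finset.card_le_card_of_injOn (fun a => a.1) (fun a ha => ?_)
      Subtype.val_injective.injOn
    rw [Finset.mem_coe, Fintype.mem_piFinset]
    intro i
    obtain rfl | hi := eq_or_ne i o
    · simp [(hs a ha).1]
    · by_cases hil : (i : ℕ) < l
      · simpa [hi, hil, abs_le] using (hs a ha).2 i hi
      · simpa [hi, hil] using a.2 i (not_lt.1 hil)
  have hIcc : (Finset.Icc (-(N : ℤ)) N).card = 2 * N + 1 := by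
    rw [Int.card_Icc]
    lia
  refine hsub.trans ?_
  simp only [face, Fintype.card_piFinset, apply_ite Finset.card, hIcc, Finset.card_singleton,
    Finset.prod_ite, Finset.prod_const, one_pow, mul_one]
  exact Nat.pow_le_pow_right (by lia) (card_filter_ne_and_lt_le ho)

variable {W : Type*} [NormedAddCommGroup W] [NormedSpace ℝ W] {f : Vec m → W}

theorem norm_sum_face_le {C : ℝ} (hC : 0 ≤ C) (hf : ∀ y, 1 ≤ ‖y‖ → ‖f y‖ ≤ C * (‖y‖ ^ l)⁻¹)
    (ho : (o : ℕ) < l) {c : ℤ} (hc : (N : ℤ) ≤ |c|) {s : Finset (Lat m l)}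
    (hs : ∀ a ∈ s, a.1 o = c ∧ ∀ i ≠ o, |a.1 i| ≤ N) {x : Vec m} (hx : 2 * ‖x‖ + 2 ≤ N) :
    ‖∑ a ∈ s, sgn p a.1 • f (x + emb m a)‖ ≤ C * 3 ^ (l - 1) * 2 ^ l * (N : ℝ)⁻¹ := by
  have hx0 : 0 ≤ ‖x‖ := norm_nonneg x
  have hN : (0 : ℝ) < N := by linarith
  have hterm : ∀ a ∈ s, ‖sgn p a.1 • f (x + emb m a)‖ ≤ C * (2 ^ l * ((N : ℝ) ^ l)⁻¹) := by
    intro a ha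
    have hNa : (N : ℝ) ≤ ‖emb m a‖ := by
      refine le_trans ?_ (abs_le_norm_emb a.1 o)
      rw [(hs a ha).1]
      exact_mod_cast hc
    have hhalf : ‖emb m a‖ / 2 ≤ ‖x + emb m a‖ := half_norm_emb_le (by linarith)
    rw [norm_sgn_smul]
    refine (hf _ (by linarith)).trans (mul_le_mul_of_nonneg_left ?_ hC)
    exact inv_pow_le_of_half_le hN (by linarith) _
  have hcard : (s.card : ℝ) ≤ (3 * N) ^ (l - 1) := by
    calc (s.card : ℝ) ≤ (2 * N + 1) ^ (l - 1) := by exact_mod_cast card_face_le ho hs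
      _ ≤ (3 * N) ^ (l - 1) := by
        gcongr
        linarith
  obtain ⟨j, rfl⟩ : ∃ j, l = j + 1 := Nat.exists_eq_succ_of_ne_zero (by lia)
  calc ‖∑ a ∈ s, sgn p a.1 • f (x + emb m a)‖
      ≤ s.card * (C * (2 ^ (j + 1) * ((N : ℝ) ^ (j + 1))⁻¹)) := by
        simpa using norm_sum_le_of_le s hterm
    _ ≤ (3 * N) ^ j * (C * (2 ^ (j + 1) * ((N : ℝ) ^ (j + 1))⁻¹)) := by
        gcongr
        exact hcard
    _ = C * 3 ^ j * 2 ^ (j + 1) * (N : ℝ)⁻¹ := by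
        rw [mul_pow, pow_succ (N : ℝ) j]
        field_simp

open Classical in
theorem sum_latBox_sub_half_sum_diffTerm {δ : Lat m l} (hδ : sgn p δ.1 = -1) (f : Vec m → W)
    (x : Vec m) (B : Finset (Lat m l)) :
    ∑ a ∈ B, sgn p a.1 • f (x + emb m a) - (1 / 2 : ℝ) • ∑ a ∈ B, diffTerm p δ f a x
      = (1 / 2 : ℝ) •
        (∑ a ∈ B \ B.map (Equiv.addRight δ).toEmbedding, sgn p a.1 • f (x + emb m a)
          - ∑ a ∈ B.map (Equiv.addRight δ).toEmbedding \ B, sgn p a.1 • f (x + emb m a)) := by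
  have hdiff : ∑ a ∈ B, diffTerm p δ f a x = ∑ a ∈ B, sgn p a.1 • f (x + emb m a)
      + ∑ a ∈ B.map (Equiv.addRight δ).toEmbedding, sgn p a.1 • f (x + emb m a) := by
    rw [Finset.sum_map, ← Finset.sum_add_distrib]
    refine Finset.sum_congr rfl fun a _ => ?_
    rw [diffTerm, smul_sub, sgn_smul_comp_add_emb, hδ]
    simp only [Equiv.coe_toEmbedding, Equiv.coe_addRight]
    module
  rw [hdiff, Finset.sum_sdiff_sub_sum_sdiff]
  module

/-- The difference is half that of the sums over the two faces which distinguish the box from its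
translate by `δ`: this is `O(1/N)`, although each face has about `N^{l-1}` points. -/
theorem norm_sum_latBox_sub_half_sum_diffTerm_le {C : ℝ} (hC : 0 ≤ C)
    (hf : ∀ y, 1 ≤ ‖y‖ → ‖f y‖ ≤ C * (‖y‖ ^ l)⁻¹) (ho : (o : ℕ) < l) {δ : Lat m l}
    (hδo : δ.1 = Pi.single o 1) (hδ : sgn p δ.1 = -1) {x : Vec m} (hx : 2 * ‖x‖ + 2 ≤ N) :
    ‖∑ a ∈ latBox m l N, sgn p a.1 • f (x + emb m a)
      - (1 / 2 : ℝ) • ∑ a ∈ latBox m l N, diffTerm p δ f a x‖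
        ≤ C * 3 ^ (l - 1) * 2 ^ l * (N : ℝ)⁻¹ := by
  classical
  set B := latBox m l N with hB
  set B' := B.map (Equiv.addRight δ).toEmbedding with hB'
  have mem_B' : ∀ a, a ∈ B' ↔ a - δ ∈ B := fun a => by
    simp [hB', sub_eq_add_neg]
  have face : ∀ a ∈ B \ B', a.1 o = -(N : ℤ) ∧ ∀ i ≠ o, |a.1 i| ≤ N := fun a ha => by
    rw [Finset.mem_sdiff, mem_B', sub_mem_latBox_iff hδo, hB, mem_latBox_iff_of_coord o, abs_le,
      abs_le] at ha
    exact ⟨by_contra fun h => ha.2 ⟨by lia, ha.1.2⟩, ha.1.2⟩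
  have face' : ∀ a ∈ B' \ B, a.1 o = (N : ℤ) + 1 ∧ ∀ i ≠ o, |a.1 i| ≤ N := fun a ha => by
    rw [Finset.mem_sdiff, mem_B', sub_mem_latBox_iff hδo, hB, mem_latBox_iff_of_coord o, abs_le,
      abs_le] at ha
    exact ⟨by_contra fun h => ha.2 ⟨by lia, ha.1.2⟩, ha.1.2⟩
  have hface := norm_sum_face_le (p := p) hC hf ho (by simp) face hx
  have hface' := norm_sum_face_le (p := p) hC hf ho (le_abs.2 (Or.inl (by lia))) face' hx
  rw [sum_latBox_sub_half_sum_diffTerm hδ, norm_smul, Real.norm_of_nonneg (by norm_num)]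
  linarith [norm_sub_le (∑ a ∈ B \ B', sgn p a.1 • f (x + emb m a))
    (∑ a ∈ B' \ B, sgn p a.1 • f (x + emb m a))]

theorem Decay.tendstoUniformlyOn_sum_latBox [CompleteSpace W] (hf : Decay l f) (ho : (o : ℕ) < l)
    {δ : Lat m l} (hδo : δ.1 = Pi.single o 1) (hδ : sgn p δ.1 = -1) {K : Set (Vec m)}
    (hK : IsCompact K) (hKl : K ⊆ (lattice m l : Set (Vec m))ᶜ) :
    TendstoUniformlyOn (fun N x => ∑ a ∈ latBox m l N, sgn p a.1 • f (x + emb m a))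
      (periodize p δ f) atTop K := by
  obtain ⟨b, hb, hbound⟩ := hf.exists_summable_bound_diffTerm p δ hK hKl
  have hsum : TendstoUniformlyOn (fun N x => ∑ a ∈ latBox m l N, diffTerm p δ f a x)
      (fun x => ∑' a, diffTerm p δ f a x) atTop K :=
    fun U hU => tendsto_latBox.eventually (tendstoUniformlyOn_tsum hb hbound U hU)
  have hhalf : TendstoUniformlyOn
      (fun N x => (1 / 2 : ℝ) • ∑ a ∈ latBox m l N, diffTerm p δ f a x) (periodize p δ f) atTop K :=
    (uniformContinuous_const_smul (1 / 2 : ℝ)).comp_tendstoUniformlyOn hsum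
  obtain ⟨C, hC, hdecay⟩ := hf.norm_le
  obtain ⟨R, hR⟩ := hK.exists_bound_of_continuousOn continuousOn_id
  have hfaces : TendstoUniformlyOn (fun (N : ℕ) x =>
      ∑ a ∈ latBox m l N, sgn p a.1 • f (x + emb m a)
        - (1 / 2 : ℝ) • ∑ a ∈ latBox m l N, diffTerm p δ f a x) (fun _ => 0) atTop K := by
    rw [Metric.tendstoUniformlyOn_iff]
    intro ε hε
    have hlim : Tendsto (fun N : ℕ => C * 3 ^ (l - 1) * 2 ^ l * (N : ℝ)⁻¹) atTop (𝓝 0) := by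
      simpa using tendsto_natCast_atTop_atTop.inv_tendsto_atTop.const_mul (C * 3 ^ (l - 1) * 2 ^ l)
    filter_upwards [hlim.eventually (gt_mem_nhds hε), eventually_ge_atTop ⌈2 * R + 2⌉₊]
      with N hNε hN x hx
    have hxR : ‖x‖ ≤ R := hR x hx
    have hRN : 2 * R + 2 ≤ N := Nat.ceil_le.1 hN
    rw [dist_zero_left]
    exact (norm_sum_latBox_sub_half_sum_diffTerm_le hC hdecay ho hδo hδ
      (by linarith)).trans_lt hNε
  simpa only [Pi.add_def, add_sub_cancel, add_zero] using hhalf.add hfaces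

end Box

/-! ### The symmetrized series -/

section Symmetrized

variable {m l p k : ℕ}

theorem neg_notMem_latPos {a : Fin m → ℤ} (ha : a ∈ latPos m l) : -a ∉ latPos m l := by
  rintro ⟨-, i, hi, hi'⟩
  obtain ⟨-, j, hj, hj'⟩ := ha
  rw [Pi.neg_apply] at hi
  rcases lt_trichotomy i j with h | rfl | h
  · have : -a j = 0 := hi' j h
    lia
  · lia
  · have : a i = 0 := hj' i h
    lia

theorem zero_notMem_latPos : (0 : Fin m → ℤ) ∉ latPos m l := by
  rintro ⟨-, i, hi, -⟩
  exact lt_irrefl _ hi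

theorem mem_latPos_or_neg_mem {a : Fin m → ℤ} (ha : a ∈ Lat m l) (h0 : a ≠ 0) :
    a ∈ latPos m l ∨ -a ∈ latPos m l := by
  have hne : (Finset.univ.filter fun i => a i ≠ 0).Nonempty := by
    obtain ⟨i, hi⟩ := Function.ne_iff.1 h0
    exact ⟨i, by simpa using hi⟩
  obtain ⟨j, hj, hmax⟩ := Finset.exists_max_image _ id hne
  have hj0 : a j ≠ 0 := (Finset.mem_filter.1 hj).2
  have hlast : ∀ i, j < i → a i = 0 := fun i hi => by
    by_contra h
    exact absurd (hmax i (by simpa using h)) (not_le.2 hi)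
  rcases lt_or_gt_of_ne hj0 with h | h
  · exact Or.inr ⟨neg_mem ha, j, by simpa using h, fun i hi => by simp [hlast i hi]⟩
  · exact Or.inl ⟨ha, j, h, hlast⟩

theorem mem_posBox {N : ℕ} {a : Fin m → ℤ} :
    a ∈ posBox m l N ↔ (∀ i, |a i| ≤ N) ∧ a ∈ latPos m l := by
  simp [posBox, abs_le]

open scoped Pointwise in
theorem map_latBox (m l N : ℕ) : (latBox m l N).map (Function.Embedding.subtype _)
    = insert 0 (posBox m l N ∪ -posBox m l N) := by
  ext a
  simp only [Finset.mem_map, Function.Embedding.coe_subtype, Subtype.exists, exists_and_right,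
    exists_eq_right, mem_latBox, Finset.mem_insert, Finset.mem_union, Finset.mem_neg', mem_posBox,
    Pi.neg_apply, abs_neg]
  constructor
  · rintro ⟨ha, hN⟩
    rcases eq_or_ne a 0 with h0 | h0
    · exact Or.inl h0
    · exact Or.inr ((mem_latPos_or_neg_mem ha h0).imp (.intro hN) (.intro hN))
  · rintro (rfl | h | h)
    · exact ⟨zero_mem _, fun i => by simp⟩
    · exact ⟨h.2.1, h.1⟩
    · exact ⟨neg_mem_iff.1 h.2.1, h.1⟩

open scoped Pointwise in
theorem sum_latBox_eq {M : Type*} [AddCommMonoid M] (N : ℕ) (h : (Fin m → ℤ) → M) :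
    ∑ a ∈ latBox m l N, h a = h 0 + ∑ a ∈ posBox m l N, (h a + h (-a)) := by
  have hzero : 0 ∉ posBox m l N ∪ -posBox m l N := by
    simp [mem_posBox, zero_notMem_latPos]
  have hdisj : Disjoint (posBox m l N) (-posBox m l N) := Finset.disjoint_left.2 fun a ha ha' =>
    neg_notMem_latPos (mem_posBox.1 ha).2 (mem_posBox.1 (Finset.mem_neg'.1 ha')).2
  calc ∑ a ∈ latBox m l N, h a = ∑ a ∈ (latBox m l N).map (Function.Embedding.subtype _), h a :=
        (Finset.sum_map _ (Function.Embedding.subtype _) h).symm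
    _ = h 0 + ∑ a ∈ posBox m l N, (h a + h (-a)) := by
        rw [map_latBox, Finset.sum_insert hzero, Finset.sum_union hdisj, Finset.sum_neg_index,
          Finset.sum_add_distrib]

theorem sgn_neg (p : ℕ) (a : Fin m → ℤ) : sgn p (-a) = sgn p a := by
  simpa [sgn_zero] using (sgn_mul_sgn_add p a (-a)).symm

theorem symPartial_eq_sum_latBox (k N : ℕ) (c₁ : ℝ) (u v x : Vec m) :
    symPartial m l k p c₁ u v N x
      = ∑ a ∈ latBox m l N, sgn p a.1 • E m k c₁ (x + emb m a) u v := by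
  rw [sum_latBox_eq N fun a => sgn p a • E m k c₁ (x + emb m a) u v, symPartial]
  simp only [symTerm, sgn_zero, sgn_neg, one_smul, map_zero, add_zero, map_neg, ← sub_eq_add_neg,
    smul_add]

theorem tendsto_sum_posBox {M : Type*} [AddCommMonoid M] [TopologicalSpace M]
    {h : (Fin m → ℤ) → M} {s : M} (hs : HasSum (fun a : latPos m l => h a) s) :
    Tendsto (fun N => ∑ a ∈ posBox m l N, h a) atTop (𝓝 s) := by
  classical
  have hbox : Tendsto (fun N => (posBox m l N).subtype (· ∈ latPos m l)) atTop atTop :=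
    tendsto_atTop_of_mem_iff_abs_le (φ := fun a : latPos m l => a.1) fun N a => by
      simp [mem_posBox]
  refine (hs.comp hbox).congr fun N => ?_
  exact Finset.sum_subtype_of_mem h fun a ha => (mem_posBox.1 ha).2

theorem decay_E (hl : l + k ≤ m) (hkm : k < m) (c₁ : ℝ) (u v : Vec m) :
    Decay l fun x => E m k c₁ x u v :=
  (decay_kernelFamily hl hkm c₁ u v).congr fun x _ => (kernelFamily_apply hkm c₁ x u v).symm

/-- For odd `k` the kernel is odd in `x`, so that the two summands of `symTerm` are a difference of
values at points at distance `2‖x‖`: this gains one order of decay. -/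
theorem norm_symTerm_le (hk : Odd k) (hl : l + k ≤ m) (hkm : k < m) (p : ℕ) (c₁ : ℝ)
    (u v : Vec m) : ∃ C, 0 ≤ C ∧ ∀ (x : Vec m) (a : Fin m → ℤ), 8 * ‖x‖ + 4 ≤ ‖emb m a‖ →
      ‖symTerm m k p c₁ u v a x‖ ≤ C * ‖x‖ * (‖emb m a‖ ^ (l + 1))⁻¹ := by
  obtain ⟨C, hC, hsub⟩ := (decay_E hl hkm c₁ u v).norm_sub_le
  refine ⟨C * 2 ^ (l + 1) * 2, by positivity, fun x a ha => ?_⟩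
  have hx : 0 ≤ ‖x‖ := norm_nonneg x
  have hhalf : ‖emb m a‖ / 2 ≤ ‖-x + emb m a‖ := half_norm_emb_le (by rw [norm_neg]; linarith)
  have hdist : ‖x + emb m a - (-x + emb m a)‖ = 2 * ‖x‖ := by
    rw [add_sub_add_right_eq_sub, sub_neg_eq_add, ← two_smul ℝ, norm_smul, Real.norm_ofNat]
  have hodd : E m k c₁ (x - emb m a) u v = -E m k c₁ (-x + emb m a) u v := by
    rw [← E_neg hk, neg_add, neg_neg, sub_eq_add_neg]
  rw [symTerm, norm_sgn_smul, hodd, ← sub_eq_add_neg]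
  calc ‖E m k c₁ (x + emb m a) u v - E m k c₁ (-x + emb m a) u v‖
      ≤ C * (‖-x + emb m a‖ ^ (l + 1))⁻¹ * (2 * ‖x‖) :=
        hdist ▸ hsub _ _ (by linarith) (by linarith)
    _ ≤ C * (2 ^ (l + 1) * (‖emb m a‖ ^ (l + 1))⁻¹) * (2 * ‖x‖) := by
        gcongr
        exact inv_pow_le_of_half_le (by linarith) hhalf _
    _ = C * 2 ^ (l + 1) * 2 * ‖x‖ * (‖emb m a‖ ^ (l + 1))⁻¹ := by ring

theorem exists_summable_bound_symTerm (hk : Odd k) (hl : l + k ≤ m) (hkm : k < m) (p : ℕ)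
    (c₁ : ℝ) (u v : Vec m) {K : Set (Vec m)} (hK : IsCompact K)
    (hKl : K ⊆ (lattice m l : Set (Vec m))ᶜ) :
    ∃ b : latPos m l → ℝ, Summable b ∧ ∀ a : latPos m l, ∀ x ∈ K,
      ‖symTerm m k p c₁ u v a x‖ ≤ b a := by
  obtain ⟨C, hC, hterm⟩ := norm_symTerm_le hk hl hkm p c₁ u v
  obtain ⟨R, hR⟩ := hK.exists_bound_of_continuousOn continuousOn_id
  let ι : latPos m l → Lat m l := Set.inclusion fun _ ha => ha.1
  have hι : Function.Injective ι := Set.inclusion_injective _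
  have hE : ContinuousOn (fun x => E m k c₁ x u v) {0}ᶜ :=
    (decay_E hl hkm c₁ u v).smooth.continuousOn
  refine exists_summable_bound_of_finite_compl hK (fun a => ?_)
    (((summable_norm_emb_pow_inv (Nat.lt_succ_self l)).comp_injective hι).mul_left (C * R))
    ((finite_lat_norm_emb_lt (8 * R + 4)).preimage hι.injOn) fun a ha x hx => ?_
  · have hcont := ((continuousOn_comp_add_emb hE hKl (ι a)).add
      (continuousOn_comp_add_emb hE hKl (-ι a))).const_smul (sgn p a.1)
    refine hcont.congr fun x _ => ?_
    rw [symTerm, sub_eq_add_neg x, ← map_neg]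
    rfl
  · have ha' : 8 * R + 4 ≤ ‖emb m a‖ := not_lt.1 ha
    have hxR : ‖x‖ ≤ R := hR x hx
    refine (hterm x a (by linarith)).trans ?_
    rw [Function.comp_apply]
    gcongr

end Symmetrized

/-! ### Second moments of the sphere -/

section Sphere

open scoped Pointwise

section Isometry

variable {V : Type*} [NormedAddCommGroup V] [InnerProductSpace ℝ V]

/-- The action of a linear isometry on the unit sphere. -/
def sphereHomeomorph (A : V ≃ₗᵢ[ℝ] V) : Metric.sphere (0 : V) 1 ≃ₜ Metric.sphere (0 : V) 1 :=
  A.toHomeomorph.subtype fun x => by simp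

theorem coe_sphereHomeomorph (A : V ≃ₗᵢ[ℝ] V) (u : Metric.sphere (0 : V) 1) :
    (sphereHomeomorph A u : V) = A u := rfl

theorem smul_image_preimage_sphereHomeomorph (A : V ≃ₗᵢ[ℝ] V) (I : Set ℝ)
    (s : Set (Metric.sphere (0 : V) 1)) :
    I • ((↑) '' (sphereHomeomorph A ⁻¹' s) : Set V) = A ⁻¹' (I • ((↑) '' s : Set V)) := by
  ext x
  simp only [Set.mem_smul, mem_image, mem_preimage]
  constructor
  · rintro ⟨t, ht, _, ⟨u, hu, rfl⟩, rfl⟩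
    exact ⟨t, ht, _, ⟨_, hu, rfl⟩, (A.map_smul t u).symm⟩
  · rintro ⟨t, ht, _, ⟨u, hu, rfl⟩, hx⟩
    refine ⟨t, ht, _, ⟨(sphereHomeomorph A).symm u, by simpa using hu, rfl⟩, A.injective ?_⟩
    rw [A.map_smul, ← coe_sphereHomeomorph, Homeomorph.apply_symm_apply, hx]

variable [FiniteDimensional ℝ V] [MeasurableSpace V] [BorelSpace V]

theorem measurePreserving_sphereHomeomorph (A : V ≃ₗᵢ[ℝ] V) :
    MeasurePreserving (sphereHomeomorph A) (volume : Measure V).toSphere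
      (volume : Measure V).toSphere := by
  have hA : Measurable (sphereHomeomorph A) := (sphereHomeomorph A).continuous.measurable
  refine ⟨hA, Measure.ext fun s hs => ?_⟩
  rw [Measure.map_apply hA hs, Measure.toSphere_apply' _ (hA hs), Measure.toSphere_apply' _ hs,
    smul_image_preimage_sphereHomeomorph,
    A.measurePreserving.measure_preimage_emb A.toHomeomorph.measurableEmbedding]

theorem integral_comp_sphereHomeomorph {W : Type*} [NormedAddCommGroup W] [NormedSpace ℝ W]
    (A : V ≃ₗᵢ[ℝ] V) (g : V → W) :
    ∫ u : Metric.sphere (0 : V) 1, g (A u) ∂(volume : Measure V).toSphere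
      = ∫ u : Metric.sphere (0 : V) 1, g u ∂(volume : Measure V).toSphere :=
  (measurePreserving_sphereHomeomorph A).integral_comp
    (sphereHomeomorph A).measurableEmbedding fun u => g u

theorem integrable_toSphere {W : Type*} [NormedAddCommGroup W] {g : V → W} (hg : Continuous g) :
    Integrable (fun u : Metric.sphere (0 : V) 1 => g u) (volume : Measure V).toSphere :=
  (hg.comp continuous_subtype_val).integrable_of_hasCompactSupport
    (HasCompactSupport.of_compactSpace _)

end Isometry

variable {m : ℕ}

theorem integral_coord_mul_coord_of_ne {i j : Fin m} (hij : i ≠ j) :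
    ∫ u : Metric.sphere (0 : Vec m) 1, u.1 i * u.1 j ∂(volume : Measure (Vec m)).toSphere = 0 := by
  let R : Vec m ≃ₗᵢ[ℝ] Vec m := Submodule.reflection (ℝ ∙ (e i : Vec m))ᗮ
  have hR : ∀ (u : Vec m) (a : Fin m), R u a = u a - 2 * u i * (e i : Vec m) a := by
    intro u a
    rw [Submodule.reflection_orthogonal_apply, Submodule.reflection_singleton_apply]
    simp [inner_e]
  have hodd : ∀ u : Vec m, R u i * R u j = -(u i * u j) := by
    intro u
    simp only [hR, PiLp.single_apply, if_true, if_neg hij.symm]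
    ring
  have hinv := integral_comp_sphereHomeomorph R fun u => u i * u j
  simp only [hodd, integral_neg] at hinv
  linarith

theorem integral_coord_sq_eq (i j : Fin m) :
    ∫ u : Metric.sphere (0 : Vec m) 1, u.1 i * u.1 i ∂(volume : Measure (Vec m)).toSphere
      = ∫ u : Metric.sphere (0 : Vec m) 1, u.1 j * u.1 j ∂(volume : Measure (Vec m)).toSphere := by
  rw [← integral_comp_sphereHomeomorph
    (LinearIsometryEquiv.piLpCongrLeft 2 ℝ ℝ (Equiv.swap i j)) fun u => u j * u j]
  simp [Equiv.piCongrLeft'_apply]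

theorem sum_integral_coord_sq :
    ∑ i, ∫ u : Metric.sphere (0 : Vec m) 1, u.1 i * u.1 i ∂(volume : Measure (Vec m)).toSphere
      = sphereArea m := by
  have hunit : ∀ u : Metric.sphere (0 : Vec m) 1, ∑ i, u.1 i * u.1 i = 1 := fun u => by
    simp only [← sq, ← EuclideanSpace.real_norm_sq_eq, mem_sphere_zero_iff_norm.1 u.2, one_pow]
  rw [← integral_finsetSum _ fun i _ => integrable_toSphere (g := fun u : Vec m => u i * u i)
    (by fun_prop)]
  simp only [hunit, integral_const, smul_eq_mul, mul_one, sphereArea]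

theorem integral_coord_mul_coord (hm : 0 < m) (i j : Fin m) :
    ∫ u : Metric.sphere (0 : Vec m) 1, u.1 i * u.1 j ∂(volume : Measure (Vec m)).toSphere
      = if i = j then sphereArea m / m else 0 := by
  split_ifs with h
  · rw [← h, eq_div_iff (by positivity), ← sum_integral_coord_sq,
      Finset.sum_congr rfl fun j _ => integral_coord_sq_eq j i]
    simp [mul_comm]
  · exact integral_coord_mul_coord_of_ne h

theorem integral_bilin_toSphere {W : Type*} [NormedAddCommGroup W] [NormedSpace ℝ W]
    [CompleteSpace W] (hm : 0 < m) (B : Vec m →ₗ[ℝ] Vec m →ₗ[ℝ] W) :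
    ∫ u : Metric.sphere (0 : Vec m) 1, B u u ∂(volume : Measure (Vec m)).toSphere
      = (sphereArea m / m) • ∑ i, B (e i) (e i) := by
  have hB : ∀ u : Vec m, B u u = ∑ i, ∑ j, (u i * u j) • B (e i) (e j) := fun u => by
    simp only [mul_smul, ← Finset.smul_sum, sum_coord_smul_map]
    rw [← sum_coord_smul_map B u, LinearMap.sum_apply]
    rfl
  have hint : ∀ i j : Fin m, Integrable (fun u : Metric.sphere (0 : Vec m) 1 =>
      (u.1 i * u.1 j) • B (e i) (e j)) (volume : Measure (Vec m)).toSphere := fun i j =>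
    integrable_toSphere (g := fun u : Vec m => (u i * u j) • B (e i) (e j)) (by fun_prop)
  calc ∫ u : Metric.sphere (0 : Vec m) 1, B u u ∂(volume : Measure (Vec m)).toSphere
      = ∫ u : Metric.sphere (0 : Vec m) 1, ∑ i, ∑ j, (u.1 i * u.1 j) • B (e i) (e j)
          ∂(volume : Measure (Vec m)).toSphere := by simp only [hB]
    _ = ∑ i, ∑ j, (if i = j then sphereArea m / m else 0) • B (e i) (e j) := by
        rw [integral_finsetSum _ fun i _ => integrable_finsetSum _ fun j _ => hint i j]
        refine Finset.sum_congr rfl fun i _ => ?_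
        rw [integral_finsetSum _ fun j _ => hint i j]
        simp only [integral_smul_const, integral_coord_mul_coord hm]
    _ = (sphereArea m / m) • ∑ i, B (e i) (e i) := by
        simp only [ite_smul, zero_smul, Finset.sum_ite_eq, Finset.mem_univ, if_true,
          Finset.smul_sum]

theorem sphereArea_ne_zero (hm : 0 < m) : sphereArea m ≠ 0 := by
  have : Nonempty (Fin m) := ⟨⟨0, hm⟩⟩
  have : NeZero (volume : Measure (Vec m)).toSphere := ⟨Measure.toSphere_ne_zero _⟩
  exact measureReal_univ_pos.ne'

end Sphere

/-! ### The reproducing kernel -/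

section Kernel

variable {m k : ℕ}

/-- The kernel `Z₁(·, v)` as a linear map. -/
def Z₁Lin (m k : ℕ) (v : Vec m) : Vec m →ₗ[ℝ] Cl m where
  toFun u := Z₁ m k u v
  map_add' u w := by
    unfold Z₁
    split_ifs <;> simp [inner_add_left, mul_add, add_mul]
    abel
  map_smul' c u := by
    unfold Z₁
    split_ifs <;>
      simp [real_inner_smul_left, Algebra.algebraMap_eq_smul_one, smul_smul, mul_comm,
        mul_left_comm]

/-- The Clifford conjugation as a continuous linear equivalence. -/
def conj (m : ℕ) : Cl m ≃L[ℝ] Cl m :=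
  (LinearEquiv.ofInvolutive
    { toFun := star
      map_add' := star_add
      map_smul' := CliffordAlgebra.star_smul } star_involutive).toContinuousLinearEquiv

theorem Z₁_mem_degreeOne (v : Vec m) : (fun u => Z₁ m k u v) ∈ degreeOne m k := by
  refine mem_degreeOne_of_linearMap (Z₁Lin m k v) fun hk => ?_
  have hterm : ∀ i : Fin m, vec (e i) * Z₁Lin m k v (e i)
      = (sphereArea m)⁻¹ • ((m : ℝ) • (⟪e i, v⟫ • vec (e i)) - vec v) := by
    intro i
    change vec (e i) * Z₁ m k (e i) v = _
    rw [Z₁, if_neg hk, mul_smul_comm, mul_add, ← mul_assoc, vec_e_mul_self, ← Algebra.commutes,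
      ← Algebra.smul_def, ← Algebra.smul_def, mul_smul, neg_one_smul, sub_eq_add_neg]
  simp only [hterm, ← Finset.smul_sum, Finset.sum_sub_distrib, sum_inner_smul_vec,
    Finset.sum_const, Finset.card_univ, Fintype.card_fin, ← Nat.cast_smul_eq_nsmul ℝ, sub_self,
    smul_zero]

open Classical in
theorem star_Z₁_mul (u v : Vec m) (w : Cl m) : star (Z₁ m k u v) * w
    = (sphereArea m)⁻¹ • ((m : ℝ) • ⟪u, v⟫ • w + vec v * if Even k then 0 else vec u * w) := by
  rw [Z₁, CliffordAlgebra.star_smul, star_add, CliffordAlgebra.star_algebraMap, smul_mul_assoc,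
    add_mul, ← Algebra.smul_def, mul_smul]
  congr 2
  split_ifs
  · simp
  · rw [star_mul, vec, vec, CliffordAlgebra.star_ι, CliffordAlgebra.star_ι, neg_mul_neg, mul_assoc]

theorem sum_star_Z₁_mul (L : Vec m →ₗ[ℝ] Cl m)
    (hL : ¬ Even k → ∑ i, vec (e i) * L (e i) = 0) (v : Vec m) :
    ∑ i, star (Z₁ m k (e i) v) * L (e i) = (m / sphereArea m) • L v := by
  have hmono : (∑ i, if Even k then 0 else vec (e i) * L (e i)) = 0 := by
    split_ifs with hk
    exacts [Finset.sum_const_zero, hL hk]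
  simp only [star_Z₁_mul, ← Finset.smul_sum, Finset.sum_add_distrib, ← Finset.mul_sum, hmono,
    sum_inner_smul_map, mul_zero, add_zero]
  rw [smul_smul, inv_mul_eq_div]

theorem isReproducingKernel_Z₁ (hm : 0 < m) : IsReproducingKernel m k (Z₁ m k) := by
  refine ⟨Z₁_mem_degreeOne, fun g hg v => ?_⟩
  obtain ⟨⟨L, hL⟩, -, hmono⟩ := hg
  obtain rfl : g = fun u => L u := funext hL
  simp only [diracU, lineDeriv_linearMap] at hmono
  let B : Vec m →ₗ[ℝ] Vec m →ₗ[ℝ] Cl m :=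
    (LinearMap.mul ℝ (Cl m)).compl₁₂ ((conj m).toLinearEquiv.toLinearMap ∘ₗ Z₁Lin m k v) L
  have hA := sphereArea_ne_zero hm
  have hm' : (m : ℝ) ≠ 0 := by positivity
  calc L v = (sphereArea m / m) • (m / sphereArea m) • L v := by
        rw [smul_smul, div_mul_div_cancel₀ hm', div_self hA, one_smul]
    _ = (sphereArea m / m) • ∑ i, B (e i) (e i) := by
        rw [← sum_star_Z₁_mul L fun hk => hmono hk 0]
        rfl
    _ = ∫ u : Metric.sphere (0 : Vec m) 1, B u u ∂(volume : Measure (Vec m)).toSphere :=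
        (integral_bilin_toSphere hm B).symm

theorem IsReproducingKernel.star_eq {Z Z' : Vec m → Vec m → Cl m} (hZ : IsReproducingKernel m k Z)
    (hZ' : IsReproducingKernel m k Z') (v w : Vec m) : star (Z' v w) = Z w v := by
  rw [hZ'.2 _ (hZ.1 v) w, hZ.2 _ (hZ'.1 w) v]
  change conj m (∫ u : Metric.sphere (0 : Vec m) 1, star (Z u v) * Z' u w
    ∂(volume : Measure (Vec m)).toSphere) = _
  rw [← (conj m).integral_comp_comm]
  congr 1
  funext u
  change star (star (Z u v) * Z' u w) = _
  rw [star_mul, star_star]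

theorem IsReproducingKernel.unique {Z Z' : Vec m → Vec m → Cl m} (hZ : IsReproducingKernel m k Z)
    (hZ' : IsReproducingKernel m k Z') : Z = Z' :=
  funext fun w => funext fun v => by rw [← hZ.star_eq hZ' v w, hZ'.star_eq hZ' v w]

end Kernel

/-! ### Translations -/

section Translation

open SmoothFun

variable {V F : Type*} [NormedAddCommGroup V] [NormedSpace ℝ V] [NormedAddCommGroup F]
  [NormedSpace ℝ F]

/-- The translate `U + y`. -/
def translateOpens (U : Opens V) (y : V) : Opens V :=
  U.comap ⟨fun x => x - y, continuous_id.sub continuous_const⟩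

/-- The translation `f ↦ f(· - y)` from `C^∞(U, F)` to `C^∞(U + y, F)`. -/
def translate (U : Opens V) (y : V) : SmoothFun U F →ₗ[ℝ] SmoothFun (translateOpens U y) F where
  toFun f := ⟨fun x => f (x - y),
    (contDiffOn f).comp (contDiff_id.sub contDiff_const).contDiffOn fun _ hx => hx,
    fun _ hx => apply_of_notMem f hx⟩
  map_add' _ _ := rfl
  map_smul' _ _ := rfl

theorem translate_apply (U : Opens V) (y : V) (f : SmoothFun U F) (x : V) :
    translate U y f x = f (x - y) := rfl

theorem dirDeriv_translate (U : Opens V) (y w : V) (f : SmoothFun U F) :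
    dirDeriv w (translate U y f) = translate U y (dirDeriv w f) := ext_on fun x hx => by
  have hx' : x - y ∈ U := hx
  rw [translate_apply, dirDeriv_apply w _ hx, dirDeriv_apply w f hx']
  change fderiv ℝ (fun x => f (x - y)) x w = _
  rw [fderiv_comp_sub]

theorem opLin_comp {m : ℕ} {U W : Opens (Vec m)} {T : SmoothFun U (Cl m) →ₗ[ℝ] SmoothFun W (Cl m)}
    (hderiv : ∀ w f, dirDeriv w (T f) = T (dirDeriv w f))
    (hmul : ∀ a f, leftMul a (T f) = T (leftMul a f))
    (k : ℕ) (f : Vec m →ₗ[ℝ] SmoothFun U (Cl m)) (u : Vec m) :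
    opLin k (T ∘ₗ f) u = T (opLin k f u) := by
  have hT : IsDiffStable T.graph := by
    refine ⟨fun w q hq => ?_, fun a q hq => ?_⟩ <;> rw [LinearMap.mem_graph_iff] at hq ⊢
    · rw [hq, hderiv]
    · rw [hq, hmul]
  exact hT.opLin_mem k (f := f) (g := T ∘ₗ f) (fun u => rfl) u

end Translation

/-! ### The kernel on the bundle -/

section BundleKernel

open SmoothFun

variable {m l k p : ℕ} {c : Vec m → Vec m → Vec m → Cl m}

theorem proj_ne_iff {x y : Vec m} : proj m l x ≠ proj m l y ↔ x - y ∉ lattice m l := by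
  rw [ne_eq, eq_comm, QuotientAddGroup.eq, neg_add_eq_sub]

theorem IsTwistedKernel.exists_isRep (hc : IsTwistedKernel m l k p c) (v : Vec m) :
    ∃ f : Vec m →ₗ[ℝ] SmoothFun (offLattice m l) (Cl m), IsRep (fun x u => c x u v) f := by
  have hsmooth : ∀ u, ContDiffOn ℝ ∞ (fun x => c x u v) (offLattice m l) := fun u =>
    (hc.smooth v).comp (contDiff_id.prodMk contDiff_const).contDiffOn fun x hx => ⟨hx, mem_univ u⟩
  have hlin : ∀ x ∉ lattice m l, ∃ L : Vec m →ₗ[ℝ] Cl m, ∀ u, c x u v = L u := fun x hx =>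
    (hc.degree_one x hx v).1
  choose L hL using hlin
  have happly : ∀ x (hx : x ∉ lattice m l) u, ofContDiffOn _ (hsmooth u) x = L x hx u :=
    fun x hx u => (ofContDiffOn_apply (hsmooth u) hx).trans (hL x hx u)
  refine ⟨{ toFun := fun u => ofContDiffOn _ (hsmooth u), map_add' := ?_, map_smul' := ?_ },
    fun x hx u => (ofContDiffOn_apply (hsmooth u) hx).symm⟩
  · exact fun u w => ext_on fun x hx => by
      rw [SmoothFun.add_apply, happly x hx, happly x hx, happly x hx, map_add]
  · exact fun a u => ext_on fun x hx => by
      rw [RingHom.id_apply, SmoothFun.smul_apply, happly x hx, happly x hx, map_smul]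

theorem IsTwistedKernel.opD_eq_zero_of_eq_comp_sub_mul (hc : IsTwistedKernel m l k p c)
    {y v : Vec m} {Y : Cl m} {F : Fun₂ m}
    (hF : ∀ x, x - y ∉ lattice m l → ∀ u, F x u = c (x - y) u v * Y) {x : Vec m}
    (hx : x - y ∉ lattice m l) (u : Vec m) : opD k F x u = 0 := by
  obtain ⟨f, hf⟩ := hc.exists_isRep v
  have hzero : opLin k f u = 0 := ext_on fun z hz => by
    rw [← hf.opD k hz u, hc.annihilated z hz u v]
    rfl
  let T := rightMul Y ∘ₗ translate (F := Cl m) (offLattice m l) y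
  have hrep : IsRep F (T ∘ₗ f) := fun z hz w => (hF z hz w).trans (congrArg (· * Y) (hf _ hz w))
  rw [hrep.opD k hx u, opLin_comp, hzero, map_zero]
  · rfl
  · exact fun w g => by
      simp only [T, LinearMap.comp_apply, dirDeriv_rightMul, dirDeriv_translate]
  · exact fun a g => (rightMul_leftMul Y a _).symm

theorem IsTwistedKernel.mk_eq_mk (hc : IsTwistedKernel m l k p c) {x₀ y₀ x y : Vec m}
    (h : proj m l x₀ ≠ proj m l y₀) (hx : proj m l x₀ = proj m l x) {Y₀ Y : Cl m}
    (hy : Bundle.mk l p y₀ Y₀ = Bundle.mk l p y Y) (u v : Vec m) :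
    Bundle.mk l p x₀ (c (x₀ - y₀) u v * Y₀) = Bundle.mk l p x (c (x - y) u v * Y) := by
  obtain ⟨a, ha, rfl⟩ := proj_eq_iff.1 hx
  obtain ⟨b, hb, rfl, rfl⟩ := Bundle.mk_eq_iff.1 hy
  have hsub : x₀ + emb m a - (y₀ + emb m b) = x₀ - y₀ + emb m (a - b) := by
    rw [map_sub]; abel
  have hsgn : sgn p (a - b) * sgn p b = sgn p a := by rw [← sgn_add, sub_add_cancel]
  refine Bundle.mk_eq_iff.2 ⟨a, ha, rfl, ?_⟩
  rw [hsub, hc.periodic _ (sub_mem ha hb) _ (proj_ne_iff.1 h), smul_mul_assoc, mul_smul_comm,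
    smul_smul, hsgn]

theorem IsTwistedKernel.exists_isProjection (hc : IsTwistedKernel m l k p c) :
    ∃ K : BundleKernel m l p, IsProjection c K := by
  have hex : ∀ (x' y' : Cyl m l) (_ : x' ≠ y') (u v : Vec m) (η : Fiber p y'),
      ∃ ξ : Fiber p x', ∀ x y Y, proj m l x = x' → η.1 = Bundle.mk l p y Y →
        ξ.1 = Bundle.mk l p x (c (x - y) u v * Y) := by
    intro x' y' h u v η
    induction x' using Quotient.inductionOn with
    | _ x₀ =>
      induction y' using Quotient.inductionOn with
      | _ y₀ =>
        obtain ⟨Y₀, rfl⟩ := Fiber.exists_rep (l := l) (p := p) y₀ η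
        exact ⟨Fiber.mk l p x₀ (c (x₀ - y₀) u v * Y₀), fun x y Y hx hy =>
          hc.mk_eq_mk h hx.symm hy u v⟩
  choose K hK using hex
  exact ⟨K, fun x y h u v Y => Subtype.ext (hK _ _ h u v _ x y Y rfl rfl)⟩

theorem IsProjection.eq {K K' : BundleKernel m l p} (hK : IsProjection c K)
    (hK' : IsProjection c K') : K = K' := by
  funext x' y' h u v η
  induction x' using Quotient.inductionOn with
  | _ x =>
    induction y' using Quotient.inductionOn with
    | _ y =>
      obtain ⟨Y, rfl⟩ := Fiber.exists_rep (l := l) (p := p) y η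
      exact (hK x y h u v Y).trans (hK' x y h u v Y).symm

theorem IsProjection.lift_sec {K : BundleKernel m l p} (hK : IsProjection c K) {x y : Vec m}
    (h : x - y ∉ lattice m l) (u v : Vec m) (Y : Cl m) :
    (K.sec (proj m l y) v (Fiber.mk l p y Y)).lift x u = c (x - y) u v * Y := by
  have hne : proj m l x ≠ proj m l y := proj_ne_iff.2 h
  rw [Sec.lift, dif_pos (show proj m l x ∈ ({proj m l y}ᶜ : Set (Cyl m l)) from hne)]
  change Fiber.coord x (K (proj m l x) (proj m l y) hne u v (Fiber.mk l p y Y)) = _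
  rw [hK x y hne u v Y, Fiber.coord_mk]

theorem IsTwistedKernel.opD_sec (hc : IsTwistedKernel m l k p c) {K : BundleKernel m l p}
    (hK : IsProjection c K) (y' : Cyl m l) (v : Vec m) (η : Fiber p y')
    (x' : ({y'}ᶜ : Set (Cyl m l))) (u : Vec m) :
    (K.sec y' v η).opD k x' u = Fiber.zero p x'.1 := by
  obtain ⟨x', hx'⟩ := x'
  induction x' using Quotient.inductionOn with
  | _ x =>
    induction y' using Quotient.inductionOn with
    | _ y =>
      obtain ⟨Y, rfl⟩ := Fiber.exists_rep (l := l) (p := p) y η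
      have hlift : opD k (K.sec (proj m l y) v (Fiber.mk l p y Y)).lift x u = 0 :=
        hc.opD_eq_zero_of_eq_comp_sub_mul (fun z hz w => hK.lift_sec hz w v Y)
          (proj_ne_iff.1 hx') u
      exact Subtype.ext (congrArg (Bundle.mk l p x) hlift)

theorem IsTwistedKernel.existsUnique_bundleKernel (hc : IsTwistedKernel m l k p c) :
    ∃! K : BundleKernel m l p, IsProjection c K ∧
      ∀ y' v η x' u, (K.sec y' v η).opD k x' u = Fiber.zero p x'.1 := by
  obtain ⟨K, hK⟩ := hc.exists_isProjection
  exact ⟨K, ⟨hK, hc.opD_sec hK⟩, fun K' hK' => hK'.1.eq hK⟩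

end BundleKernel

/-! ### Convergence of the cotangent series -/

section Cotangent

variable {m l k p : ℕ} {c₁ : ℝ} {o : Fin m} {δ : Lat m l} {x : Vec m}

theorem exists_unit_lat (hp : 1 ≤ p) (hpl : p ≤ l) (hlm : l ≤ m) :
    ∃ (o : Fin m) (δ : Lat m l), (o : ℕ) < l ∧ δ.1 = Pi.single o 1 ∧ sgn p δ.1 = -1 := by
  let o : Fin m := ⟨0, by lia⟩
  have hmem : Pi.single o 1 ∈ Lat m l := fun i hi =>
    Pi.single_eq_of_ne (by rintro rfl; exact absurd hi (by simp [o]; lia)) _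
  refine ⟨o, ⟨_, hmem⟩, show 0 < l by lia, rfl, ?_⟩
  have hsum : (∑ i : Fin m, if (i : ℕ) < p then (Pi.single o 1 : Fin m → ℤ) i else 0) = 1 := by
    rw [Finset.sum_eq_single o (fun i _ hi => by rw [Pi.single_eq_of_ne hi, ite_self])
      (fun ho => absurd (Finset.mem_univ o) ho), if_pos (show 0 < p from hp), Pi.single_eq_same]
  rw [sgn, hsum, zpow_one]

theorem convergesNormallyOn_twistTerm (hkm : k < m) (hl : l + k + 1 ≤ m) (u v : Vec m) :
    ConvergesNormallyOn (twistTerm m l k p c₁ u v) (lattice m l : Set (Vec m))ᶜ := fun _ hKl hK =>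
  (decay_E (l := l + 1) (by lia) hkm c₁ u v).exists_summable_bound_twist p hK hKl

theorem cot_eq_periodize (hkm : k < m) (hl : l + k + 1 ≤ m) (hδ : sgn p δ.1 = -1)
    (hx : x ∉ lattice m l) (u v : Vec m) :
    cot m l k p c₁ x u v = periodize p δ (fun y => E m k c₁ y u v) x :=
  ((decay_E (l := l + 1) (by lia) hkm c₁ u v).periodize_eq_tsum hδ hx).symm

theorem tendstoUniformlyOn_symPartial (hkm : k < m) (hl : l + k ≤ m) (ho : (o : ℕ) < l)
    (hδo : δ.1 = Pi.single o 1) (hδ : sgn p δ.1 = -1) (u v : Vec m) {K : Set (Vec m)}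
    (hK : IsCompact K) (hKl : K ⊆ (lattice m l : Set (Vec m))ᶜ) :
    TendstoUniformlyOn (symPartial m l k p c₁ u v) (periodize p δ fun y => E m k c₁ y u v)
      atTop K :=
  ((decay_E hl hkm c₁ u v).tendstoUniformlyOn_sum_latBox ho hδo hδ hK hKl).congr
    (Eventually.of_forall fun N x _ => (symPartial_eq_sum_latBox k N c₁ u v x).symm)

theorem cotSym_eq_periodize (hkm : k < m) (hl : l + k ≤ m) (ho : (o : ℕ) < l)
    (hδo : δ.1 = Pi.single o 1) (hδ : sgn p δ.1 = -1) (hx : x ∉ lattice m l) (u v : Vec m) :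
    cotSym m l k p c₁ x u v = periodize p δ (fun y => E m k c₁ y u v) x :=
  ((tendstoUniformlyOn_symPartial hkm hl ho hδo hδ u v isCompact_singleton
    (singleton_subset_iff.2 hx)).tendsto_at rfl).limUnder_eq

theorem tendstoLocallyUniformlyOn_symPartial (hkm : k < m) (hl : l + k ≤ m) (ho : (o : ℕ) < l)
    (hδo : δ.1 = Pi.single o 1) (hδ : sgn p δ.1 = -1) (u v : Vec m) :
    TendstoLocallyUniformlyOn (symPartial m l k p c₁ u v) (fun x => cotSym m l k p c₁ x u v) atTop
      (lattice m l : Set (Vec m))ᶜ := by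
  rw [tendstoLocallyUniformlyOn_iff_forall_isCompact (isClosed_lattice m l).isOpen_compl]
  exact fun K hKl hK => (tendstoUniformlyOn_symPartial hkm hl ho hδo hδ u v hK hKl).congr_right
    fun x hx => (cotSym_eq_periodize hkm hl ho hδo hδ (hKl hx) u v).symm

theorem convergesNormallyOn_symTerm (hk : Odd k) (hkm : k < m) (hl : l + k ≤ m) (u v : Vec m) :
    ConvergesNormallyOn (fun a : latPos m l => symTerm m k p c₁ u v a)
      (lattice m l : Set (Vec m))ᶜ := fun _ hKl hK =>
  exists_summable_bound_symTerm hk hl hkm p c₁ u v hK hKl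

theorem cotSym_eq_tsum (hk : Odd k) (hkm : k < m) (hl : l + k ≤ m) (hx : x ∉ lattice m l)
    (u v : Vec m) : cotSym m l k p c₁ x u v
      = E m k c₁ x u v + ∑' a : latPos m l, symTerm m k p c₁ u v a x := by
  obtain ⟨b, hb, hbound⟩ := convergesNormallyOn_symTerm (p := p) (c₁ := c₁) hk hkm hl u v {x}
    (singleton_subset_iff.2 hx) isCompact_singleton
  have hs : Summable fun a : latPos m l => symTerm m k p c₁ u v a x :=
    Summable.of_norm_bounded hb fun a => hbound a x rfl
  exact ((tendsto_sum_posBox (h := fun a => symTerm m k p c₁ u v a x) hs.hasSum).const_add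
    (E m k c₁ x u v)).limUnder_eq

end Cotangent

end SpinCylinder

end

theorem mainTheorem3 (m k : ℕ) (hk : 1 ≤ k) (hkm : k < m) (c₁ : ℝ) (hc₁ : c₁ ≠ 0) :
    -- `Z₁` is the reproducing kernel
    (IsReproducingKernel m k (Z₁ m k) ∧ ∀ Z, IsReproducingKernel m k Z → Z = Z₁ m k) ∧
    -- the case `1 ≤ l ≤ m - k - 1`
    (∀ l p : ℕ, 1 ≤ p → p ≤ l → l + k + 1 ≤ m →
      (∀ u v, ConvergesNormallyOn (twistTerm m l k p c₁ u v) (lattice m l : Set (Vec m))ᶜ) ∧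
      IsTwistedKernel m l k p (cot m l k p c₁) ∧
      ∃! K : BundleKernel m l p, IsProjection (cot m l k p c₁) K ∧
        ∀ y' v η x' u, (K.sec y' v η).opD k x' u = Fiber.zero p x'.1) ∧
    -- the case `l = m - k`
    (∀ l p : ℕ, 1 ≤ p → p ≤ l → l + k = m →
      (∀ u v, TendstoLocallyUniformlyOn (symPartial m l k p c₁ u v)
        (fun x => cotSym m l k p c₁ x u v) Filter.atTop (lattice m l : Set (Vec m))ᶜ) ∧
      (Odd k → ∀ u v,
        ConvergesNormallyOn (fun a : latPos m l => symTerm m k p c₁ u v a)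
          (lattice m l : Set (Vec m))ᶜ ∧
        ∀ x ∉ lattice m l, cotSym m l k p c₁ x u v =
          E m k c₁ x u v + ∑' a : latPos m l, symTerm m k p c₁ u v a x) ∧
      IsTwistedKernel m l k p (cotSym m l k p c₁) ∧
      ∃! K : BundleKernel m l p, IsProjection (cotSym m l k p c₁) K ∧
        ∀ y' v η x' u, (K.sec y' v η).opD k x' u = Fiber.zero p x'.1) := by
  have hm : 0 < m := by lia
  refine ⟨⟨isReproducingKernel_Z₁ hm, fun Z hZ => hZ.unique (isReproducingKernel_Z₁ hm)⟩,
    fun l p hp hpl hl => ?_, fun l p hp hpl hl => ?_⟩ <;>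
    obtain ⟨o, δ, ho, hδo, hδ⟩ := exists_unit_lat hp hpl (by lia : l ≤ m)
  · have hker : IsTwistedKernel m l k p (cot m l k p c₁) :=
      isTwistedKernel_of_periodize hk hkm (by lia) fun x hx u v => cot_eq_periodize hkm hl hδ hx u v
    exact ⟨convergesNormallyOn_twistTerm hkm hl, hker, hker.existsUnique_bundleKernel⟩
  · have hker : IsTwistedKernel m l k p (cotSym m l k p c₁) :=
      isTwistedKernel_of_periodize hk hkm hl.le fun x hx u v =>
        cotSym_eq_periodize hkm hl.le ho hδo hδ hx u v
    exact ⟨tendstoLocallyUniformlyOn_symPartial hkm hl.le ho hδo hδ, fun hodd u v =>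
      ⟨convergesNormallyOn_symTerm hodd hkm hl.le u v, fun x hx =>
        cotSym_eq_tsum hodd hkm hl.le hx u v⟩, hker, hker.existsUnique_bundleKernel⟩
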